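/- \textbf{Theorem (Hopf--Cole transform).} Let $H$ be a real separable Hilbert space, $T,\sigma>0$, let $A$ be the (possibly unbounded) generator of a strongly continuous semigroup $(e^{tA})_{t\ge 0}$ on $H$, and let $Q$ be a nonnegative self-adjoint trace-class operator with nonnegative square root $Q^{1/2}$. Put $Q_t=\int_0^t e^{sA}Q(e^{sA})^*\,ds$, and let $G:H\to\mathbb R$ be measurable with $e^{-G}$ integrable with respect to the Gaussian measure $\mathcal N(e^{tA}x,\sigma^2Q_t)$ for all $t\in[0,T]$, $x\in H$. Define $$h(t,x)=\int_H e^{-G(z)}\,\mathcal N(e^{(T-t)A}x,\sigma^2Q_{T-t})(dz),\qquad V=-\log h,$$ so that $h(t,x)=\mathbb E[e^{-G}(X_T)\mid X_t=x]$ for the solution of $dX=AX\,dt+\sigma\,dW^Q$. For functions on $[0,T]\times H$ put $$Lf(t,x)=\langle x,A^*D_xf(t,x)\rangle+\tfrac12\mathrm{Tr}\big[\sigma^2Q\,D_{xx}f(t,x)\big].$$ Say that $f$ is \emph{of class $C^{1,2}$} if it is continuous on $[0,T]\times H$, if on $(0,T)\times H$ it is differentiable in $t$ and twice differentiable in $x$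 with $D_xf\in D(A^*)$, and if $\partial_tf$, $D_xf$, $D_{xx}f$, $A^*D_xf$ are continuous on $(0,T)\times H$. Say that $f$ is \emph{regular} if moreover $f$ (respectively $\partial_tf,D_xf,D_{xx}f$) is uniformly continuous on bounded subsets of $[0,T]\times H$ (respectively $(0,T)\times H$) and $|f|+\|D_xf\|+|\partial_tf|+\|D_{xx}f\|+\|A^*D_xf\|\le C(1+\|x\|)^m$ on $(0,T)\times H$ for some constants $C,m$. Solutions of PDEs are classical, i.e. of class $C^{1,2}$, the equation holding on $(0,T)\times H$. Put $$\alpha^\star(t,x)=\sigma Q^{1/2}D_x\log h(t,x).$$ (a) If $h$ is regular, then $h$ solves the Kolmogorov backward equation $\partial_th+Lh=0$, $h(T,\cdot)=e^{-G}$. (b) Whenever $h$ solves the Kolmogorov backward equation, $V$ solves the Hamilton--Jacobi--Bellman equation $$\partial_tV+LV-\tfrac12\|\sigma Q^{1/2}D_xV\|^2=0,\qquad V(T,\cdot)=G .$$ Moreover, on $(0,T)\times H$, $\alpha^\star=-\sigma Q^{1/2}D_xV=\sigma Q^{1/2}D_xh/h$ and $\sigma Q^{1/2}\alpha^\star=\sigma^2Q\,D_x\log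 h$; $\alpha^\star(t,x)$ is the unique minimiser over $a\in H$ of $\langle a,\sigma Q^{1/2}D_xV(t,x)\rangle+\frac12\|a\|^2$, and $\partial_tV+LV+\inf_{a\in H}[\langle a,\sigma Q^{1/2}D_xV\rangle+\frac12\|a\|^2]=0$. For every $f$ of class $C^{1,2}$, $$h^{-1}(\partial_t+L)(hf)=\partial_tf+Lf+\langle\sigma Q^{1/2}\alpha^\star,D_xf\rangle ,$$ i.e. the operator of the equation controlled by $\alpha^\star$ is Doob's $h$-transform of $\partial_t+L$. (c) Suppose that $h$ and $V$ are regular, and let $(t_0,x_0)\in[0,T]\times H$. On a filtered probability space $(\Omega,(\mathcal F_s)_{t_0\le s\le T},P)$, call a pair $(\alpha,X)$ \emph{admissible} if $\alpha$ is an $H$-valued progressively measurable process with $\mathbb E\int_{t_0}^T\|\alpha_s\|^2ds<\infty$ and $X$ is a continuous adapted process with $X_{t_0}=x_0$ a.s. and $\sup_s\mathbb E\|X_s\|^n<\infty$ for all $n\in\mathbb N$ that is a weak solution of $dX_s=(AX_s+\sigma Q^{1/2}\alpha_s)ds+\sigma\,dW^Q_s$ in the sense of the martingale problem: $f(s,X_s)-\int_{t_0}^s(\partial_tf+Lf+\langle\sigma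 Q^{1/2}\alpha_r,D_xf\rangle)(r,X_r)\,dr$ is a martingale for every regular $f$. Let $J(\alpha,X)=\mathbb E\big[\int_{t_0}^T\frac12\|\alpha_s\|^2ds+G(X_T)\big]$. Then for every admissible pair the random variable in $J$ is integrable, $V(t_0,x_0)\le J(\alpha,X)$, and equality holds if and only if $\alpha_s=\alpha^\star(s,X_s)$ for almost every $(s,\omega)$. If $(0,X)$ is admissible under $P$ (the uncontrolled process), then $h(s,X_s)=\mathbb E[e^{-G(X_T)}\mid\mathcal F_s]$ a.s. for $s\in[t_0,T]$; and Doob's $h$-transform $dP^h=\frac{h(T,X_T)}{h(t_0,x_0)}dP$ is a probability measure under which $(\alpha^\star(\cdot,X),X)$ is admissible, with cost $J=V(t_0,x_0)$. -/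

import Mathlib

open MeasureTheory ProbabilityTheory Set Filter Topology
open scoped ENNReal

namespace HopfCole

noncomputable section

section Operators

variable {H : Type*} [NormedAddCommGroup H] [InnerProductSpace ℝ H] [CompleteSpace H]

/-- `S` (restricted to `[0, ∞)`) is a strongly continuous semigroup of bounded operators; the
values at negative times play no role. -/
structure IsC0Semigroup (S : ℝ → H →L[ℝ] H) : Prop where
  zero : S 0 = ContinuousLinearMap.id ℝ H
  add : ∀ s t : ℝ, 0 ≤ s → 0 ≤ t → S (s + t) = S s ∘L S t
  continuousOn : ∀ x : H, ContinuousOn (fun t => S t x) (Ici 0)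

/-- The (possibly unbounded) operator `A` is the infinitesimal generator of `S`, so that
`S t = exp (t A)`: a vector `x` is in the domain of `A` with `A x = y` iff
`(S t x - x) / t → y` as `t → 0+`. -/
def IsGenerator (S : ℝ → H →L[ℝ] H) (A : H →ₗ.[ℝ] H) : Prop :=
  ∀ x y : H, (x, y) ∈ A.graph ↔
    Tendsto (fun t : ℝ => t⁻¹ • (S t x - x)) (𝓝[>] 0) (𝓝 y)

/-- The adjoint `A* p` of an unbounded operator, and `0` when `p` is not in the domain of `A*`
(the definitions below ask for membership in the domain wherever it is used). -/
def adjApply (A : H →ₗ.[ℝ] H) (p : H) : H :=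
  open Classical in if hp : p ∈ A.adjoint.domain then A.adjoint ⟨p, hp⟩ else 0

/-- The index set of a fixed Hilbert basis of `H`. -/
def basisIndex (H : Type*) [NormedAddCommGroup H] [InnerProductSpace ℝ H] [CompleteSpace H] :
    Set H := (exists_hilbertBasis ℝ H).choose

/-- A fixed Hilbert (complete orthonormal) basis of `H`. -/
def basis (H : Type*) [NormedAddCommGroup H] [InnerProductSpace ℝ H] [CompleteSpace H] :
    HilbertBasis (basisIndex H) ℝ H := (exists_hilbertBasis ℝ H).choose_spec.choose

/-- The trace `∑ₖ ⟨eₖ, B eₖ⟩` (independent of the basis when `B` is trace class). -/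
def opTrace (B : H →L[ℝ] H) : ℝ := ∑' i, inner ℝ (basis H i) (B (basis H i))

/-- A nonnegative self-adjoint operator of finite trace, i.e. a covariance operator. -/
structure IsCovarianceOperator (Q : H →L[ℝ] H) : Prop where
  isPositive : Q.IsPositive
  summable : Summable fun i => inner ℝ (basis H i) (Q (basis H i))

/-- `R` is the nonnegative self-adjoint square root `Q^{1/2}` of `Q`. -/
structure IsPosSqrt (R Q : H →L[ℝ] H) : Prop where
  isPositive : R.IsPositive
  sq : R ∘L R = Q

/-- `Q_t = ∫₀ᵗ e^{sA} Q (e^{sA})* ds`. -/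
def convCov (S : ℝ → H →L[ℝ] H) (Q : H →L[ℝ] H) (t : ℝ) : H →L[ℝ] H :=
  ∫ s in (0 : ℝ)..t, S s ∘L Q ∘L ContinuousLinearMap.adjoint (S s)

/-! ### Derivatives of functions on `[0, T] × H` -/

/-- `∂_t f (t, x)`. -/
def dt (f : ℝ → H → ℝ) (t : ℝ) (x : H) : ℝ := deriv (fun s => f s x) t

/-- `D_x f (t, x)`, as a vector of `H`. -/
def Dx (f : ℝ → H → ℝ) (t : ℝ) (x : H) : H := gradient (f t) x

/-- `D_xx f (t, x)`, as a bounded operator on `H`. -/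
def Dxx (f : ℝ → H → ℝ) (t : ℝ) (x : H) : H →L[ℝ] H := fderiv ℝ (fun y => Dx f t y) x

/-- The operator
`L f (t, x) = ⟨x, A* D_x f (t, x)⟩ + (1 / 2) Tr [σ² Q D_xx f (t, x)]`. -/
def genL (A : H →ₗ.[ℝ] H) (Q : H →L[ℝ] H) (σ : ℝ) (f : ℝ → H → ℝ) (t : ℝ) (x : H) : ℝ :=
  inner ℝ x (adjApply A (Dx f t x)) + 1 / 2 * opTrace (σ ^ 2 • (Q ∘L Dxx f t x))

/-- Functions of class `C^{1,2}` for which `∂_t f` and `L f` make classical sense. -/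
structure IsC12 (A : H →ₗ.[ℝ] H) (T : ℝ) (f : ℝ → H → ℝ) : Prop where
  cont : ContinuousOn (fun p : ℝ × H => f p.1 p.2) (Icc 0 T ×ˢ univ)
  diff_t : ∀ t ∈ Ioo 0 T, ∀ x, DifferentiableAt ℝ (fun s => f s x) t
  diff_x : ∀ t ∈ Ioo 0 T, Differentiable ℝ (f t)
  diff_xx : ∀ t ∈ Ioo 0 T, Differentiable ℝ (fun y => Dx f t y)
  mem_adjoint : ∀ t ∈ Ioo 0 T, ∀ x, Dx f t x ∈ A.adjoint.domain
  cont_dt : ContinuousOn (fun p : ℝ × H => dt f p.1 p.2) (Ioo 0 T ×ˢ univ)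
  cont_Dx : ContinuousOn (fun p : ℝ × H => Dx f p.1 p.2) (Ioo 0 T ×ˢ univ)
  cont_Dxx : ContinuousOn (fun p : ℝ × H => Dxx f p.1 p.2) (Ioo 0 T ×ˢ univ)
  cont_adj : ContinuousOn (fun p : ℝ × H => adjApply A (Dx f p.1 p.2)) (Ioo 0 T ×ˢ univ)

/-- The regularity and growth class in which value functions are considered: `f` and its
derivatives are uniformly continuous on bounded sets, and they and `A* D_x f` grow at most
polynomially. -/
structure IsRegular (A : H →ₗ.[ℝ] H) (T : ℝ) (f : ℝ → H → ℝ) : Prop extends IsC12 A T f where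
  unif : ∀ r, UniformContinuousOn (fun p : ℝ × H => f p.1 p.2)
    (Icc 0 T ×ˢ Metric.closedBall 0 r)
  unif_dt : ∀ r, UniformContinuousOn (fun p : ℝ × H => dt f p.1 p.2)
    (Ioo 0 T ×ˢ Metric.closedBall 0 r)
  unif_Dx : ∀ r, UniformContinuousOn (fun p : ℝ × H => Dx f p.1 p.2)
    (Ioo 0 T ×ˢ Metric.closedBall 0 r)
  unif_Dxx : ∀ r, UniformContinuousOn (fun p : ℝ × H => Dxx f p.1 p.2)
    (Ioo 0 T ×ˢ Metric.closedBall 0 r)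
  growth : ∃ (C : ℝ) (m : ℕ), ∀ t ∈ Ioo 0 T, ∀ x,
    |f t x| + ‖Dx f t x‖ + |dt f t x| + ‖Dxx f t x‖ + ‖adjApply A (Dx f t x)‖
      ≤ C * (1 + ‖x‖) ^ m

/-- `f` is a classical solution of the Kolmogorov backward equation
`∂_t f + L f = 0` on `(0, T) × H`, `f (T, ·) = φ`. -/
structure SolvesKBE (A : H →ₗ.[ℝ] H) (Q : H →L[ℝ] H) (σ T : ℝ) (φ : H → ℝ)
    (f : ℝ → H → ℝ) : Prop where
  isC12 : IsC12 A T f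
  eqn : ∀ t ∈ Ioo 0 T, ∀ x, dt f t x + genL A Q σ f t x = 0
  terminal : ∀ x, f T x = φ x

/-- `f` is a classical solution of the Hamilton-Jacobi-Bellman equation
`∂_t f + L f - (1 / 2) ‖σ Q^{1/2} D_x f‖² = 0` on `(0, T) × H`, `f (T, ·) = G`;
`R` stands for `Q^{1/2}`. -/
structure SolvesHJB (A : H →ₗ.[ℝ] H) (Q R : H →L[ℝ] H) (σ T : ℝ) (G : H → ℝ)
    (f : ℝ → H → ℝ) : Prop where
  isC12 : IsC12 A T f
  eqn : ∀ t ∈ Ioo 0 T, ∀ x,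
    dt f t x + genL A Q σ f t x - 1 / 2 * ‖σ • R (Dx f t x)‖ ^ 2 = 0
  terminal : ∀ x, f T x = G x

end Operators

section Laws

variable {H : Type*} [NormedAddCommGroup H] [InnerProductSpace ℝ H] [CompleteSpace H]
  [MeasurableSpace H] [BorelSpace H] [SecondCountableTopology H]

/-- `μ` is the Gaussian measure on `H` with mean `m` and covariance operator `C`. -/
structure IsGaussianWith (μ : Measure H) (m : H) (C : H →L[ℝ] H) : Prop where
  isGaussian : IsGaussian μ
  mean : ∀ u : H, ∫ z, inner ℝ z u ∂μ = inner ℝ m u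
  covariance : ∀ u v : H,
    ∫ z, inner ℝ (z - m) u * inner ℝ (z - m) v ∂μ = inner ℝ u (C v)

/-- There is at most one Gaussian measure with given mean and covariance. -/
theorem IsGaussianWith.unique {μ ν : Measure H} {m : H} {C : H →L[ℝ] H}
    (hμ : IsGaussianWith μ m C) (hν : IsGaussianWith ν m C) : μ = ν := by
  have key : ∀ ρ : Measure H, IsGaussianWith ρ m C → ∀ u : H,
      charFun ρ u = Complex.exp ((inner ℝ m u : ℝ) * Complex.I - (inner ℝ u (C u) : ℝ) / 2) := by
    intro ρ hρ u
    have := hρ.isGaussian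
    have hm : ∫ z, inner ℝ u z ∂ρ = inner ℝ m u := by
      simp_rw [real_inner_comm _ u]; exact hρ.mean u
    have hv : Var[fun z => inner ℝ u z; ρ] = inner ℝ u (C u) := by
      rw [variance_eq_integral (by fun_prop), hm, ← hρ.covariance u u]
      refine integral_congr_ae (Eventually.of_forall fun z => ?_)
      simp only [inner_sub_left, real_inner_comm z u]
      ring
    rw [IsGaussian.charFun_eq, integral_complex_ofReal, hm, hv]
  have := hμ.isGaussian
  have := hν.isGaussian
  exact Measure.ext_of_charFun (funext fun u => (key μ hμ u).trans (key ν hν u).symm)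

/-- The Gaussian measure `N(m, C)` (and `0` if `C` is not a covariance operator). -/
def gaussianLaw (m : H) (C : H →L[ℝ] H) : Measure H :=
  open Classical in if h : ∃ μ, IsGaussianWith μ m C then h.choose else 0

/-- The law `N(e^{tA} x, σ² Q_t)` at time `t` of the solution, started at `x`, of
`dX = A X dt + σ dW^Q`. -/
def transitionLaw (S : ℝ → H →L[ℝ] H) (Q : H →L[ℝ] H) (σ t : ℝ) (x : H) : Measure H :=
  gaussianLaw (S t x) (σ ^ 2 • convCov S Q t)

/-- `h (t, x) = ∫ e^{-G(z)} N(e^{(T-t)A} x, σ² Q_{T-t})(dz) = E [e^{-G}(X_T) | X_t = x]`. -/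
def hFun (S : ℝ → H →L[ℝ] H) (Q : H →L[ℝ] H) (σ T : ℝ) (G : H → ℝ) (t : ℝ) (x : H) : ℝ :=
  ∫ z, Real.exp (-G z) ∂(transitionLaw S Q σ (T - t) x)

/-- `V = -log h`. -/
def VFun (S : ℝ → H →L[ℝ] H) (Q : H →L[ℝ] H) (σ T : ℝ) (G : H → ℝ) (t : ℝ) (x : H) : ℝ :=
  -Real.log (hFun S Q σ T G t x)

/-- The feedback control `α* (t, x) = σ Q^{1/2} D_x log h (t, x)`; `R` stands for `Q^{1/2}`. -/
def optFeedback (R : H →L[ℝ] H) (σ : ℝ) (h : ℝ → H → ℝ) (t : ℝ) (x : H) : H :=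
  σ • R (Dx (fun s y => Real.log (h s y)) t x)

/-- Under `P`, the process `X` started at `x₀` at time `t₀` is a weak solution on `[t₀, T]` of the
controlled equation
`dX_s = (A X_s + σ Q^{1/2} α_s) ds + σ dW^Q_s`,
in the sense of the martingale problem with test functions in the class `IsRegular`, where `α` is a
square-integrable progressively measurable control and the moments of `X` are finite (so that the
expectations of functions of polynomial growth exist). `R` stands for `Q^{1/2}`. -/
structure IsControlled (A : H →ₗ.[ℝ] H) (Q R : H →L[ℝ] H) (σ T t₀ : ℝ) (x₀ : H)
    {Ω : Type*} {mΩ : MeasurableSpace Ω} (P : Measure Ω) (𝓕 : Filtration (Icc t₀ T) mΩ)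
    (α X : ℝ → Ω → H) : Prop where
  progressive : IsStronglyProgressive 𝓕 (fun (s : Icc t₀ T) ω => α s ω)
  square_integrable :
    Integrable (fun p : ℝ × Ω => ‖α p.1 p.2‖ ^ 2) ((volume.restrict (Icc t₀ T)).prod P)
  adapted : StronglyAdapted 𝓕 (fun (s : Icc t₀ T) ω => X s ω)
  continuous_paths : ∀ ω, ContinuousOn (fun s => X s ω) (Icc t₀ T)
  initial : ∀ᵐ ω ∂P, X t₀ ω = x₀
  moments : ∀ n : ℕ, ∃ C : ℝ, ∀ s ∈ Icc t₀ T,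
    Integrable (fun ω => ‖X s ω‖ ^ n) P ∧ ∫ ω, ‖X s ω‖ ^ n ∂P ≤ C
  martingale_problem : ∀ f : ℝ → H → ℝ, IsRegular A T f →
    Martingale (fun (s : Icc t₀ T) ω => f s (X s ω) -
      ∫ r in t₀..s, (dt f r (X r ω) + genL A Q σ f r (X r ω)
        + inner ℝ (σ • R (α r ω)) (Dx f r (X r ω)))) 𝓕 P

/-- The cost of a control over `[t₀, T]` on one trajectory: the running cost
`R(α) = (1 / 2) ‖α‖²` plus the terminal cost `G (X_T)`. -/
def pathCost {Ω : Type*} (T t₀ : ℝ) (G : H → ℝ) (α X : ℝ → Ω → H) (ω : Ω) : ℝ :=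
  (∫ s in t₀..T, 1 / 2 * ‖α s ω‖ ^ 2) + G (X T ω)

/-- The objective functional `J = E [∫_{t₀}^T (1 / 2) ‖α_s‖² ds + G (X_T)]`. -/
def cost {Ω : Type*} {mΩ : MeasurableSpace Ω} (P : Measure Ω) (T t₀ : ℝ) (G : H → ℝ)
    (α X : ℝ → Ω → H) : ℝ :=
  ∫ ω, pathCost T t₀ G α X ω ∂P

end Laws

end

end HopfCole

/-! For (a), the Chapman-Kolmogorov equation gives h(t-ε, x) = ∫ h(t, S_ε x + z) N(0, σ²Q_ε)(dz)
(`hFun_sub`). Divide the increment by ε and split it at h(t, S_ε x). The drift part tends to ⟨x,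
A*D_x h⟩ even though x need not lie in D(A): by the mean value theorem it is ⟨S_ε x - x, p⟩ with p a
gradient in D(A*), and this equals ⟨∫₀^ε S_s x ds, A*p⟩ because the integral lies in D(A)
(`IsGenerator.inner_sub`, `IsGenerator.tendsto_drift`). In the diffusion part, the second-order
Taylor term has mean ½σ² Tr[Q_ε D_xx h], and Q_ε/ε → Q in the trace pairing. The remainder is o(ε),
since Gaussian moments of order 2k are O(ε^k) with a constant given by Fernique's argument
(`tendsto_diffusion`). The left-hand side tends to -∂_t h.

Everything here rests on the Gaussian laws being genuine: `gaussianLaw` is 0 when no Gaussian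
measure exists, so one is built for each positive operator of finite trace as the law of an
L²-convergent series of independent normal variables (`exists_charFun_eq`). The continuity of s ↦
S_s Q S_s* in operator norm, hence the meaning of Q_t, comes from the Hilbert-Schmidt property of
Q^{1/2}.

Part (b) is calculus. The Hessian of -log h contains a rank-one term whose trace against Q is
‖Q^{1/2}D_x h‖²/h², the nonlinearity of the HJB equation (`IsC12.genL_neg_log`). The product rule
for L has the cross term σ²⟨Q^{1/2}D_x h, Q^{1/2}D_x f⟩, which is h times the controlled drift
(`SolvesKBE.doob_transform`). The minimiser comes from completing a square.

For (c), the martingale problem is applied to V. By the HJB equation its drift is ½‖α - α*‖² -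
½‖α‖², so J = V(t₀, x₀) + ½E∫‖α - α*‖² exactly (`IsControlled.cost_formula`); inequality and
equality case are read off. Under zero control h(s, X_s) is a positive martingale. The martingale
problem for f under P^h follows, by Bayes' formula, from the one for h f under P
(`IsControlled.martingale_doobMeasure`), so the transformed process is controlled by α* and is
optimal by the equality case. -/

set_option linter.unusedSectionVars false

namespace HopfCole

/-! ### Hilbert-Schmidt operators and the trace pairing with Q. -/

section HilbertSchmidt

variable {H : Type*} [NormedAddCommGroup H] [InnerProductSpace ℝ H] [CompleteSpace H]

theorem hasSum_inner_sq {ι : Type*} {K : Type*} [NormedAddCommGroup K] [InnerProductSpace ℝ K]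
    [CompleteSpace K] (b : HilbertBasis ι ℝ K) (x : K) :
    HasSum (fun i => (inner ℝ (b i) x) ^ 2) (‖x‖ ^ 2) := by
  have := b.hasSum_inner_mul_inner x x
  rw [real_inner_self_eq_norm_sq] at this
  refine this.congr_fun fun i => ?_
  rw [real_inner_comm x (b i)]; ring

/-- The square of the Hilbert-Schmidt norm. -/
noncomputable def hsq (M : H →L[ℝ] H) : ℝ := ∑' i, ‖M (basis H i)‖ ^ 2

/-- `M` is a Hilbert-Schmidt operator. -/
def IsHS (M : H →L[ℝ] H) : Prop := Summable fun i => ‖M (basis H i)‖ ^ 2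

theorem hsq_nonneg (M : H →L[ℝ] H) : 0 ≤ hsq M := tsum_nonneg fun _ => sq_nonneg _

/-- By Parseval, both norms are the double sum of ⟨e_i, M e_k⟩², taken in the two orders. -/
theorem IsHS.hasSum_adjoint {M : H →L[ℝ] H} (hM : IsHS M) :
    HasSum (fun i => ‖M.adjoint (basis H i)‖ ^ 2) (hsq M) := by
  have h1 : ∀ k, HasSum (fun i => (inner ℝ (basis H i) (M (basis H k))) ^ 2)
      (‖M (basis H k)‖ ^ 2) := fun k => hasSum_inner_sq _ _
  have hs : Summable fun p : basisIndex H × basisIndex H =>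
      (inner ℝ (basis H p.2) (M (basis H p.1))) ^ 2 := by
    rw [summable_prod_of_nonneg fun _ => sq_nonneg _]
    refine ⟨fun k => (h1 k).summable, ?_⟩
    simp only [(h1 _).tsum_eq]
    exact hM
  have h2 : HasSum (fun p : basisIndex H × basisIndex H =>
      (inner ℝ (basis H p.2) (M (basis H p.1))) ^ 2) (hsq M) := by
    have := hs.hasSum.prod_fiberwise h1
    rw [hsq, this.tsum_eq]
    exact hs.hasSum
  have h3 := ((Equiv.prodComm _ _).hasSum_iff (a := hsq M)).2 h2
  refine h3.prod_fiberwise fun i => ?_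
  refine (hasSum_inner_sq (basis H) (M.adjoint (basis H i))).congr_fun fun k => ?_
  simp [ContinuousLinearMap.adjoint_inner_right, real_inner_comm]

theorem IsHS.comp_left {M : H →L[ℝ] H} (hM : IsHS M) (B : H →L[ℝ] H) : IsHS (B ∘L M) := by
  refine Summable.of_nonneg_of_le (fun _ => sq_nonneg _) (fun i => ?_) (hM.mul_left (‖B‖ ^ 2))
  rw [← mul_pow]
  exact pow_le_pow_left₀ (norm_nonneg _) (B.le_opNorm _) 2

theorem IsHS.hsq_comp_left_le {M : H →L[ℝ] H} (hM : IsHS M) (B : H →L[ℝ] H) :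
    hsq (B ∘L M) ≤ ‖B‖ ^ 2 * hsq M := by
  rw [hsq, hsq, ← tsum_mul_left]
  refine (hM.comp_left B).tsum_le_tsum (fun i => ?_) (hM.mul_left (‖B‖ ^ 2))
  rw [← mul_pow]
  exact pow_le_pow_left₀ (norm_nonneg _) (B.le_opNorm _) 2

theorem IsHS.sub {M N : H →L[ℝ] H} (hM : IsHS M) (hN : IsHS N) : IsHS (M - N) := by
  refine Summable.of_nonneg_of_le (fun _ => sq_nonneg _) (fun i => ?_)
    ((hM.mul_left 2).add (hN.mul_left 2))
  have := norm_sub_le (M (basis H i)) (N (basis H i))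
  rw [sub_apply]
  nlinarith [sq_nonneg (‖M (basis H i)‖ - ‖N (basis H i)‖), norm_nonneg (M (basis H i) - N (basis H i)),
    norm_nonneg (M (basis H i)), norm_nonneg (N (basis H i))]

theorem IsHS.norm_le {M : H →L[ℝ] H} (hM : IsHS M) : ‖M‖ ≤ √(hsq M) := by
  refine M.opNorm_le_bound (Real.sqrt_nonneg _) fun x => ?_
  have h1 := hasSum_inner_sq (basis H) (M x)
  have h2 := hM.hasSum_adjoint.mul_right (‖x‖ ^ 2)
  have h3 : ‖M x‖ ^ 2 ≤ hsq M * ‖x‖ ^ 2 := by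
    refine hasSum_le (fun i => ?_) h1 h2
    rw [← ContinuousLinearMap.adjoint_inner_left, ← mul_pow]
    exact sq_le_sq' (by linarith [neg_le_of_abs_le (abs_real_inner_le_norm (M.adjoint (basis H i)) x)])
      (real_inner_le_norm _ _)
  calc ‖M x‖ = √(‖M x‖ ^ 2) := (Real.sqrt_sq (norm_nonneg _)).symm
    _ ≤ √(hsq M * ‖x‖ ^ 2) := Real.sqrt_le_sqrt h3
    _ = √(hsq M) * ‖x‖ := by rw [Real.sqrt_mul (hsq_nonneg _), Real.sqrt_sq (norm_nonneg _)]

/-- Cauchy-Schwarz for the Hilbert-Schmidt pairing behind Tr[M N* B]. The bound does not depend on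
the finite set, so it gives absolute convergence, the continuity of the trace in B, and the
short-time estimate on Q_ε. -/
theorem IsHS.sum_abs_inner_le {M N : H →L[ℝ] H} (hM : IsHS M) (hN : IsHS N) (B : H →L[ℝ] H)
    (F : Finset (basisIndex H)) :
    ∑ i ∈ F, |inner ℝ (basis H i) (M (N.adjoint (B (basis H i))))| ≤
      √(hsq M) * √(hsq N) * ‖B‖ := by
  set N' := B.adjoint ∘L N with hN'def
  have hN' : IsHS N' := hN.comp_left _
  have hle : hsq N' ≤ ‖B‖ ^ 2 * hsq N := by
    simpa using hN.hsq_comp_left_le B.adjoint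
  have hadj : ∀ x, N'.adjoint x = N.adjoint (B x) := fun x => by
    simp [hN'def, ContinuousLinearMap.adjoint_comp]
  calc ∑ i ∈ F, |inner ℝ (basis H i) (M (N.adjoint (B (basis H i))))|
      ≤ ∑ i ∈ F, ‖M.adjoint (basis H i)‖ * ‖N'.adjoint (basis H i)‖ := by
        refine Finset.sum_le_sum fun i _ => ?_
        rw [← ContinuousLinearMap.adjoint_inner_left, hadj]
        exact abs_real_inner_le_norm _ _
    _ ≤ √(∑ i ∈ F, ‖M.adjoint (basis H i)‖ ^ 2) * √(∑ i ∈ F, ‖N'.adjoint (basis H i)‖ ^ 2) :=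
        Real.sum_mul_le_sqrt_mul_sqrt _ _ _
    _ ≤ √(hsq M) * √(‖B‖ ^ 2 * hsq N) := by
        gcongr
        · exact sum_le_hasSum F (fun _ _ => sq_nonneg _) hM.hasSum_adjoint
        · exact (sum_le_hasSum F (fun _ _ => sq_nonneg _) hN'.hasSum_adjoint).trans hle
    _ = √(hsq M) * √(hsq N) * ‖B‖ := by
        rw [Real.sqrt_mul (sq_nonneg _), Real.sqrt_sq (norm_nonneg _)]; ring

theorem IsHS.summable_inner {M N : H →L[ℝ] H} (hM : IsHS M) (hN : IsHS N) (B : H →L[ℝ] H) :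
    Summable fun i => inner ℝ (basis H i) (M (N.adjoint (B (basis H i)))) :=
  Summable.of_abs (summable_of_sum_le (fun _ => abs_nonneg _) (hM.sum_abs_inner_le hN B))

/-! ### The square root of a covariance operator and the trace -/

variable {R Q : H →L[ℝ] H}

theorem IsPosSqrt.adjoint_eq (hR : IsPosSqrt R Q) : R.adjoint = R :=
  hR.isPositive.isSelfAdjoint.adjoint_eq

theorem IsPosSqrt.inner_apply (hR : IsPosSqrt R Q) (x y : H) :
    inner ℝ x (Q y) = inner ℝ (R x) (R y) := by
  rw [← hR.sq, ContinuousLinearMap.comp_apply, ← ContinuousLinearMap.adjoint_inner_left,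
    hR.adjoint_eq]

theorem IsPosSqrt.isHS (hR : IsPosSqrt R Q) (hQ : IsCovarianceOperator Q) : IsHS R := by
  refine hQ.summable.congr fun i => ?_
  rw [hR.inner_apply, real_inner_self_eq_norm_sq]

theorem IsPosSqrt.summable_trace (hR : IsPosSqrt R Q) (hQ : IsCovarianceOperator Q)
    (B : H →L[ℝ] H) : Summable fun i => inner ℝ (basis H i) (Q (B (basis H i))) := by
  have := (hR.isHS hQ).summable_inner (hR.isHS hQ) B
  simpa only [hR.adjoint_eq, ← ContinuousLinearMap.comp_apply R R, hR.sq] using this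

/-- `B ↦ Tr [Q B]` as a bounded linear functional. -/
noncomputable def IsPosSqrt.traceCLM (hR : IsPosSqrt R Q) (hQ : IsCovarianceOperator Q) :
    (H →L[ℝ] H) →L[ℝ] ℝ :=
  LinearMap.mkContinuous
    { toFun := fun B => opTrace (Q ∘L B)
      map_add' := fun B C => by
        simp only [opTrace, ContinuousLinearMap.comp_apply, add_apply, map_add,
          inner_add_right]
        exact (hR.summable_trace hQ B).tsum_add (hR.summable_trace hQ C)
      map_smul' := fun c B => by
        simp only [opTrace, ContinuousLinearMap.comp_apply, smul_apply, map_smul,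
          inner_smul_right, tsum_mul_left, RingHom.id_apply, smul_eq_mul] }
    (√(hsq R) * √(hsq R)) fun B => by
      have h := (hR.isHS hQ).sum_abs_inner_le (hR.isHS hQ) B
      simp only [hR.adjoint_eq, ← ContinuousLinearMap.comp_apply R R, hR.sq] at h
      exact le_of_tendsto (hR.summable_trace hQ B).hasSum.norm
        (Eventually.of_forall fun F => (Finset.abs_sum_le_sum_abs _ _).trans (h F))

theorem IsPosSqrt.traceCLM_apply (hR : IsPosSqrt R Q) (hQ : IsCovarianceOperator Q)
    (B : H →L[ℝ] H) : hR.traceCLM hQ B = opTrace (Q ∘L B) := rfl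

theorem opTrace_smul (c : ℝ) (B : H →L[ℝ] H) : opTrace (c • B) = c * opTrace B := by
  simp [opTrace, inner_smul_right, tsum_mul_left]

theorem IsPosSqrt.genL_eq (hR : IsPosSqrt R Q) (hQ : IsCovarianceOperator Q) (A : H →ₗ.[ℝ] H)
    (σ : ℝ) (f : ℝ → H → ℝ) (t : ℝ) (x : H) :
    genL A Q σ f t x = inner ℝ x (adjApply A (Dx f t x))
      + 1 / 2 * (σ ^ 2 * hR.traceCLM hQ (Dxx f t x)) := by
  rw [genL, opTrace_smul, hR.traceCLM_apply]

/-- This trace is the source of every term quadratic in first derivatives: the nonlinearity of the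
HJB equation and the cross term of Doob's transform. -/
theorem IsPosSqrt.traceCLM_rankOne (hR : IsPosSqrt R Q) (hQ : IsCovarianceOperator Q) (p q : H) :
    hR.traceCLM hQ ((innerSL ℝ p).smulRight q) = inner ℝ (R p) (R q) := by
  rw [hR.traceCLM_apply, opTrace, ← hR.inner_apply, ← (basis H).tsum_inner_mul_inner p (Q q)]
  refine tsum_congr fun i => ?_
  simp [inner_smul_right]

end HilbertSchmidt

/-! ### The semigroup, the covariances Q_t and the generator. -/

section Semigroup

variable {H : Type*} [NormedAddCommGroup H] [InnerProductSpace ℝ H] [CompleteSpace H]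
  {S : ℝ → H →L[ℝ] H} {R Q : H →L[ℝ] H}

theorem IsC0Semigroup.exists_norm_le (hS : IsC0Semigroup S) (T : ℝ) :
    ∃ M, 0 ≤ M ∧ ∀ s ∈ Icc 0 T, ‖S s‖ ≤ M := by
  obtain ⟨C, hC⟩ := banach_steinhaus (g := fun s : Icc 0 T => S s) fun x => by
    obtain ⟨C, hC⟩ := (isCompact_Icc (a := (0 : ℝ)) (b := T)).exists_bound_of_continuousOn
      ((hS.continuousOn x).mono Icc_subset_Ici_self)
    exact ⟨C, fun s => hC s s.2⟩
  exact ⟨max C 0, le_max_right _ _, fun s hs => (hC ⟨s, hs⟩).trans (le_max_left _ _)⟩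

/-- Strong continuity gives convergence on each basis vector, and local boundedness of the semigroup
dominates the series by a multiple of ‖R e_i‖². Composition with a Hilbert-Schmidt operator thus
upgrades strong continuity to Hilbert-Schmidt continuity. -/
theorem IsC0Semigroup.tendsto_hsq (hS : IsC0Semigroup S) (hR : IsHS R) {s₀ : ℝ} (hs₀ : 0 ≤ s₀) :
    Tendsto (fun s => hsq (S s ∘L R - S s₀ ∘L R)) (𝓝[Ici 0] s₀) (𝓝 0) := by
  obtain ⟨M, hM0, hM⟩ := hS.exists_norm_le (s₀ + 1)
  suffices h : Tendsto (fun s => hsq (S s ∘L R - S s₀ ∘L R)) (𝓝[Ici 0] s₀)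
      (𝓝 (∑' _ : basisIndex H, (0 : ℝ))) by simpa using h
  refine tendsto_tsum_of_dominated_convergence
    (bound := fun i => (2 * M) ^ 2 * ‖R (basis H i)‖ ^ 2) (hR.mul_left _) (fun i => ?_) ?_
  · have h1 := (hS.continuousOn (R (basis H i))) s₀ hs₀
    have h2 := (((h1.tendsto).sub_const (S s₀ (R (basis H i)))).norm).pow 2
    simpa using h2
  · have hI : ∀ᶠ s in 𝓝[Ici 0] s₀, s ∈ Icc 0 (s₀ + 1) := by
      filter_upwards [self_mem_nhdsWithin, mem_nhdsWithin_of_mem_nhds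
        (Iic_mem_nhds (lt_add_one s₀))] with s h1 h2
      exact ⟨h1, h2⟩
    filter_upwards [hI] with s hs i
    rw [norm_pow, norm_norm, ← mul_pow]
    gcongr
    have e1 := (S s).le_of_opNorm_le (hM s hs) (R (basis H i))
    have e2 := (S s₀).le_of_opNorm_le (hM s₀ ⟨hs₀, by linarith⟩) (R (basis H i))
    calc ‖(S s ∘L R - S s₀ ∘L R) (basis H i)‖ ≤ _ + _ := norm_sub_le _ _
      _ ≤ M * ‖R (basis H i)‖ + M * ‖R (basis H i)‖ := add_le_add e1 e2
      _ = 2 * M * ‖R (basis H i)‖ := by ring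

theorem IsC0Semigroup.continuousOn_comp (hS : IsC0Semigroup S) (hR : IsHS R) :
    ContinuousOn (fun s => S s ∘L R) (Ici 0) := by
  intro s₀ hs₀
  rw [ContinuousWithinAt, tendsto_iff_norm_sub_tendsto_zero]
  have h := (hS.tendsto_hsq hR hs₀).sqrt
  rw [Real.sqrt_zero] at h
  exact squeeze_zero (fun _ => norm_nonneg _)
    (fun s => ((hR.comp_left _).sub (hR.comp_left _)).norm_le) h

theorem IsPosSqrt.conj_eq (hR : IsPosSqrt R Q) (B : H →L[ℝ] H) :
    B ∘L Q ∘L B.adjoint = (B ∘L R) ∘L (B ∘L R).adjoint := by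
  rw [ContinuousLinearMap.adjoint_comp, hR.adjoint_eq, ← hR.sq]
  rfl

/-- Writing the conjugate as (S_s R)(S_s R)* makes it continuous in operator norm, although S itself
is only strongly continuous. Without this integrability the Bochner integral defining `convCov`
could be the default value 0. -/
theorem IsC0Semigroup.continuousOn_conj (hS : IsC0Semigroup S) (hR : IsPosSqrt R Q)
    (hQ : IsCovarianceOperator Q) :
    ContinuousOn (fun s => S s ∘L Q ∘L (S s).adjoint) (Ici 0) := by
  simp only [hR.conj_eq]
  have h := hS.continuousOn_comp (hR.isHS hQ)
  exact h.clm_comp (ContinuousLinearMap.adjoint.continuous.comp_continuousOn h)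

theorem IsC0Semigroup.intervalIntegrable_conj (hS : IsC0Semigroup S) (hR : IsPosSqrt R Q)
    (hQ : IsCovarianceOperator Q) {a b : ℝ} (ha : 0 ≤ a) (hb : 0 ≤ b) :
    IntervalIntegrable (fun s => S s ∘L Q ∘L (S s).adjoint) volume a b :=
  ((hS.continuousOn_conj hR hQ).mono fun _ hx => (le_inf ha hb).trans hx.1).intervalIntegrable

theorem inner_convCov (hS : IsC0Semigroup S) (hR : IsPosSqrt R Q)
    (hQ : IsCovarianceOperator Q) {t : ℝ} (ht : 0 ≤ t) (u v : H) :
    inner ℝ u (convCov S Q t v) = ∫ s in (0 : ℝ)..t, inner ℝ u ((S s ∘L Q ∘L (S s).adjoint) v) := by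
  have := ContinuousLinearMap.intervalIntegral_comp_comm
    ((innerSL ℝ u) ∘L (ContinuousLinearMap.apply ℝ H v))
    (hS.intervalIntegrable_conj hR hQ le_rfl ht)
  exact this.symm

theorem inner_conj (hR : IsPosSqrt R Q) (B : H →L[ℝ] H) (u v : H) :
    inner ℝ u ((B ∘L Q ∘L B.adjoint) v) =
      inner ℝ ((B ∘L R).adjoint u) ((B ∘L R).adjoint v) := by
  rw [hR.conj_eq, ContinuousLinearMap.comp_apply, ContinuousLinearMap.adjoint_inner_left]

theorem inner_convCov_comm (hS : IsC0Semigroup S) (hR : IsPosSqrt R Q)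
    (hQ : IsCovarianceOperator Q) {t : ℝ} (ht : 0 ≤ t) (u v : H) :
    inner ℝ u (convCov S Q t v) = inner ℝ v (convCov S Q t u) := by
  simp only [inner_convCov hS hR hQ ht, inner_conj hR]
  simp only [real_inner_comm]

theorem inner_convCov_nonneg (hS : IsC0Semigroup S) (hR : IsPosSqrt R Q)
    (hQ : IsCovarianceOperator Q) {t : ℝ} (ht : 0 ≤ t) (u : H) :
    0 ≤ inner ℝ u (convCov S Q t u) := by
  rw [inner_convCov hS hR hQ ht]
  refine intervalIntegral.integral_nonneg ht fun s _ => ?_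
  rw [inner_conj hR]
  exact real_inner_self_nonneg

theorem intervalIntegrable_inner_conj (hS : IsC0Semigroup S) (hR : IsPosSqrt R Q)
    (hQ : IsCovarianceOperator Q) {t : ℝ} (ht : 0 ≤ t) (u v : H) :
    IntervalIntegrable (fun s => inner ℝ u ((S s ∘L Q ∘L (S s).adjoint) v)) volume 0 t := by
  have h := hS.continuousOn_conj hR hQ
  have h2 : ContinuousOn (fun s => inner ℝ u ((S s ∘L Q ∘L (S s).adjoint) v)) (Ici 0) :=
    (continuousOn_const).inner (h.clm_apply continuousOn_const)
  exact (h2.mono fun _ hx => (le_inf le_rfl ht).trans hx.1).intervalIntegrable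

theorem intervalIntegrable_sum_inner_conj (hS : IsC0Semigroup S) (hR : IsPosSqrt R Q)
    (hQ : IsCovarianceOperator Q) {t : ℝ} (ht : 0 ≤ t) {ι : Type*} (F : Finset ι) (u v : ι → H) :
    IntervalIntegrable (fun s => ∑ i ∈ F, inner ℝ (u i) ((S s ∘L Q ∘L (S s).adjoint) (v i)))
      volume 0 t := by
  have := IntervalIntegrable.sum F fun i _ =>
    intervalIntegrable_inner_conj hS hR hQ ht (u i) (v i)
  simpa only [Finset.sum_fn] using this

/-- The trace of Q_t is at most linear in t; this is what makes the second moment of the noise over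
a time ε of order ε. -/
theorem sum_inner_convCov_le (hS : IsC0Semigroup S) (hR : IsPosSqrt R Q)
    (hQ : IsCovarianceOperator Q) (T : ℝ) :
    ∃ K, 0 ≤ K ∧ ∀ t ∈ Icc 0 T, ∀ F : Finset (basisIndex H),
      ∑ i ∈ F, inner ℝ (basis H i) (convCov S Q t (basis H i)) ≤ K * t := by
  obtain ⟨M, hM0, hM⟩ := hS.exists_norm_le T
  refine ⟨M ^ 2 * hsq R, mul_nonneg (sq_nonneg _) (hsq_nonneg _), fun t ht F => ?_⟩
  simp only [inner_convCov hS hR hQ ht.1]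
  rw [← intervalIntegral.integral_finsetSum
    fun i _ => intervalIntegrable_inner_conj hS hR hQ ht.1 _ _]
  have hc : ∫ _ in (0 : ℝ)..t, M ^ 2 * hsq R = M ^ 2 * hsq R * t := by simp; ring
  rw [← hc]
  refine intervalIntegral.integral_mono_on ht.1 ?_ intervalIntegrable_const fun s hs => ?_
  · exact intervalIntegrable_sum_inner_conj hS hR hQ ht.1 F _ _
  · simp only [inner_conj hR, real_inner_self_eq_norm_sq]
    have hHS := (hR.isHS hQ).comp_left (S s)
    refine (sum_le_hasSum F (fun _ _ => sq_nonneg _) hHS.hasSum_adjoint).trans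
      (((hR.isHS hQ).hsq_comp_left_le (S s)).trans ?_)
    have := hM s ⟨hs.1, hs.2.trans ht.2⟩
    gcongr
    exact hsq_nonneg _

theorem summable_inner_convCov (hS : IsC0Semigroup S) (hR : IsPosSqrt R Q)
    (hQ : IsCovarianceOperator Q) {t : ℝ} (ht : 0 ≤ t) :
    Summable fun i => inner ℝ (basis H i) (convCov S Q t (basis H i)) := by
  obtain ⟨K, _, hK⟩ := sum_inner_convCov_le hS hR hQ t
  exact summable_of_sum_le (fun i => inner_convCov_nonneg hS hR hQ ht _) (hK t ⟨ht, le_rfl⟩)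

theorem convCov_zero : convCov S Q 0 = 0 := by simp [convCov]

theorem convCov_add (hS : IsC0Semigroup S) (hR : IsPosSqrt R Q)
    (hQ : IsCovarianceOperator Q) {t ε : ℝ} (ht : 0 ≤ t) (hε : 0 ≤ ε) :
    convCov S Q (t + ε) = convCov S Q t + S t ∘L convCov S Q ε ∘L (S t).adjoint := by
  have h1 : convCov S Q (t + ε) = convCov S Q t +
      ∫ s in t..(t + ε), S s ∘L Q ∘L (S s).adjoint :=
    (intervalIntegral.integral_add_adjacent_intervals
      (hS.intervalIntegrable_conj hR hQ le_rfl ht)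
      (hS.intervalIntegrable_conj hR hQ ht (by linarith))).symm
  rw [h1]
  congr 1
  let L : (H →L[ℝ] H) →L[ℝ] (H →L[ℝ] H) :=
    (ContinuousLinearMap.compL ℝ H H H (S t)) ∘L
      ((ContinuousLinearMap.compL ℝ H H H).flip (S t).adjoint)
  have h2 := L.intervalIntegral_comp_comm (hS.intervalIntegrable_conj hR hQ le_rfl hε)
  have h3 : L (convCov S Q ε) = S t ∘L convCov S Q ε ∘L (S t).adjoint := rfl
  rw [← h3, convCov, ← h2]
  have h4 := intervalIntegral.integral_comp_add_left
    (a := 0) (b := ε) (fun s => S s ∘L Q ∘L (S s).adjoint) t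
  rw [add_zero] at h4
  rw [← h4]
  refine intervalIntegral.integral_congr fun s hs => ?_
  rw [uIcc_of_le hε] at hs
  simp only [hS.add t s ht hs.1, ContinuousLinearMap.adjoint_comp]
  rfl

/-- Convergence of Q_ε/ε to Q in trace norm, phrased by duality against B. It is kept on finite
partial sums so that the interchange with the time integral is elementary. -/
theorem eventually_abs_sum_convCov_sub_le (hS : IsC0Semigroup S) (hR : IsPosSqrt R Q)
    (hQ : IsCovarianceOperator Q) {δ : ℝ} (hδ : 0 < δ) :
    ∀ᶠ ε in 𝓝[>] (0 : ℝ), ∀ (B : H →L[ℝ] H) (F : Finset (basisIndex H)),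
      |∑ i ∈ F, inner ℝ (basis H i) (convCov S Q ε (B (basis H i)))
        - ε * ∑ i ∈ F, inner ℝ (basis H i) (Q (B (basis H i)))| ≤ δ * ‖B‖ * ε := by
  have hHS := hR.isHS hQ
  obtain ⟨M, hM0, hM⟩ := hS.exists_norm_le 1
  set c : ℝ := M * √(hsq R) + √(hsq R)
  have hc : 0 ≤ c := by positivity
  have hlim : ∀ᶠ s in 𝓝[Ici 0] (0 : ℝ), √(hsq (S s ∘L R - R)) * c < δ := by
    have h := (hS.tendsto_hsq hHS le_rfl).sqrt.mul_const c
    rw [Real.sqrt_zero, zero_mul] at h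
    have := h.eventually_lt_const hδ
    simpa [hS.zero] using this
  obtain ⟨r, hr, hr'⟩ := mem_nhdsGE_iff_exists_Ico_subset.1 hlim
  filter_upwards [Ioo_mem_nhdsGT (lt_min hr one_pos)] with ε hε B F
  have hε0 : 0 ≤ ε := hε.1.le
  simp only [inner_convCov hS hR hQ hε0]
  rw [← intervalIntegral.integral_finsetSum
    fun i _ => intervalIntegrable_inner_conj hS hR hQ hε0 _ _]
  have hconst : ε * ∑ i ∈ F, inner ℝ (basis H i) (Q (B (basis H i))) =
      ∫ _ in (0 : ℝ)..ε, ∑ i ∈ F, inner ℝ (basis H i) (Q (B (basis H i))) := by simp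
  rw [hconst, ← intervalIntegral.integral_sub
    (intervalIntegrable_sum_inner_conj hS hR hQ hε0 F _ _)
    intervalIntegrable_const]
  have hb : ∀ s ∈ Ioc 0 ε, ‖∑ i ∈ F, inner ℝ (basis H i) ((S s ∘L Q ∘L (S s).adjoint)
      (B (basis H i))) - ∑ i ∈ F, inner ℝ (basis H i) (Q (B (basis H i)))‖ ≤ δ * ‖B‖ := by
    intro s hs
    set N := S s ∘L R with hN
    have hNHS : IsHS N := hHS.comp_left _
    have hs1 : √(hsq (N - R)) * c < δ :=
      hr' ⟨hs.1.le, hs.2.trans_lt (hε.2.trans_le (min_le_left _ _))⟩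
    have hNle : √(hsq N) ≤ M * √(hsq R) := by
      rw [← Real.sqrt_sq hM0, ← Real.sqrt_mul (sq_nonneg _)]
      refine Real.sqrt_le_sqrt ((hHS.hsq_comp_left_le _).trans ?_)
      have := hM s ⟨hs.1.le, hs.2.trans (hε.2.le.trans (min_le_right _ _))⟩
      gcongr
      exact hsq_nonneg _
    rw [← Finset.sum_sub_distrib, Real.norm_eq_abs]
    -- The telescoping N N* - R R* = (N - R) N* + R (N - R)*, with N = S_s R, leaves a factor small
    -- in Hilbert-Schmidt norm in each term.
    have hterm : ∀ x y, inner ℝ x ((S s ∘L Q ∘L (S s).adjoint) y) - inner ℝ x (Q y) =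
        inner ℝ x ((N - R) (N.adjoint y)) + inner ℝ x (R ((N - R).adjoint y)) := by
      intro x y
      rw [hR.conj_eq, ← hN, ← hR.sq, ← inner_sub_right, ← inner_add_right]
      simp [hR.adjoint_eq]
    simp only [hterm, Finset.sum_add_distrib]
    refine (abs_add_le _ _).trans ?_
    have e1 := (Finset.abs_sum_le_sum_abs _ _).trans
      ((hNHS.sub hHS).sum_abs_inner_le hNHS B F)
    have e2 := (Finset.abs_sum_le_sum_abs _ _).trans
      (hHS.sum_abs_inner_le (hNHS.sub hHS) B F)
    refine (add_le_add e1 e2).trans ?_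
    calc √(hsq (N - R)) * √(hsq N) * ‖B‖ + √(hsq R) * √(hsq (N - R)) * ‖B‖
        = √(hsq (N - R)) * (√(hsq N) + √(hsq R)) * ‖B‖ := by ring
      _ ≤ √(hsq (N - R)) * c * ‖B‖ := by gcongr; exact add_le_add hNle le_rfl
      _ ≤ δ * ‖B‖ := by gcongr
  have := intervalIntegral.norm_integral_le_of_norm_le_const (a := 0) (b := ε)
    (fun s hs => hb s (by rwa [uIoc_of_le hε0] at hs))
  simpa [abs_of_nonneg hε0] using this

/-! ### The generator -/

variable {A : H →ₗ.[ℝ] H}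

theorem IsC0Semigroup.intervalIntegrable (hS : IsC0Semigroup S) (x : H) {a b : ℝ} (ha : 0 ≤ a)
    (hb : 0 ≤ b) : IntervalIntegrable (fun s => S s x) volume a b :=
  ((hS.continuousOn x).mono fun _ hx => (le_inf ha hb).trans hx.1).intervalIntegrable

theorem IsC0Semigroup.tendsto_average (hS : IsC0Semigroup S) (x : H) {s : ℝ} (hs : 0 ≤ s) :
    Tendsto (fun t : ℝ => t⁻¹ • ∫ r in s..(s + t), S r x) (𝓝[>] 0) (𝓝 (S s x)) := by
  have hd : HasDerivWithinAt (fun t => ∫ r in s..t, S r x) (S s x) (Ioi s) s := by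
    refine (intervalIntegral.integral_hasDerivWithinAt_right (s := Ici s) (t := Ioi s)
      (by simp) ?_ ?_).mono Ioi_subset_Ici_self
    · refine ⟨Ioi s, self_mem_nhdsWithin, ?_⟩
      exact ((hS.continuousOn x).mono fun r hr => hs.trans (le_of_lt hr)).aestronglyMeasurable
        measurableSet_Ioi
    · exact ((hS.continuousOn x) s hs).mono fun r hr => hs.trans (le_of_lt hr)
  rw [hasDerivWithinAt_iff_tendsto_slope' (by simp)] at hd
  have hm : Tendsto (fun t : ℝ => s + t) (𝓝[>] 0) (𝓝[>] s) := by
    refine tendsto_nhdsWithin_iff.2 ⟨?_, ?_⟩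
    · have : Tendsto (fun t : ℝ => s + t) (𝓝 0) (𝓝 (s + 0)) := (by fun_prop : Continuous _).tendsto 0
      rw [add_zero] at this
      exact this.mono_left nhdsWithin_le_nhds
    · filter_upwards [self_mem_nhdsWithin] with t ht
      simpa using ht
  refine (hd.comp hm).congr fun t => ?_
  simp [slope_def_module]

/-- Applying S_t to the integral shifts its window by t, so the difference quotient is the average
of S over [ε, ε + t] minus that over [0, t]. Time averages of any orbit therefore lie in D(A),
whatever x is. -/
theorem IsGenerator.integral_mem (hA : IsGenerator S A) (hS : IsC0Semigroup S) (x : H) {ε : ℝ}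
    (hε : 0 ≤ ε) : ((∫ s in (0 : ℝ)..ε, S s x), S ε x - x) ∈ A.graph := by
  rw [hA]
  have h1 := (hS.tendsto_average x hε).sub (hS.tendsto_average x le_rfl)
  rw [hS.zero] at h1
  refine h1.congr' ?_
  filter_upwards [self_mem_nhdsWithin] with t ht
  have ht0 : (0 : ℝ) ≤ t := le_of_lt ht
  rw [← smul_sub]
  congr 1
  rw [← (S t).intervalIntegral_comp_comm (hS.intervalIntegrable x le_rfl hε)]
  have h2 : ∫ s in (0 : ℝ)..ε, S t (S s x) = ∫ s in t..(t + ε), S s x := by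
    have h4 := intervalIntegral.integral_comp_add_left (a := 0) (b := ε) (fun s => S s x) t
    rw [add_zero] at h4
    rw [← h4]
    refine intervalIntegral.integral_congr fun s hs => ?_
    rw [uIcc_of_le hε] at hs
    simp [hS.add t s ht0 hs.1]
  have i1 := hS.intervalIntegrable x le_rfl hε
  have i2 := hS.intervalIntegrable x hε (add_nonneg hε ht0)
  have i3 := hS.intervalIntegrable x le_rfl ht0
  have i4 := hS.intervalIntegrable x ht0 (add_nonneg ht0 hε)
  have e1 := intervalIntegral.integral_add_adjacent_intervals i1 i2
  have e2 := intervalIntegral.integral_add_adjacent_intervals i3 i4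
  rw [h2, zero_add, sub_eq_sub_iff_add_eq_add, add_comm, e1, add_comm ε t, ← e2, add_comm]

theorem IsGenerator.dense_domain (hA : IsGenerator S A) (hS : IsC0Semigroup S) :
    Dense (A.domain : Set H) := by
  intro x
  have h1 := hS.tendsto_average x le_rfl
  rw [hS.zero] at h1
  refine mem_closure_of_tendsto h1 ?_
  filter_upwards [self_mem_nhdsWithin] with t ht
  have := LinearPMap.mem_domain_of_mem_graph (hA.integral_mem hS x (le_of_lt (α := ℝ) ht))
  simpa using A.domain.smul_mem t⁻¹ this

/-- Moves A from the averaged orbit to p, so that increments of an orbit starting outside D(A) can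
be tested against vectors of D(A*). -/
theorem IsGenerator.inner_sub (hA : IsGenerator S A) (hS : IsC0Semigroup S) (x p : H) {ε : ℝ}
    (hε : 0 ≤ ε) (hp : p ∈ A.adjoint.domain) :
    inner ℝ (S ε x - x) p = inner ℝ (∫ s in (0 : ℝ)..ε, S s x) (adjApply A p) := by
  obtain ⟨y, hy1, hy2⟩ := (LinearPMap.mem_graph_iff _).1 (hA.integral_mem hS x hε)
  have := (LinearPMap.adjoint_isFormalAdjoint (hA.dense_domain hS)) ⟨p, hp⟩ y
  rw [adjApply, dif_pos hp]
  simp only at hy1 hy2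
  rw [← hy1, ← hy2, real_inner_comm, real_inner_comm _ (y : H)]
  exact this.symm

end Semigroup

/-! ### Factoring a positive operator through the Hilbert space it defines. -/

section CovSpace

variable {H : Type*} [NormedAddCommGroup H] [InnerProductSpace ℝ H] [CompleteSpace H]

set_option linter.unusedVariables false in
/-- The space `H` with the semi-inner product `⟨u, C v⟩`. -/
@[nolint unusedArguments]
def CovSpace (C : H →L[ℝ] H) (hC : C.IsPositive) : Type _ := H

variable (C : H →L[ℝ] H) (hC : C.IsPositive)

instance : AddCommGroup (CovSpace C hC) := inferInstanceAs (AddCommGroup H)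
instance : Module ℝ (CovSpace C hC) := inferInstanceAs (Module ℝ H)

/-- The identity map from `H` to `CovSpace C hC`. -/
def toCovSpace : H ≃ₗ[ℝ] CovSpace C hC := LinearEquiv.refl ℝ _

/-- The semi-inner product `⟨u, C v⟩`. -/
noncomputable abbrev covSpaceCore : PreInnerProductSpace.Core ℝ (CovSpace C hC) where
  inner u v := inner ℝ ((toCovSpace C hC).symm u) (C ((toCovSpace C hC).symm v))
  conj_inner_symm u v := by
    simp only [conj_trivial]
    rw [← hC.inner_left_eq_inner_right, real_inner_comm]
  re_inner_nonneg u := hC.inner_nonneg_right _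
  add_left u v w := by simp [inner_add_left]
  smul_left u v r := by simp [inner_smul_left]

noncomputable instance : SeminormedAddCommGroup (CovSpace C hC) :=
  InnerProductSpace.Core.toSeminormedAddCommGroup (c := covSpaceCore C hC)
noncomputable instance : InnerProductSpace ℝ (CovSpace C hC) :=
  InnerProductSpace.ofCore (covSpaceCore C hC)

theorem covSpace_inner (u v : H) :
    inner ℝ (toCovSpace C hC u) (toCovSpace C hC v) = inner ℝ u (C v) := rfl

/-- The map from `H` to the completion of `CovSpace C hC`. -/
noncomputable def covMap : H →L[ℝ] UniformSpace.Completion (CovSpace C hC) :=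
  LinearMap.mkContinuous
    ((UniformSpace.Completion.toComplₗᵢ (𝕜 := ℝ) (E := CovSpace C hC)).toLinearMap ∘ₗ
      (toCovSpace C hC).toLinearMap) (√‖C‖) fun u => by
    have h : ‖toCovSpace C hC u‖ ^ 2 ≤ (√‖C‖ * ‖u‖) ^ 2 := by
      rw [← real_inner_self_eq_norm_sq, covSpace_inner, mul_pow, Real.sq_sqrt (norm_nonneg _)]
      calc inner ℝ u (C u) ≤ ‖u‖ * (‖C‖ * ‖u‖) :=
            (real_inner_le_norm _ _).trans (by gcongr; exact C.le_opNorm u)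
        _ = ‖C‖ * ‖u‖ ^ 2 := by ring
    simpa using (sq_le_sq₀ (norm_nonneg _) (by positivity)).1 h

theorem covMap_norm_sq (u : H) : ‖covMap C hC u‖ ^ 2 = inner ℝ u (C u) := by
  rw [← covSpace_inner C hC, real_inner_self_eq_norm_sq]
  simp [covMap]

end CovSpace

section

universe u
variable {H : Type u} [NormedAddCommGroup H] [InnerProductSpace ℝ H] [CompleteSpace H]

/-- Take a Hilbert basis of the completion of H under ⟨u, C v⟩ and pull it back by the adjoint of
the canonical map; Parseval in the completion is the claim. No spectral theorem for C is used. -/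
theorem exists_hasSum_inner_sq {C : H →L[ℝ] H} (hC : C.IsPositive) :
    ∃ (ι : Type u) (b : ι → H), ∀ u, HasSum (fun k => (inner ℝ (b k) u) ^ 2) (inner ℝ u (C u)) := by
  obtain ⟨w, f, -⟩ := exists_hilbertBasis ℝ (UniformSpace.Completion (CovSpace C hC))
  refine ⟨w, fun k => (covMap C hC).adjoint (f k), fun u => ?_⟩
  simp only [ContinuousLinearMap.adjoint_inner_left]
  rw [← covMap_norm_sq C hC]
  exact hasSum_inner_sq f _

/-- Summing ⟨b_k, e_i⟩² over k first gives the trace of C, over i first gives the norms. -/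
theorem summable_norm_sq_of_hasSum {ι : Type*} {b : ι → H} {C : H →L[ℝ] H}
    (hb : ∀ u, HasSum (fun k => (inner ℝ (b k) u) ^ 2) (inner ℝ u (C u)))
    (hC : Summable fun i => inner ℝ (basis H i) (C (basis H i))) :
    Summable fun k => ‖b k‖ ^ 2 := by
  have hs : Summable fun p : basisIndex H × ι => (inner ℝ (b p.2) (basis H p.1)) ^ 2 := by
    rw [summable_prod_of_nonneg fun _ => sq_nonneg _]
    exact ⟨fun i => (hb (basis H i)).summable, hC.congr fun i => (hb (basis H i)).tsum_eq.symm⟩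
  have h3 := ((Equiv.prodComm _ _).summable_iff).2 hs
  have := ((summable_prod_of_nonneg fun _ => sq_nonneg _).1 h3).2
  refine this.congr fun k => ?_
  simp only [Equiv.prodComm_apply, Prod.swap]
  rw [← (hasSum_inner_sq (basis H) (b k)).tsum_eq]
  simp only [real_inner_comm]

end

/-! ### Existence of Gaussian measures with prescribed covariance. -/

section Existence

variable {H : Type*} [NormedAddCommGroup H] [InnerProductSpace ℝ H] [CompleteSpace H]
  [MeasurableSpace H] [BorelSpace H] [SecondCountableTopology H]

/-- The law of a sequence of independent standard Gaussian variables. -/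
noncomputable abbrev whiteNoise (ι : Type*) : Measure (ι → ℝ) :=
  Measure.infinitePi fun _ : ι => gaussianReal 0 1

theorem whiteNoise_map_eval {ι : Type*} (k : ι) :
    (whiteNoise ι).map (fun ω => ω k) = gaussianReal 0 1 :=
  Measure.infinitePi_map_eval (fun _ : ι => gaussianReal 0 1) k

theorem memLp_eval {ι : Type*} (k : ι) : MemLp (fun ω : ι → ℝ => ω k) 2 (whiteNoise ι) := by
  have h : MemLp id 2 ((whiteNoise ι).map fun ω => ω k) := by
    rw [whiteNoise_map_eval]
    exact memLp_id_gaussianReal 2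
  exact (memLp_map_measure_iff aestronglyMeasurable_id (measurable_pi_apply k).aemeasurable).1 h

theorem memLp_eval_smul {ι : Type*} (k : ι) (x : H) :
    MemLp (fun ω : ι → ℝ => ω k • x) 2 (whiteNoise ι) :=
  (memLp_eval k).of_le_mul (c := ‖x‖) ((memLp_eval k).1.smul_const x)
    (Eventually.of_forall fun _ => by rw [norm_smul, mul_comm])

theorem iIndepFun_eval (ι : Type*) : iIndepFun (fun (i : ι) (ω : ι → ℝ) => ω i) (whiteNoise ι) :=
  iIndepFun_infinitePi (P := fun _ : ι => gaussianReal 0 1) (X := fun _ x => x) fun _ => measurable_id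

theorem integral_eval_mul_eval {ι : Type*} [DecidableEq ι] (k l : ι) :
    ∫ ω, ω k * ω l ∂(whiteNoise ι) = if k = l then 1 else 0 := by
  have hmean : ∀ j, ∫ ω, ω j ∂(whiteNoise ι) = 0 := fun j => by
    have := integral_map (μ := whiteNoise ι) (φ := fun ω => ω j) (f := fun x : ℝ => x)
      (measurable_pi_apply j).aemeasurable (by fun_prop)
    rw [whiteNoise_map_eval, integral_id_gaussianReal] at this
    exact this.symm
  split_ifs with h
  · subst h
    have := integral_map (μ := whiteNoise ι) (φ := fun ω => ω k) (f := fun x : ℝ => x * x)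
      (measurable_pi_apply k).aemeasurable (by fun_prop)
    rw [← this, whiteNoise_map_eval]
    have hv := variance_fun_id_gaussianReal (μ := 0) (v := 1)
    rw [variance_eq_integral (by fun_prop)] at hv
    simpa [integral_id_gaussianReal, sq] using hv
  · rw [((iIndepFun_eval ι).indepFun h).integral_fun_mul_eq_mul_integral
      (memLp_eval k).1 (memLp_eval l).1, hmean, zero_mul]

theorem inner_toLp_eval_smul {ι : Type*} [DecidableEq ι] (k l : ι) (x y : H) :
    inner ℝ ((memLp_eval_smul k x).toLp _) ((memLp_eval_smul l y).toLp _) =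
      if k = l then inner ℝ x y else 0 := by
  rw [L2.inner_def]
  have : ∫ ω, inner ℝ ((memLp_eval_smul k x).toLp _ ω) ((memLp_eval_smul l y).toLp _ ω)
      ∂(whiteNoise ι) = ∫ ω, (ω k * ω l) * inner ℝ x y ∂(whiteNoise ι) := by
    refine integral_congr_ae ?_
    filter_upwards [(memLp_eval_smul k x).coeFn_toLp, (memLp_eval_smul l y).coeFn_toLp]
      with ω h1 h2
    rw [h1, h2, inner_smul_left, inner_smul_right]
    simp; ring
  rw [this, integral_mul_const, integral_eval_mul_eval]
  split_ifs <;> simp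

/-- The isometry `x ↦ ξ_k x` from `H` to `L²`, where `ξ_k` is the `k`-th coordinate. -/
noncomputable def noiseIsometry {ι : Type*} (H : Type*) [NormedAddCommGroup H]
    [InnerProductSpace ℝ H] [CompleteSpace H]
    [MeasurableSpace H] [BorelSpace H] [SecondCountableTopology H] (k : ι) :
    H →ₗᵢ[ℝ] Lp H 2 (whiteNoise ι) where
  toFun x := (memLp_eval_smul k x).toLp _
  map_add' x y := by
    rw [← MemLp.toLp_add]
    congr 1
    ext ω
    simp
  map_smul' c x := by
    rw [RingHom.id_apply, ← MemLp.toLp_const_smul]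
    congr 1
    ext ω
    exact smul_comm _ _ _
  norm_map' x := by
    classical
    have := inner_toLp_eval_smul (ι := ι) k k x x
    rw [real_inner_self_eq_norm_sq, if_pos rfl, real_inner_self_eq_norm_sq] at this
    exact (sq_eq_sq₀ (norm_nonneg _) (norm_nonneg _)).1 this

theorem noiseIsometry_coeFn {ι : Type*} (k : ι) (x : H) :
    noiseIsometry H k x =ᵐ[whiteNoise ι] fun ω => ω k • x :=
  (memLp_eval_smul k x).coeFn_toLp

/-- Orthogonality in L² reduces the convergence of ∑ ξ_k b_k to that of ∑ ‖b_k‖². -/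
theorem orthogonalFamily_noiseIsometry (ι : Type*) :
    OrthogonalFamily ℝ (fun _ : ι => H) (noiseIsometry H) := by
  classical
  intro k l hkl x y
  exact (inner_toLp_eval_smul k l x y).trans (if_neg hkl)

theorem norm_exp_mul_I_sub_le (a b : ℝ) :
    ‖Complex.exp (a * Complex.I) - Complex.exp (b * Complex.I)‖ ≤ |a - b| := by
  have h : Complex.exp (a * Complex.I) - Complex.exp (b * Complex.I) =
      Complex.exp (b * Complex.I) * (Complex.exp (Complex.I * ((a - b : ℝ) : ℂ)) - 1) := by
    rw [mul_sub, ← Complex.exp_add, mul_one]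
    congr 2
    push_cast
    ring
  rw [h, norm_mul, Complex.norm_exp_ofReal_mul_I, one_mul]
  exact Real.norm_exp_I_mul_ofReal_sub_one_le

/-- Since |e^{ia} - e^{ib}| ≤ |a - b| and the L¹ norm is at most the L² norm under a probability
measure, L² convergence carries characteristic functions to the limit. -/
theorem norm_charFun_sub_le {Ω : Type*} {mΩ : MeasurableSpace Ω} {P : Measure Ω}
    [IsProbabilityMeasure P] (X Y : Lp H 2 P) (u : H) :
    ‖(∫ ω, Complex.exp ((inner ℝ (X ω) u : ℝ) * Complex.I) ∂P) -
      ∫ ω, Complex.exp ((inner ℝ (Y ω) u : ℝ) * Complex.I) ∂P‖ ≤ ‖X - Y‖ * ‖u‖ := by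
  have hi : ∀ Z : Lp H 2 P,
      Integrable (fun ω => Complex.exp ((inner ℝ (Z ω) u : ℝ) * Complex.I)) P := fun Z => by
    refine Integrable.of_bound (C := 1) ?_ (Eventually.of_forall fun ω => ?_)
    · have h1 : AEStronglyMeasurable (fun ω => inner ℝ (Z ω) u) P :=
        (Lp.aestronglyMeasurable Z).inner_const
      exact (by fun_prop : Continuous fun x : ℝ => Complex.exp (x * Complex.I))
        |>.comp_aestronglyMeasurable h1
    · rw [Complex.norm_exp_ofReal_mul_I]
  rw [← integral_sub (hi X) (hi Y)]
  have hXY : MemLp (X - Y : Lp H 2 P) 1 P := (Lp.memLp (X - Y)).mono_exponent (by norm_num)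
  have hint : Integrable (fun ω => ‖(X - Y : Lp H 2 P) ω‖ * ‖u‖) P :=
    (memLp_one_iff_integrable.1 hXY).norm.mul_const _
  refine (norm_integral_le_of_norm_le hint ?_).trans ?_
  · filter_upwards [Lp.coeFn_sub X Y] with ω hω
    refine (norm_exp_mul_I_sub_le _ _).trans ?_
    rw [← inner_sub_left, hω]
    exact abs_real_inner_le_norm _ _
  · rw [integral_mul_const]
    gcongr
    rw [Lp.norm_def, integral_norm_eq_lintegral_enorm (Lp.aestronglyMeasurable _),
      ← eLpNorm_one_eq_lintegral_enorm]
    exact ENNReal.toReal_mono (Lp.eLpNorm_ne_top _)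
      (eLpNorm_le_eLpNorm_of_exponent_le (by norm_num) (Lp.aestronglyMeasurable _))

theorem charFun_sum_noise {ι : Type*} (b : ι → H) (F : Finset ι) (u : H) :
    ∫ ω, Complex.exp ((inner ℝ ((∑ k ∈ F, noiseIsometry H k (b k) :
        Lp H 2 (whiteNoise ι)) ω) u : ℝ) * Complex.I) ∂(whiteNoise ι) =
      Complex.exp (-((∑ k ∈ F, (inner ℝ (b k) u) ^ 2 : ℝ) : ℂ) / 2) := by
  have h1 : (∑ k ∈ F, noiseIsometry H k (b k) : Lp H 2 (whiteNoise ι)) =ᵐ[whiteNoise ι]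
      fun ω => ∑ k ∈ F, ω k • b k := by
    refine (Lp.coeFn_finsetSum _ _).trans ?_
    have : ∀ᵐ ω ∂(whiteNoise ι), ∀ k ∈ F, noiseIsometry H k (b k) ω = ω k • b k :=
      (ae_ball_iff F.countable_toSet).2 fun k _ => noiseIsometry_coeFn k (b k)
    filter_upwards [this] with ω hω
    rw [Finset.sum_apply]
    exact Finset.sum_congr rfl hω
  have h2 : iIndepFun (fun (k : ι) (ω : ι → ℝ) => ω k * inner ℝ (b k) u) (whiteNoise ι) :=
    iIndepFun_infinitePi (P := fun _ : ι => gaussianReal 0 1)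
      (X := fun k x => x * inner ℝ (b k) u) fun _ => by fun_prop
  have h3 := iIndepFun.charFun_map_fun_finsetSum_eq_prod (s := F)
    (X := fun (k : ι) (ω : ι → ℝ) => ω k * inner ℝ (b k) u) (P := whiteNoise ι)
    (fun k _ => ((measurable_pi_apply k).mul_const _).aemeasurable) (h2.restrict F)
  have h4 := congrFun h3 1
  rw [charFun_apply_real, integral_map (Finset.measurable_fun_sum _ fun k _ =>
    (measurable_pi_apply k).mul_const _).aemeasurable (by fun_prop), Finset.prod_apply] at h4
  have h5 : ∀ k ∈ F, charFun ((whiteNoise ι).map fun ω => ω k * inner ℝ (b k) u) 1 =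
      Complex.exp (-(((inner ℝ (b k) u) ^ 2 : ℝ) : ℂ) / 2) := by
    intro k _
    have : (whiteNoise ι).map (fun ω => ω k * inner ℝ (b k) u) =
        (gaussianReal 0 1).map (fun x => inner ℝ (b k) u * x) := by
      rw [← whiteNoise_map_eval k, Measure.map_map (by fun_prop) (by fun_prop)]
      congr 1
      ext ω
      simp [mul_comm]
    rw [this, charFun_map_mul, charFun_gaussianReal]
    congr 1
    push_cast
    ring
  rw [Finset.prod_congr rfl h5, ← Complex.exp_sum] at h4
  calc _ = ∫ ω, Complex.exp (((1 : ℝ) : ℂ) * ((∑ k ∈ F, ω k * inner ℝ (b k) u : ℝ) : ℂ) *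
        Complex.I) ∂(whiteNoise ι) := by
        refine integral_congr_ae ?_
        filter_upwards [h1] with ω hω
        rw [hω, sum_inner]
        simp only [inner_smul_left]
        simp
    _ = _ := by
        rw [h4]
        congr 1
        push_cast
        rw [neg_div, Finset.sum_div, ← Finset.sum_neg_distrib]
        simp [neg_div]

/-- The measure is the law of the L² sum of ξ_k b_k; the characteristic functions of its finite
partial sums are explicit and converge. -/
theorem exists_charFun_eq {C : H →L[ℝ] H} (hC : C.IsPositive)
    (hC' : Summable fun i => inner ℝ (basis H i) (C (basis H i))) :
    ∃ μ : Measure H, IsProbabilityMeasure μ ∧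
      ∀ u, charFun μ u = Complex.exp (-((inner ℝ u (C u) : ℝ) : ℂ) / 2) := by
  obtain ⟨ι, b, hb⟩ := exists_hasSum_inner_sq hC
  have hs := ((orthogonalFamily_noiseIsometry (H := H) ι).summable_iff_norm_sq_summable b).2
    (summable_norm_sq_of_hasSum hb hC')
  obtain ⟨X, hX⟩ := hs
  have hXm : AEMeasurable X (whiteNoise ι) := (Lp.aestronglyMeasurable X).aemeasurable
  refine ⟨(whiteNoise ι).map X, Measure.isProbabilityMeasure_map hXm, fun u => ?_⟩
  rw [charFun_apply, integral_map hXm (by fun_prop)]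
  have l1 : Tendsto (fun F : Finset ι => ∫ ω, Complex.exp ((inner ℝ ((∑ k ∈ F,
      noiseIsometry H k (b k) : Lp H 2 (whiteNoise ι)) ω) u : ℝ) * Complex.I) ∂(whiteNoise ι))
      atTop (𝓝 (∫ ω, Complex.exp ((inner ℝ (X ω) u : ℝ) * Complex.I) ∂(whiteNoise ι))) := by
    rw [tendsto_iff_norm_sub_tendsto_zero]
    have h0 := (tendsto_iff_norm_sub_tendsto_zero.1 hX).mul_const ‖u‖
    rw [zero_mul] at h0
    exact squeeze_zero (fun _ => norm_nonneg _) (fun F => norm_charFun_sub_le _ X u) h0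
  simp only [charFun_sum_noise] at l1
  have l2 : Tendsto (fun F : Finset ι => Complex.exp (-((∑ k ∈ F, (inner ℝ (b k) u) ^ 2 : ℝ) : ℂ)
      / 2)) atTop (𝓝 (Complex.exp (-((inner ℝ u (C u) : ℝ) : ℂ) / 2))) := by
    have hc : Continuous fun x : ℝ => Complex.exp (-(x : ℂ) / 2) := by fun_prop
    exact (hc.tendsto _).comp (hb u)
  exact tendsto_nhds_unique l1 l2

/-- Along each direction the characteristic function is that of a real centred normal law, which
gives Gaussianity and the variances. The covariances follow by polarisation. -/
theorem isGaussianWith_of_charFun {C : H →L[ℝ] H} (hC : C.IsPositive) {μ : Measure H}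
    [IsProbabilityMeasure μ]
    (hμ : ∀ u, charFun μ u = Complex.exp (-((inner ℝ u (C u) : ℝ) : ℂ) / 2)) :
    IsGaussianWith μ 0 C := by
  have hmap : ∀ u : H, μ.map (fun z => inner ℝ u z) =
      gaussianReal 0 (inner ℝ u (C u)).toNNReal := by
    intro u
    have : IsProbabilityMeasure (μ.map fun z => inner ℝ u z) :=
      Measure.isProbabilityMeasure_map (by fun_prop)
    refine Measure.ext_of_charFun (funext fun t => ?_)
    rw [charFun_apply_real, integral_map (by fun_prop) (by fun_prop), charFun_gaussianReal]
    have h1 := hμ (t • u)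
    rw [charFun_apply] at h1
    have h2 : ∀ z : H, ((inner ℝ z (t • u) : ℝ) : ℂ) = (t : ℂ) * ((inner ℝ u z : ℝ) : ℂ) := by
      intro z
      rw [inner_smul_right, real_inner_comm]
      push_cast; rfl
    simp only [h2] at h1
    rw [h1]
    congr 1
    rw [map_smul, inner_smul_left, inner_smul_right, Real.coe_toNNReal _ (hC.inner_nonneg_right u)]
    push_cast
    simp
    ring
  have hG : IsGaussian μ := by
    refine isGaussian_of_map_eq_gaussianReal fun L => ?_
    refine ⟨0, _, Eq.trans ?_ (hmap ((InnerProductSpace.toDual ℝ H).symm L))⟩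
    congr 1
    ext z
    simp
  have hmean : ∀ u : H, ∫ z, inner ℝ z u ∂μ = 0 := by
    intro u
    have := integral_map (μ := μ) (φ := fun z => inner ℝ u z) (f := fun x : ℝ => x)
      (by fun_prop) (by fun_prop)
    rw [hmap, integral_id_gaussianReal] at this
    simp only [real_inner_comm u] at this ⊢
    exact this.symm
  have hsq : ∀ u : H, ∫ z, (inner ℝ z u) ^ 2 ∂μ = inner ℝ u (C u) := by
    intro u
    have := integral_map (μ := μ) (φ := fun z => inner ℝ u z) (f := fun x : ℝ => x ^ 2)
      (by fun_prop) (by fun_prop)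
    simp only [real_inner_comm u] at this ⊢
    rw [← this, hmap]
    have hv := variance_fun_id_gaussianReal (μ := 0) (v := (inner ℝ u (C u)).toNNReal)
    rw [variance_eq_integral (by fun_prop)] at hv
    rw [Real.coe_toNNReal _ (hC.inner_nonneg_right u)] at hv
    simpa [integral_id_gaussianReal] using hv
  refine ⟨hG, fun u => by simpa using hmean u, fun u v => ?_⟩
  have hL2 : ∀ u : H, MemLp (fun z => inner ℝ z u) 2 μ := fun u =>
    (IsGaussian.memLp_id μ 2 (by norm_num)).inner_const u
  simp only [sub_zero]
  have h3 := hsq (u + v)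
  have e : ∀ z : H, (inner ℝ z (u + v)) ^ 2 = (inner ℝ z u) ^ 2 + (inner ℝ z v) ^ 2 +
      2 * (inner ℝ z u * inner ℝ z v) := by
    intro z; rw [inner_add_right]; ring
  simp only [e] at h3
  rw [integral_add (f := fun z => inner ℝ z u ^ 2 + inner ℝ z v ^ 2)
    (g := fun z => 2 * (inner ℝ z u * inner ℝ z v)) ((hL2 u).integrable_sq.add (hL2 v).integrable_sq)
    (((hL2 u).integrable_mul (hL2 v)).const_mul 2), integral_add (hL2 u).integrable_sq
    (hL2 v).integrable_sq, integral_const_mul, hsq, hsq, map_add, inner_add_left, inner_add_right,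
    inner_add_right, ← hC.inner_left_eq_inner_right v u, real_inner_comm u (C v)] at h3
  linarith

theorem exists_isGaussianWith_zero {C : H →L[ℝ] H} (hC : C.IsPositive)
    (hC' : Summable fun i => inner ℝ (basis H i) (C (basis H i))) :
    ∃ μ : Measure H, IsGaussianWith μ 0 C := by
  obtain ⟨μ, hp, hμ⟩ := exists_charFun_eq hC hC'
  exact ⟨μ, isGaussianWith_of_charFun hC hμ⟩

end Existence

/-! ### Moments of Gaussian measures, uniformly in the covariance. -/

section Moments

variable {H : Type*} [NormedAddCommGroup H] [InnerProductSpace ℝ H] [CompleteSpace H]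
  [MeasurableSpace H] [BorelSpace H] [SecondCountableTopology H]

/-- Orthonormal vectors are √2 apart, so balls of radius 1/2 around them are disjoint, and a
separable space has only countably many disjoint nonempty open sets. -/
theorem countable_basisIndex (H : Type*) [NormedAddCommGroup H] [InnerProductSpace ℝ H]
    [CompleteSpace H] [SecondCountableTopology H] : Countable (basisIndex H) := by
  have h : (univ : Set (basisIndex H)).PairwiseDisjoint fun i => Metric.ball (basis H i) (1 / 2) := by
    intro i _ j _ hij
    refine Metric.ball_disjoint_ball ?_
    have hd : ‖basis H i - basis H j‖ ^ 2 = 2 := by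
      rw [norm_sub_sq_real, (basis H).orthonormal.2 hij, (basis H).orthonormal.1,
        (basis H).orthonormal.1]
      norm_num
    rw [dist_eq_norm]
    nlinarith [norm_nonneg (basis H i - basis H j)]
  have := h.countable_of_isOpen (fun _ _ => Metric.isOpen_ball)
    (fun i _ => ⟨basis H i, Metric.mem_ball_self (by norm_num)⟩)
  exact countable_univ_iff.1 this

theorem IsGaussianWith.charFun_eq {μ : Measure H} {m : H} {C : H →L[ℝ] H}
    (hμ : IsGaussianWith μ m C) (u : H) :
    charFun μ u = Complex.exp ((inner ℝ m u : ℝ) * Complex.I - (inner ℝ u (C u) : ℝ) / 2) := by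
  have := hμ.isGaussian
  have hm : ∫ z, inner ℝ u z ∂μ = inner ℝ m u := by
    simp_rw [real_inner_comm _ u]; exact hμ.mean u
  have hv : Var[fun z => inner ℝ u z; μ] = inner ℝ u (C u) := by
    rw [variance_eq_integral (by fun_prop), hm, ← hμ.covariance u u]
    refine integral_congr_ae (Eventually.of_forall fun z => ?_)
    simp only [inner_sub_left, real_inner_comm z u]
    ring
  rw [IsGaussian.charFun_eq, integral_complex_ofReal, hm, hv]

theorem IsGaussianWith.map_const_add {μ : Measure H} {C : H →L[ℝ] H}
    (hμ : IsGaussianWith μ 0 C) (m : H) : IsGaussianWith (μ.map (m + ·)) m C := by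
  have := hμ.isGaussian
  refine ⟨inferInstance, fun u => ?_, fun u v => ?_⟩
  · rw [integral_map (by fun_prop) (by fun_prop)]
    simp only [inner_add_left]
    rw [integral_add (by simp) (IsGaussian.integrable_id.inner_const u), hμ.mean]
    simp
  · rw [integral_map (by fun_prop) (by fun_prop)]
    simpa using hμ.covariance u v

/-- For covariance operators the default value 0 in `gaussianLaw` is never taken. -/
theorem gaussianLaw_spec {C : H →L[ℝ] H} (hC : C.IsPositive)
    (hC' : Summable fun i => inner ℝ (basis H i) (C (basis H i))) (m : H) :
    IsGaussianWith (gaussianLaw m C) m C := by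
  obtain ⟨μ, hμ⟩ := exists_isGaussianWith_zero hC hC'
  have h : ∃ μ, IsGaussianWith μ m C := ⟨_, hμ.map_const_add m⟩
  rw [gaussianLaw, dif_pos h]
  exact h.choose_spec

theorem gaussianLaw_eq_map {C : H →L[ℝ] H} (hC : C.IsPositive)
    (hC' : Summable fun i => inner ℝ (basis H i) (C (basis H i))) (m : H) :
    gaussianLaw m C = (gaussianLaw 0 C).map (m + ·) :=
  (gaussianLaw_spec hC hC' m).unique ((gaussianLaw_spec hC hC' 0).map_const_add m)

theorem IsGaussianWith.integrable_norm_pow {μ : Measure H} {m : H} {C : H →L[ℝ] H}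
    (hμ : IsGaussianWith μ m C) (n : ℕ) : Integrable (fun z => ‖z‖ ^ n) μ := by
  have := hμ.isGaussian
  exact (IsGaussian.memLp_id μ n (by simp)).integrable_norm_pow' 

/-- The moment `E ⟨B z, z⟩` of a centred Gaussian variable as a trace. -/
theorem IsGaussianWith.hasSum_inner {μ : Measure H} {C : H →L[ℝ] H}
    (hμ : IsGaussianWith μ 0 C) (B : H →L[ℝ] H) :
    HasSum (fun i => inner ℝ (basis H i) (C (B (basis H i)))) (∫ z, inner ℝ (B z) z ∂μ) := by
  have := hμ.isGaussian
  -- Dominated convergence along finite subsets needs their `atTop` filter to be countably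
  -- generated.
  have := countable_basisIndex H
  have hL2 : ∀ u : H, MemLp (fun z => inner ℝ z u) 2 μ := fun u =>
    (IsGaussian.memLp_id μ 2 (by norm_num)).inner_const u
  have hterm : ∀ i, ∫ z, inner ℝ z (basis H i) * inner ℝ z (B (basis H i)) ∂μ =
      inner ℝ (basis H i) (C (B (basis H i))) := fun i => by
    simpa using hμ.covariance (basis H i) (B (basis H i))
  have hsum : ∀ (z : H) (F : Finset (basisIndex H)),
      ∑ i ∈ F, inner ℝ z (basis H i) * inner ℝ z (B (basis H i)) =
        inner ℝ (B.adjoint z) (∑ i ∈ F, inner ℝ (basis H i) z • basis H i) := by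
    intro z F
    rw [inner_sum]
    refine Finset.sum_congr rfl fun i _ => ?_
    rw [inner_smul_right, ContinuousLinearMap.adjoint_inner_left, real_inner_comm z]
  have hproj : ∀ z : H, HasSum (fun i => inner ℝ (basis H i) z • basis H i) z := fun z => by
    simpa [HilbertBasis.repr_apply_apply] using (basis H).hasSum_repr z
  have hnorm : ∀ (z : H) (F : Finset (basisIndex H)),
      ‖∑ i ∈ F, inner ℝ (basis H i) z • basis H i‖ ≤ ‖z‖ := by
    intro z F
    have h1 : ‖∑ i ∈ F, inner ℝ (basis H i) z • basis H i‖ ^ 2 =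
        ∑ i ∈ F, (inner ℝ (basis H i) z) ^ 2 := by
      rw [← real_inner_self_eq_norm_sq, (basis H).orthonormal.inner_sum]
      simp [sq]
    refine (sq_le_sq₀ (norm_nonneg _) (norm_nonneg _)).1 ?_
    rw [h1]
    exact sum_le_hasSum F (fun _ _ => sq_nonneg _) (hasSum_inner_sq (basis H) z)
  have hlim : Tendsto (fun F : Finset (basisIndex H) =>
      ∫ z, ∑ i ∈ F, inner ℝ z (basis H i) * inner ℝ z (B (basis H i)) ∂μ) atTop
      (𝓝 (∫ z, inner ℝ (B z) z ∂μ)) := by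
    refine tendsto_integral_filter_of_dominated_convergence
      (bound := fun z => ‖B.adjoint‖ * ‖z‖ ^ 2) ?_ ?_ ?_ ?_
    · exact Eventually.of_forall fun F => by fun_prop
    · refine Eventually.of_forall fun F => Eventually.of_forall fun z => ?_
      rw [hsum]
      refine (norm_inner_le_norm _ _).trans ?_
      calc _ ≤ (‖B.adjoint‖ * ‖z‖) * ‖z‖ :=
            mul_le_mul (B.adjoint.le_opNorm z) (hnorm z F) (norm_nonneg _) (by positivity)
        _ = _ := by ring
    · exact (hμ.integrable_norm_pow 2).const_mul _
    · refine Eventually.of_forall fun z => ?_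
      simp only [hsum]
      have h1 : inner ℝ (B z) z = inner ℝ (B.adjoint z) z := by
        rw [ContinuousLinearMap.adjoint_inner_left, real_inner_comm]
      rw [h1]
      exact (tendsto_const_nhds).inner (hproj z)
  refine hlim.congr fun F => ?_
  rw [integral_finsetSum (f := fun i z => inner ℝ z (basis H i) * inner ℝ z (B (basis H i))) _
    fun i _ => (hL2 _).integrable_mul (hL2 _)]
  exact Finset.sum_congr rfl fun i _ => hterm i

/-- Fernique's exponential bound depends only on a radius carrying a fixed mass greater than 1/2.
Chebyshev supplies such a radius proportional to √a, so the moments scale like a^k with a constant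
independent of the measure. -/
theorem exists_gaussian_moment_bound (H : Type*) [NormedAddCommGroup H] [InnerProductSpace ℝ H]
    [CompleteSpace H] [MeasurableSpace H] [BorelSpace H] [SecondCountableTopology H] (k : ℕ) :
    ∃ D : ℝ, 0 ≤ D ∧ ∀ (μ : Measure H) (C : H →L[ℝ] H), IsGaussianWith μ 0 C → ∀ a : ℝ, 0 < a →
      ∫ z, ‖z‖ ^ 2 ∂μ ≤ a → ∫ z, ‖z‖ ^ (2 * k) ∂μ ≤ D * a ^ k := by
  -- Chebyshev at radius r = 2√a leaves mass at most a/r² = 1/4 outside the ball; Fernique's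
  -- argument accepts any value strictly between 1/2 and 1.
  set c : ℝ≥0∞ := ENNReal.ofReal (3 / 4) with hc
  have hc_gt : 2⁻¹ < c := by
    rw [hc, ← ENNReal.ofReal_ofNat, ← ENNReal.ofReal_inv_of_pos (by norm_num)]
    exact (ENNReal.ofReal_lt_ofReal_iff (by norm_num)).2 (by norm_num)
  have hc_lt : c < 1 := by
    rw [hc, ← ENNReal.ofReal_one]
    exact (ENNReal.ofReal_lt_ofReal_iff (by norm_num)).2 (by norm_num)
  set L := Fernique.logRatio c
  have hL : 0 < L := Fernique.logRatio_pos hc_gt hc_lt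
  set K : ℝ≥0∞ := .ofReal (Real.exp L)
        + ∑' n : ℕ, .ofReal (Real.exp (-2⁻¹ * Real.log (c / (1 - c)).toReal * 2 ^ n)) with hK
  have hKtop : K < ∞ := by
    refine ENNReal.add_lt_top.mpr ⟨ENNReal.ofReal_lt_top, ?_⟩
    refine Summable.tsum_ofReal_lt_top <|
      Real.summable_exp_nat_mul_of_ge ?_ (fun i ↦ mod_cast (Nat.lt_pow_self (by simp)).le)
    refine mul_neg_of_neg_of_pos (by simp) (Real.log_pos ?_)
    have h1 : (1 : ℝ≥0∞) - c = ENNReal.ofReal (1 / 4) := by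
      rw [hc, ← ENNReal.ofReal_one, ← ENNReal.ofReal_sub _ (by norm_num)]
      norm_num
    rw [h1, hc, ← ENNReal.ofReal_div_of_pos (by norm_num), ENNReal.toReal_ofReal (by norm_num)]
    norm_num
  -- From y^k ≤ k! e^y with y = L‖x‖²/r², where r² = 4a, and K the bound on the exponential moment.
  refine ⟨k.factorial * (4 / L) ^ k * K.toReal, by positivity, fun μ C hμ a ha hle => ?_⟩
  have := hμ.isGaussian
  set r : ℝ := 2 * √a with hr
  have hr0 : 0 < r := by positivity
  have hr2 : r ^ 2 = 4 * a := by rw [hr, mul_pow, Real.sq_sqrt ha.le]; norm_num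
  have hmean : μ[id] = 0 := by
    refine integral_eq_zero_of_forall_integral_inner_eq_zero ℝ _ IsGaussian.integrable_id fun u => ?_
    have := hμ.mean u
    simp only [inner_zero_left] at this
    rw [← this]
    simp [real_inner_comm]
  have hrot := IsGaussian.map_rotation_eq_self hmean (-(Real.pi / 4))
  have hball : c ≤ μ {x | ‖x‖ ≤ r} := by
    have h1 := mul_meas_ge_le_integral_of_nonneg (μ := μ) (f := fun z : H => ‖z‖ ^ 2)
      (Eventually.of_forall fun _ => sq_nonneg _) (hμ.integrable_norm_pow 2) (4 * a)
    have h2 : μ.real {x | 4 * a ≤ ‖x‖ ^ 2} ≤ 1 / 4 := by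
      have : 4 * a * μ.real {x | 4 * a ≤ ‖x‖ ^ 2} ≤ a := h1.trans hle
      nlinarith
    have h3 : μ.real {x | ‖x‖ ≤ r}ᶜ ≤ 1 / 4 := by
      refine (measureReal_mono ?_).trans h2
      intro x hx
      simp only [mem_compl_iff, mem_ofPred_eq, not_le] at hx ⊢
      rw [← hr2]
      exact pow_le_pow_left₀ hr0.le hx.le 2
    rw [probReal_compl_eq_one_sub (measurableSet_le (by fun_prop) (by fun_prop))] at h3
    rw [hc, ENNReal.ofReal_le_iff_le_toReal (measure_ne_top _ _)]
    change 3 / 4 ≤ μ.real {x | ‖x‖ ≤ r}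
    linarith
  have hF := lintegral_exp_mul_sq_norm_le_of_map_rotation_eq_self hrot hball hc_gt
  rw [← hK] at hF
  have hint : Integrable (fun x : H => Real.exp (L * r⁻¹ ^ 2 * ‖x‖ ^ 2)) μ := by
    refine ⟨by fun_prop, ?_⟩
    rw [hasFiniteIntegral_iff_ofReal (Eventually.of_forall fun _ => (Real.exp_pos _).le)]
    exact hF.trans_lt hKtop
  have hexp : ∫ x, Real.exp (L * r⁻¹ ^ 2 * ‖x‖ ^ 2) ∂μ ≤ K.toReal := by
    rw [integral_eq_lintegral_of_nonneg_ae (Eventually.of_forall fun _ => (Real.exp_pos _).le)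
      hint.1]
    exact ENNReal.toReal_mono hKtop.ne hF
  have hpt : ∀ x : H, ‖x‖ ^ (2 * k) ≤
      (k.factorial * (4 / L) ^ k * a ^ k) * Real.exp (L * r⁻¹ ^ 2 * ‖x‖ ^ 2) := by
    intro x
    have h1 := Real.pow_div_factorial_le_exp (x := L * r⁻¹ ^ 2 * ‖x‖ ^ 2) (by positivity) k
    rw [div_le_iff₀ (by positivity)] at h1
    have h2 : ‖x‖ ^ (2 * k) = ((4 / L) ^ k * a ^ k) * (L * r⁻¹ ^ 2 * ‖x‖ ^ 2) ^ k := by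
      rw [pow_mul, ← mul_pow, ← mul_pow]
      congr 1
      rw [inv_pow, hr2]
      field_simp
    rw [h2]
    calc _ ≤ ((4 / L) ^ k * a ^ k) * (Real.exp (L * r⁻¹ ^ 2 * ‖x‖ ^ 2) * k.factorial) := by gcongr
      _ = _ := by ring
  calc ∫ z, ‖z‖ ^ (2 * k) ∂μ
      ≤ ∫ x, (k.factorial * (4 / L) ^ k * a ^ k) * Real.exp (L * r⁻¹ ^ 2 * ‖x‖ ^ 2) ∂μ :=
        integral_mono (hμ.integrable_norm_pow _) (hint.const_mul _) hpt
    _ ≤ (k.factorial * (4 / L) ^ k * a ^ k) * K.toReal := by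
        rw [integral_const_mul]; gcongr
    _ = _ := by ring

end Moments

/-! ### Transition laws and the Chapman-Kolmogorov equation. -/

section Transition

variable {H : Type*} [NormedAddCommGroup H] [InnerProductSpace ℝ H] [CompleteSpace H]
  [MeasurableSpace H] [BorelSpace H] [SecondCountableTopology H]
  {S : ℝ → H →L[ℝ] H} {R Q : H →L[ℝ] H}

theorem isPositive_smul_convCov (hS : IsC0Semigroup S) (hR : IsPosSqrt R Q)
    (hQ : IsCovarianceOperator Q) (σ : ℝ) {t : ℝ} (ht : 0 ≤ t) :
    (σ ^ 2 • convCov S Q t).IsPositive := by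
  refine ⟨fun u v => ?_, fun u => ?_⟩
  · change inner ℝ (σ ^ 2 • convCov S Q t u) v = inner ℝ u (σ ^ 2 • convCov S Q t v)
    rw [inner_smul_left, inner_smul_right, inner_convCov_comm hS hR hQ ht, real_inner_comm]
    rfl
  · change 0 ≤ inner ℝ (σ ^ 2 • convCov S Q t u) u
    rw [inner_smul_left, real_inner_comm]
    exact mul_nonneg (sq_nonneg _) (inner_convCov_nonneg hS hR hQ ht u)

theorem summable_inner_smul_convCov (hS : IsC0Semigroup S) (hR : IsPosSqrt R Q)
    (hQ : IsCovarianceOperator Q) (σ : ℝ) {t : ℝ} (ht : 0 ≤ t) :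
    Summable fun i => inner ℝ (basis H i) ((σ ^ 2 • convCov S Q t) (basis H i)) := by
  simpa [inner_smul_right] using (summable_inner_convCov hS hR hQ ht).mul_left (σ ^ 2)

theorem transitionLaw_spec (hS : IsC0Semigroup S) (hR : IsPosSqrt R Q)
    (hQ : IsCovarianceOperator Q) (σ : ℝ) {t : ℝ} (ht : 0 ≤ t) (x : H) :
    IsGaussianWith (transitionLaw S Q σ t x) (S t x) (σ ^ 2 • convCov S Q t) :=
  gaussianLaw_spec (isPositive_smul_convCov hS hR hQ σ ht)
    (summable_inner_smul_convCov hS hR hQ σ ht) _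

theorem transitionLaw_eq_map (hS : IsC0Semigroup S) (hR : IsPosSqrt R Q)
    (hQ : IsCovarianceOperator Q) (σ : ℝ) {t : ℝ} (ht : 0 ≤ t) (x : H) :
    transitionLaw S Q σ t x = (transitionLaw S Q σ t 0).map (S t x + ·) := by
  have := gaussianLaw_eq_map (isPositive_smul_convCov hS hR hQ σ ht)
    (summable_inner_smul_convCov hS hR hQ σ ht) (S t x)
  rw [transitionLaw, this, transitionLaw, map_zero]

theorem transitionLaw_zero (hS : IsC0Semigroup S) (hR : IsPosSqrt R Q)
    (hQ : IsCovarianceOperator Q) (σ : ℝ) (x : H) :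
    transitionLaw S Q σ 0 x = Measure.dirac x := by
  have h := transitionLaw_spec hS hR hQ σ le_rfl x
  have := h.isGaussian
  refine Measure.ext_of_charFun (funext fun u => ?_)
  rw [h.charFun_eq, charFun_dirac, hS.zero, convCov_zero]
  simp

/-- The Chapman-Kolmogorov equation. -/
theorem transitionLaw_add (hS : IsC0Semigroup S) (hR : IsPosSqrt R Q)
    (hQ : IsCovarianceOperator Q) (σ : ℝ) {t ε : ℝ} (ht : 0 ≤ t) (hε : 0 ≤ ε) (x : H) :
    transitionLaw S Q σ (t + ε) x =
      ((transitionLaw S Q σ ε x).prod (transitionLaw S Q σ t 0)).map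
        (fun p => S t p.1 + p.2) := by
  have h := transitionLaw_spec hS hR hQ σ (add_nonneg ht hε) x
  have h1 := transitionLaw_spec hS hR hQ σ hε x
  have h2 := transitionLaw_spec hS hR hQ σ ht 0
  have := h.isGaussian
  have := h1.isGaussian
  have := h2.isGaussian
  have : IsProbabilityMeasure (((transitionLaw S Q σ ε x).prod (transitionLaw S Q σ t 0)).map
        (fun p => S t p.1 + p.2)) := Measure.isProbabilityMeasure_map (by fun_prop)
  refine Measure.ext_of_charFun (funext fun u => ?_)
  rw [h.charFun_eq, charFun_apply, integral_map (by fun_prop) (by fun_prop)]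
  have e : ∀ p : H × H, Complex.exp ((inner ℝ (S t p.1 + p.2) u : ℝ) * Complex.I) =
      Complex.exp ((inner ℝ p.1 ((S t).adjoint u) : ℝ) * Complex.I) *
        Complex.exp ((inner ℝ p.2 u : ℝ) * Complex.I) := by
    intro p
    rw [← Complex.exp_add, inner_add_left, ContinuousLinearMap.adjoint_inner_right]
    push_cast
    ring_nf
  simp only [e]
  rw [integral_prod_mul (fun y => Complex.exp ((inner ℝ y ((S t).adjoint u) : ℝ) * Complex.I))
    (fun z => Complex.exp ((inner ℝ z u : ℝ) * Complex.I)), ← charFun_apply, ← charFun_apply,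
    h1.charFun_eq, h2.charFun_eq, ← Complex.exp_add, convCov_add hS hR hQ ht hε,
    hS.add t ε ht hε]
  congr 1
  simp only [smul_apply, add_apply, ContinuousLinearMap.comp_apply, inner_smul_right,
    inner_add_right, map_zero, inner_zero_left, ContinuousLinearMap.adjoint_inner_right,
    ContinuousLinearMap.adjoint_inner_left]
  push_cast
  ring

end Transition

/-! ### Second-order Taylor expansion with a moving base point. -/

section Taylor

variable {H : Type*} [NormedAddCommGroup H] [InnerProductSpace ℝ H] [CompleteSpace H]

theorem hasFDerivAt_gradient {f : H → ℝ} {x : H} (hf : DifferentiableAt ℝ f x) :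
    HasFDerivAt f (innerSL ℝ (gradient f x)) x :=
  hf.hasGradientAt.hasFDerivAt

/-- The mean value inequality is used twice, first for the gradient minus B and then for χ along the
segment. The base point y and the operator B are decoupled because S_ε x moves with ε while the
Hessian stays frozen at x. -/
theorem abs_taylor_two_le {f : H → ℝ} (hf : Differentiable ℝ f)
    (hg : Differentiable ℝ (gradient f)) {x : H} {B : H →L[ℝ] H} {η ρ : ℝ}
    (hη : 0 ≤ η) (hB : ∀ w ∈ Metric.ball x ρ, ‖fderiv ℝ (gradient f) w - B‖ ≤ η) {y z : H}
    (hy : y ∈ Metric.ball x ρ) (hyz : y + z ∈ Metric.ball x ρ) :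
    |f (y + z) - f y - inner ℝ (gradient f y) z - 1 / 2 * inner ℝ (B z) z| ≤ η * ‖z‖ ^ 2 := by
  have hmem : ∀ θ ∈ Icc (0 : ℝ) 1, y + θ • z ∈ Metric.ball x ρ := fun θ hθ => by
    have := (convex_ball x ρ).add_smul_sub_mem hy hyz hθ
    simpa using this
  have hgrad : ∀ θ ∈ Icc (0 : ℝ) 1,
      ‖gradient f (y + θ • z) - gradient f y - θ • B z‖ ≤ η * ‖z‖ := fun θ hθ => by
    have h1 := (convex_ball x ρ).norm_image_sub_le_of_norm_hasFDerivWithin_le' (φ := B)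
      (fun w _ => (hg w).hasFDerivAt.hasFDerivWithinAt) hB hy (hmem θ hθ)
    have h2 : y + θ • z - y = θ • z := by abel
    rw [h2, map_smul] at h1
    refine h1.trans ?_
    rw [norm_smul, Real.norm_of_nonneg hθ.1]
    exact mul_le_mul_of_nonneg_left (mul_le_of_le_one_left (norm_nonneg _) hθ.2) hη
  let χ : ℝ → ℝ := fun θ => f (y + θ • z) - θ * inner ℝ (gradient f y) z
    - 1 / 2 * θ ^ 2 * inner ℝ (B z) z
  have hder : ∀ θ : ℝ, HasDerivAt χ (inner ℝ (gradient f (y + θ • z)) z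
      - inner ℝ (gradient f y) z - θ * inner ℝ (B z) z) θ := fun θ => by
    have h1 : HasDerivAt (fun θ : ℝ => y + θ • z) z θ := by
      simpa using ((hasDerivAt_id θ).smul_const z).const_add y
    have h2 := (hasFDerivAt_gradient (hf (y + θ • z))).comp_hasDerivAt θ h1
    have h3 := (h2.sub ((hasDerivAt_id θ).mul_const (inner ℝ (gradient f y) z))).sub
      ((((hasDerivAt_id θ).pow 2).const_mul (1 / 2)).mul_const (inner ℝ (B z) z))
    refine h3.congr_deriv ?_
    simp
  have hχ := norm_image_sub_le_of_norm_deriv_le_segment_01' (f := χ) (C := η * ‖z‖ ^ 2)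
    (fun θ _ => (hder θ).hasDerivWithinAt) (fun θ hθ => by
      have e : inner ℝ (gradient f (y + θ • z)) z - inner ℝ (gradient f y) z
          - θ * inner ℝ (B z) z = inner ℝ (gradient f (y + θ • z) - gradient f y - θ • B z) z := by
        rw [inner_sub_left, inner_sub_left, inner_smul_left]; simp
      rw [e]
      refine (norm_inner_le_norm _ _).trans ?_
      calc _ ≤ (η * ‖z‖) * ‖z‖ := by gcongr; exact hgrad θ ⟨hθ.1, hθ.2.le⟩
        _ = _ := by ring)
  have e2 : χ 1 - χ 0 = f (y + z) - f y - inner ℝ (gradient f y) z - 1 / 2 * inner ℝ (B z) z := by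
    simp [χ]; ring
  rwa [e2] at hχ

/-- Near x the Hessian is nearly constant. Away from it, ‖z‖ is bounded below, so polynomial growth
is absorbed in a power of ‖z‖. The exponent 2(m + 2) is even, dominates all terms, and its Gaussian
moment is O(ε^(m+2)) = o(ε). -/
theorem exists_taylor_two_bound {f : H → ℝ} (hf : Differentiable ℝ f)
    (hg : Differentiable ℝ (gradient f)) {x : H}
    (hgc : ContinuousAt (fderiv ℝ (gradient f)) x) {C : ℝ} {m : ℕ}
    (hC : ∀ x, |f x| + ‖gradient f x‖ + ‖fderiv ℝ (gradient f) x‖ ≤ C * (1 + ‖x‖) ^ m)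
    {η : ℝ} (hη : 0 < η) :
    ∃ D : ℝ, 0 ≤ D ∧ ∀ᶠ y in 𝓝 x, ∀ z,
      |f (y + z) - f y - inner ℝ (gradient f y) z
        - 1 / 2 * inner ℝ (fderiv ℝ (gradient f) x z) z| ≤
        η * ‖z‖ ^ 2 + D * ‖z‖ ^ (2 * (m + 2)) := by
  set B := fderiv ℝ (gradient f) x with hBdef
  obtain ⟨ρ', hρ', hball⟩ := Metric.continuousAt_iff.1 hgc η hη
  set ρ := min ρ' 1
  have hρ : 0 < ρ := lt_min hρ' one_pos
  have hB : ∀ w ∈ Metric.ball x ρ, ‖fderiv ℝ (gradient f) w - B‖ ≤ η := fun w hw => by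
    rw [← dist_eq_norm]
    exact (hball (lt_of_lt_of_le hw (min_le_left _ _))).le
  have hC0 : 0 ≤ C := by
    have h := (add_nonneg (add_nonneg (abs_nonneg _) (norm_nonneg _)) (norm_nonneg _)).trans (hC x)
    exact nonneg_of_mul_nonneg_left h (by positivity)
  set δ := ρ / 2
  have hδ : 0 < δ := by positivity
  -- Chosen so that c‖z‖ ≥ 2 + ‖x‖ + ‖z‖ once ‖z‖ ≥ δ, which bounds 1 + ‖w‖ for w = x, y and y + z.
  set c := (2 + ‖x‖) / δ + 1 with hc
  have hc1 : 1 ≤ c := by rw [hc]; linarith [show 0 ≤ (2 + ‖x‖) / δ by positivity]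
  -- One factor for each of the four terms of the remainder.
  refine ⟨4 * C * c ^ (2 * (m + 2)), by positivity, ?_⟩
  filter_upwards [Metric.ball_mem_nhds x hδ] with y hy z
  rw [Metric.mem_ball, dist_eq_norm] at hy
  rcases lt_or_ge ‖z‖ δ with hz | hz
  · have h1 := abs_taylor_two_le hf hg hη.le hB (y := y) (z := z)
      (by rw [Metric.mem_ball, dist_eq_norm]; simp only [δ] at hy; linarith)
      (by
        rw [Metric.mem_ball, dist_eq_norm]
        have : y + z - x = (y - x) + z := by abel
        rw [this]
        refine (norm_add_le _ _).trans_lt ?_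
        simp only [δ] at hy hz
        linarith)
    exact h1.trans (le_add_of_nonneg_right (by positivity))
  · set a := c * ‖z‖ with ha
    have ha2 : 2 + ‖x‖ + ‖z‖ ≤ a := by
      have : 2 + ‖x‖ = (2 + ‖x‖) / δ * δ := by field_simp
      rw [ha, hc, add_mul, one_mul]
      have h3 : (2 + ‖x‖) / δ * δ ≤ (2 + ‖x‖) / δ * ‖z‖ := by gcongr
      linarith
    have ha1 : 1 ≤ a := by linarith [norm_nonneg x, norm_nonneg z]
    have hza : ‖z‖ ≤ a := by linarith [norm_nonneg x]
    have hyx : ‖y‖ ≤ ‖x‖ + 1 := by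
      have h4 : ‖y‖ ≤ ‖y - x‖ + ‖x‖ := by simpa using norm_add_le (y - x) x
      have h5 : δ ≤ 1 := by
        have : ρ ≤ 1 := min_le_right _ _
        simp only [δ]; linarith
      linarith
    have key : ∀ w : H, 1 + ‖w‖ ≤ a →
        |f w| + ‖gradient f w‖ + ‖fderiv ℝ (gradient f) w‖ ≤ C * a ^ m := fun w hw =>
      (hC w).trans (by gcongr)
    have kyz := key (y + z) (by linarith [norm_add_le y z])
    have ky := key y (by linarith [norm_nonneg z])
    have kx := key x (by linarith [norm_nonneg z])
    have p1 : C * a ^ m ≤ C * a ^ (2 * (m + 2)) := by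
      gcongr
      omega
    have p2 : C * a ^ m * a ≤ C * a ^ (2 * (m + 2)) := by
      rw [mul_assoc, ← pow_succ]; gcongr
      omega
    have p3 : C * a ^ m * a ^ 2 ≤ C * a ^ (2 * (m + 2)) := by
      rw [mul_assoc, ← pow_add]; gcongr
      omega
    have q1 : |f (y + z)| ≤ C * a ^ (2 * (m + 2)) := by
      linarith [norm_nonneg (gradient f (y + z)), norm_nonneg (fderiv ℝ (gradient f) (y + z))]
    have q2 : |f y| ≤ C * a ^ (2 * (m + 2)) := by
      linarith [norm_nonneg (gradient f y), norm_nonneg (fderiv ℝ (gradient f) y)]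
    have q3 : |inner ℝ (gradient f y) z| ≤ C * a ^ (2 * (m + 2)) := by
      refine (abs_real_inner_le_norm _ _).trans (le_trans ?_ p2)
      have : ‖gradient f y‖ ≤ C * a ^ m := by
        linarith [abs_nonneg (f y), norm_nonneg (fderiv ℝ (gradient f) y)]
      gcongr
    have q4 : |1 / 2 * inner ℝ (B z) z| ≤ C * a ^ (2 * (m + 2)) := by
      have h6 : ‖B‖ ≤ C * a ^ m := by
        linarith [abs_nonneg (f x), norm_nonneg (gradient f x)]
      have h7 : |inner ℝ (B z) z| ≤ C * a ^ m * a ^ 2 := by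
        refine (abs_real_inner_le_norm _ _).trans ?_
        calc ‖B z‖ * ‖z‖ ≤ (‖B‖ * ‖z‖) * ‖z‖ := by gcongr; exact B.le_opNorm z
          _ = ‖B‖ * ‖z‖ ^ 2 := by ring
          _ ≤ _ := by gcongr
      rw [abs_mul, abs_of_pos (by norm_num : (0 : ℝ) < 1 / 2)]
      linarith [abs_nonneg (inner ℝ (B z) z)]
    have hfin : |f (y + z) - f y - inner ℝ (gradient f y) z - 1 / 2 * inner ℝ (B z) z| ≤
        4 * (C * a ^ (2 * (m + 2))) := by
      rw [abs_le] at *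
      constructor <;> linarith
    refine hfin.trans ?_
    have e : 4 * (C * a ^ (2 * (m + 2))) = 4 * C * c ^ (2 * (m + 2)) * ‖z‖ ^ (2 * (m + 2)) := by
      rw [ha, mul_pow]; ring
    rw [e]
    exact le_add_of_nonneg_left (by positivity)

end Taylor

/-! ### Short-time limits of the drift and of the diffusion. -/

section Generator

variable {H : Type*} [NormedAddCommGroup H] [InnerProductSpace ℝ H] [CompleteSpace H]
  {S : ℝ → H →L[ℝ] H} {R Q : H →L[ℝ] H} {A : H →ₗ.[ℝ] H}

theorem IsC0Semigroup.tendsto_zero (hS : IsC0Semigroup S) (x : H) :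
    Tendsto (fun ε => S ε x) (𝓝[>] 0) (𝓝 x) := by
  have h := (hS.continuousOn x 0 (by simp)).tendsto
  rw [hS.zero] at h
  exact h.mono_left (nhdsWithin_mono _ Ioi_subset_Ici_self)

/-- By the mean value theorem and `IsGenerator.inner_sub`, the quotient is the inner product of the
average of S_s x with A* of the gradient at an intermediate point. Both factors converge, the second
by continuity of A*∇f. -/
theorem IsGenerator.tendsto_drift (hA : IsGenerator S A) (hS : IsC0Semigroup S) {f : H → ℝ}
    (hf : Differentiable ℝ f) (hmem : ∀ x, gradient f x ∈ A.adjoint.domain)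
    (hcont : Continuous fun x => adjApply A (gradient f x)) (x : H) :
    Tendsto (fun ε : ℝ => ε⁻¹ * (f (S ε x) - f x)) (𝓝[>] 0)
      (𝓝 (inner ℝ x (adjApply A (gradient f x)))) := by
  have hmvt : ∀ ε : ℝ, ∃ y ∈ segment ℝ x (S ε x),
      f (S ε x) - f x = inner ℝ (gradient f y) (S ε x - x) := fun ε => by
    obtain ⟨y, hy, h⟩ := domain_mvt (f := f) (s := univ) (x := x) (y := S ε x)
      (fun w _ => (hasFDerivAt_gradient (hf w)).hasFDerivWithinAt) convex_univ trivial trivial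
    exact ⟨y, hy, by simpa using h⟩
  choose y hy hfy using hmvt
  have hylim : Tendsto y (𝓝[>] 0) (𝓝 x) := by
    rw [tendsto_iff_norm_sub_tendsto_zero]
    have h0 := tendsto_iff_norm_sub_tendsto_zero.1 (hS.tendsto_zero x)
    refine squeeze_zero (fun _ => norm_nonneg _) (fun ε => ?_) h0
    obtain ⟨θ, hθ, he⟩ := (segment_eq_image' ℝ x (S ε x)) ▸ hy ε
    rw [← he]
    simp only [add_sub_cancel_left, norm_smul, Real.norm_of_nonneg hθ.1]
    exact mul_le_of_le_one_left (norm_nonneg _) hθ.2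
  have h1 := hS.tendsto_average x le_rfl
  rw [hS.zero] at h1
  have h2 := Filter.Tendsto.inner (𝕜 := ℝ) h1 ((hcont.tendsto x).comp hylim)
  refine h2.congr' ?_
  filter_upwards [self_mem_nhdsWithin] with ε hε
  have hε0 : (0 : ℝ) ≤ ε := le_of_lt hε
  rw [hfy, real_inner_comm (S ε x - x), hA.inner_sub hS x _ hε0 (hmem _), inner_smul_left]
  simp

variable [MeasurableSpace H] [BorelSpace H] [SecondCountableTopology H]

theorem integral_norm_sq_transitionLaw_le (hS : IsC0Semigroup S) (hR : IsPosSqrt R Q)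
    (hQ : IsCovarianceOperator Q) (σ : ℝ) :
    ∃ K : ℝ, 0 < K ∧ ∀ ε ∈ Icc (0 : ℝ) 1, ∫ z, ‖z‖ ^ 2 ∂(transitionLaw S Q σ ε 0) ≤ K * ε := by
  obtain ⟨K, hK0, hK⟩ := sum_inner_convCov_le hS hR hQ 1
  refine ⟨σ ^ 2 * K + 1, by positivity, fun ε hε => ?_⟩
  have h := transitionLaw_spec hS hR hQ σ hε.1 0
  rw [map_zero] at h
  have h1 := h.hasSum_inner (ContinuousLinearMap.id ℝ H)
  simp only [ContinuousLinearMap.id_apply, real_inner_self_eq_norm_sq] at h1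
  have h2 : ∫ z, ‖z‖ ^ 2 ∂(transitionLaw S Q σ ε 0) ≤ σ ^ 2 * (K * ε) := by
    refine le_of_tendsto h1 (Eventually.of_forall fun F => ?_)
    simp only [smul_apply, inner_smul_right, ← Finset.mul_sum]
    gcongr
    exact hK ε hε F
  linarith [hε.1]

/-- The integral is σ² Tr[Q_ε B], so the short-time estimate on Q_ε applies after passing to the
limit over finite sums. -/
theorem tendsto_integral_quadratic (hS : IsC0Semigroup S) (hR : IsPosSqrt R Q)
    (hQ : IsCovarianceOperator Q) (σ : ℝ) (B : H →L[ℝ] H) :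
    Tendsto (fun ε : ℝ => ε⁻¹ * ∫ z, inner ℝ (B z) z ∂(transitionLaw S Q σ ε 0)) (𝓝[>] 0)
      (𝓝 (σ ^ 2 * hR.traceCLM hQ B)) := by
  rw [Metric.tendsto_nhds]
  intro r hr
  -- Makes δσ²‖B‖ < r; the added 1 covers B = 0.
  set δ := r / (2 * (σ ^ 2 * ‖B‖ + 1))
  have hδ : 0 < δ := by positivity
  filter_upwards [eventually_abs_sum_convCov_sub_le hS hR hQ hδ, self_mem_nhdsWithin]
    with ε hε hε0
  have hε0 : 0 < ε := hε0
  have h := transitionLaw_spec hS hR hQ σ hε0.le 0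
  rw [map_zero] at h
  have h1 := h.hasSum_inner B
  have h2 : HasSum (fun i => inner ℝ (basis H i) (Q (B (basis H i)))) (hR.traceCLM hQ B) :=
    (hR.summable_trace hQ B).hasSum
  have h3 : |∫ z, inner ℝ (B z) z ∂(transitionLaw S Q σ ε 0) - ε * (σ ^ 2 * hR.traceCLM hQ B)| ≤
      σ ^ 2 * (δ * ‖B‖ * ε) := by
    have hl : Tendsto (fun F : Finset (basisIndex H) =>
        |∑ i ∈ F, inner ℝ (basis H i) ((σ ^ 2 • convCov S Q ε) (B (basis H i)))
          - ε * (σ ^ 2 * ∑ i ∈ F, inner ℝ (basis H i) (Q (B (basis H i))))|) atTop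
        (𝓝 |∫ z, inner ℝ (B z) z ∂(transitionLaw S Q σ ε 0)
          - ε * (σ ^ 2 * hR.traceCLM hQ B)|) :=
      (Tendsto.sub h1 ((Tendsto.const_mul (σ ^ 2) h2).const_mul ε)).abs
    refine le_of_tendsto hl (Eventually.of_forall fun F => ?_)
    simp only [smul_apply, inner_smul_right, ← Finset.mul_sum]
    have e : ∀ a b : ℝ, σ ^ 2 * a - ε * (σ ^ 2 * b) = σ ^ 2 * (a - ε * b) := fun a b => by ring
    rw [e, abs_mul, abs_of_nonneg (sq_nonneg σ)]
    gcongr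
    exact hε B F
  rw [Real.dist_eq]
  have h4 : ε⁻¹ * (∫ z, inner ℝ (B z) z ∂(transitionLaw S Q σ ε 0)) - σ ^ 2 * hR.traceCLM hQ B =
      ε⁻¹ * (∫ z, inner ℝ (B z) z ∂(transitionLaw S Q σ ε 0)
        - ε * (σ ^ 2 * hR.traceCLM hQ B)) := by
    field_simp
  rw [h4, abs_mul, abs_of_pos (inv_pos.2 hε0)]
  calc ε⁻¹ * _ ≤ ε⁻¹ * (σ ^ 2 * (δ * ‖B‖ * ε)) := by gcongr
    _ = δ * (σ ^ 2 * ‖B‖) := by field_simp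
    _ < δ * (2 * (σ ^ 2 * ‖B‖ + 1)) := by
        have : 0 ≤ σ ^ 2 * ‖B‖ := by positivity
        exact mul_lt_mul_of_pos_left (by linarith) hδ
    _ = r := by simp only [δ]; field_simp

theorem tendsto_diffusion (hS : IsC0Semigroup S) (hR : IsPosSqrt R Q)
    (hQ : IsCovarianceOperator Q) (σ : ℝ) {f : H → ℝ} (hf : Differentiable ℝ f)
    (hg : Differentiable ℝ (gradient f)) {x : H}
    (hgc : ContinuousAt (fderiv ℝ (gradient f)) x) {C : ℝ} {m : ℕ}
    (hC : ∀ x, |f x| + ‖gradient f x‖ + ‖fderiv ℝ (gradient f) x‖ ≤ C * (1 + ‖x‖) ^ m) :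
    Tendsto (fun ε : ℝ => ε⁻¹ * ((∫ z, f (S ε x + z) ∂(transitionLaw S Q σ ε 0)) - f (S ε x)))
      (𝓝[>] 0) (𝓝 (1 / 2 * (σ ^ 2 * hR.traceCLM hQ (fderiv ℝ (gradient f) x)))) := by
  set B := fderiv ℝ (gradient f) x with hB
  have hq := (tendsto_integral_quadratic hS hR hQ σ B).const_mul (1 / 2)
  obtain ⟨K, hK0, hK⟩ := integral_norm_sq_transitionLaw_le hS hR hQ σ
  obtain ⟨D', hD'0, hD'⟩ := exists_gaussian_moment_bound H (m + 2)
  suffices h : Tendsto (fun ε : ℝ =>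
      ε⁻¹ * ((∫ z, f (S ε x + z) ∂(transitionLaw S Q σ ε 0)) - f (S ε x)) -
      1 / 2 * (ε⁻¹ * ∫ z, inner ℝ (B z) z ∂(transitionLaw S Q σ ε 0))) (𝓝[>] 0) (𝓝 0) by
    have := h.add hq
    rw [zero_add] at this
    exact this.congr fun ε => by ring
  rw [Metric.tendsto_nhds]
  intro r hr
  -- The quadratic part of the remainder then contributes r/2 after division by ε, and the higher
  -- moment vanishes in the limit.
  set η := r / (2 * K)
  have hη : 0 < η := by positivity
  obtain ⟨D, hD0, hD⟩ := exists_taylor_two_bound hf hg hgc hC hη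
  have hpoly : Tendsto (fun ε : ℝ => η * K + D * (D' * K ^ (m + 2) * ε ^ (m + 1))) (𝓝[>] 0)
      (𝓝 (η * K + D * (D' * K ^ (m + 2) * 0 ^ (m + 1)))) :=
    ((by fun_prop : Continuous fun ε : ℝ =>
      η * K + D * (D' * K ^ (m + 2) * ε ^ (m + 1))).tendsto 0).mono_left nhdsWithin_le_nhds
  have hlt : ∀ᶠ ε in 𝓝[>] (0 : ℝ), η * K + D * (D' * K ^ (m + 2) * ε ^ (m + 1)) < r := by
    refine hpoly.eventually_lt_const ?_
    have : η * K = r / 2 := by simp only [η]; field_simp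
    simp only [this, ne_eq, Nat.add_eq_zero_iff, one_ne_zero, and_false, not_false_eq_true,
      zero_pow, mul_zero, add_zero]
    linarith
  filter_upwards [(hS.tendsto_zero x).eventually hD, hlt, Ioo_mem_nhdsGT (one_pos (α := ℝ))]
    with ε hTay hlt hε
  have hε0 : 0 < ε := hε.1
  have h := transitionLaw_spec hS hR hQ σ hε0.le 0
  rw [map_zero] at h
  have := h.isGaussian
  set μ := transitionLaw S Q σ ε 0
  set y := S ε x
  have i1 : Integrable (fun z => inner ℝ (gradient f y) z) μ :=
    IsGaussian.integrable_id.const_inner _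
  have i2 : Integrable (fun z => 1 / 2 * inner ℝ (B z) z) μ := by
    refine ((h.integrable_norm_pow 2).const_mul (1 / 2 * ‖B‖)).mono' (by fun_prop)
      (Eventually.of_forall fun z => ?_)
    rw [norm_mul, Real.norm_of_nonneg (by norm_num : (0 : ℝ) ≤ 1 / 2)]
    calc 1 / 2 * ‖inner ℝ (B z) z‖ ≤ 1 / 2 * ((‖B‖ * ‖z‖) * ‖z‖) := by
          gcongr
          exact (norm_inner_le_norm _ _).trans (by gcongr; exact B.le_opNorm z)
      _ = _ := by ring
  have hbint : Integrable (fun z : H => η * ‖z‖ ^ 2 + D * ‖z‖ ^ (2 * (m + 2))) μ :=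
    ((h.integrable_norm_pow _).const_mul _).add ((h.integrable_norm_pow _).const_mul _)
  have i3 : Integrable (fun z => f (y + z) - f y - inner ℝ (gradient f y) z
      - 1 / 2 * inner ℝ (B z) z) μ := by
    refine hbint.mono' ?_ (Eventually.of_forall hTay)
    have c1 : Continuous fun z => f (y + z) := hf.continuous.comp (by fun_prop)
    have c2 : Continuous fun z => inner ℝ (gradient f y) z := by fun_prop
    have c3 : Continuous fun z => 1 / 2 * inner ℝ (B z) z := by fun_prop
    exact (((c1.sub continuous_const).sub c2).sub c3).aestronglyMeasurable
  have hmean : ∫ z, inner ℝ (gradient f y) z ∂μ = 0 := by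
    have := h.mean (gradient f y)
    simpa [real_inner_comm] using this
  have hsplit : (∫ z, f (y + z) ∂μ) - f y - 1 / 2 * ∫ z, inner ℝ (B z) z ∂μ =
      ∫ z, (f (y + z) - f y - inner ℝ (gradient f y) z - 1 / 2 * inner ℝ (B z) z) ∂μ := by
    have e : ∫ z, f (y + z) ∂μ = ∫ z, ((f (y + z) - f y - inner ℝ (gradient f y) z
        - 1 / 2 * inner ℝ (B z) z) + (f y + inner ℝ (gradient f y) z
        + 1 / 2 * inner ℝ (B z) z)) ∂μ := by
      congr 1; ext z; ring
    have i4 : Integrable (fun z => f y + inner ℝ (gradient f y) z) μ :=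
      (integrable_const (f y)).add i1
    have i5 : Integrable (fun z => f y + inner ℝ (gradient f y) z + 1 / 2 * inner ℝ (B z) z) μ :=
      i4.add i2
    rw [e, integral_add i3 i5, integral_add i4 i2,
      integral_add (integrable_const _) i1, hmean, integral_const_mul, integral_const,
      probReal_univ, one_smul]
    ring
  have hbound : |(∫ z, f (y + z) ∂μ) - f y - 1 / 2 * ∫ z, inner ℝ (B z) z ∂μ| ≤
      η * (K * ε) + D * (D' * (K * ε) ^ (m + 2)) := by
    rw [hsplit]
    have hT : ∀ z, ‖f (y + z) - f y - inner ℝ (gradient f y) z - 1 / 2 * inner ℝ (B z) z‖ ≤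
      η * ‖z‖ ^ 2 + D * ‖z‖ ^ (2 * (m + 2)) := hTay
    refine (norm_integral_le_of_norm_le hbint (Eventually.of_forall hT)).trans ?_
    rw [integral_add ((h.integrable_norm_pow _).const_mul _)
      ((h.integrable_norm_pow _).const_mul _), integral_const_mul, integral_const_mul]
    have hKε := hK ε ⟨hε0.le, hε.2.le⟩
    gcongr
    exact hD' μ _ h (K * ε) (by positivity) hKε
  rw [Real.dist_eq, sub_zero]
  have e : ε⁻¹ * ((∫ z, f (y + z) ∂μ) - f y) - 1 / 2 * (ε⁻¹ * ∫ z, inner ℝ (B z) z ∂μ) =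
      ε⁻¹ * ((∫ z, f (y + z) ∂μ) - f y - 1 / 2 * ∫ z, inner ℝ (B z) z ∂μ) := by ring
  rw [e, abs_mul, abs_of_pos (inv_pos.2 hε0)]
  refine lt_of_le_of_lt ?_ hlt
  calc ε⁻¹ * _ ≤ ε⁻¹ * (η * (K * ε) + D * (D' * (K * ε) ^ (m + 2))) := by gcongr
    _ = η * K + D * (D' * K ^ (m + 2) * ε ^ (m + 1)) := by
      rw [mul_pow, pow_succ ε (m + 1)]
      field_simp

end Generator

/-! ### The Kolmogorov backward equation for h. -/

section Kolmogorov

variable {H : Type*} [NormedAddCommGroup H] [InnerProductSpace ℝ H] [CompleteSpace H]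
  [MeasurableSpace H] [BorelSpace H] [SecondCountableTopology H]
  {S : ℝ → H →L[ℝ] H} {R Q : H →L[ℝ] H} {A : H →ₗ.[ℝ] H} {σ T : ℝ} {G : H → ℝ}

theorem hFun_terminal (hS : IsC0Semigroup S) (hR : IsPosSqrt R Q)
    (hQ : IsCovarianceOperator Q) (x : H) :
    hFun S Q σ T G T x = Real.exp (-G x) := by
  rw [hFun, sub_self, transitionLaw_zero hS hR hQ, integral_dirac]

theorem hFun_pos (hS : IsC0Semigroup S) (hR : IsPosSqrt R Q) (hQ : IsCovarianceOperator Q)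
    (hGint : ∀ t ∈ Icc 0 T, ∀ x, Integrable (fun z => Real.exp (-G z)) (transitionLaw S Q σ t x))
    {t : ℝ} (ht : t ∈ Icc 0 T) (x : H) : 0 < hFun S Q σ T G t x := by
  have ht' : T - t ∈ Icc 0 T := ⟨by linarith [ht.2], by linarith [ht.1]⟩
  have := (transitionLaw_spec hS hR hQ σ ht'.1 x).isGaussian
  exact integral_exp_pos (hGint _ ht' x)

/-- The Markov property of `h`. -/
theorem hFun_sub (hS : IsC0Semigroup S) (hR : IsPosSqrt R Q) (hQ : IsCovarianceOperator Q)
    (hG : Measurable G)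
    (hGint : ∀ t ∈ Icc 0 T, ∀ x, Integrable (fun z => Real.exp (-G z)) (transitionLaw S Q σ t x))
    {t ε : ℝ} (ht : t ≤ T) (hε : 0 ≤ ε) (hεt : ε ≤ t) (x : H) :
    hFun S Q σ T G (t - ε) x =
      ∫ z, hFun S Q σ T G t (S ε x + z) ∂(transitionLaw S Q σ ε 0) := by
  have hTt : 0 ≤ T - t := by linarith
  have hadd := transitionLaw_add hS hR hQ σ hTt hε x
  have hint := hGint (T - t + ε) ⟨by linarith, by linarith⟩ x
  have e : T - (t - ε) = T - t + ε := by ring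
  have := (transitionLaw_spec hS hR hQ σ hTt 0).isGaussian
  have := (transitionLaw_spec hS hR hQ σ hε x).isGaussian
  have hm : Measurable fun z => Real.exp (-G z) := by fun_prop
  rw [hadd, integrable_map_measure hm.aestronglyMeasurable (by fun_prop)] at hint
  replace hint : Integrable (fun p : H × H => Real.exp (-G (S (T - t) p.1 + p.2)))
    ((transitionLaw S Q σ ε x).prod (transitionLaw S Q σ (T - t) 0)) := hint
  rw [hFun, e, hadd, integral_map (by fun_prop) hm.aestronglyMeasurable, integral_prod _ hint]
  have h1 : ∀ y, ∫ z, Real.exp (-G (S (T - t) y + z)) ∂(transitionLaw S Q σ (T - t) 0) =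
      hFun S Q σ T G t y := fun y => by
    rw [hFun, transitionLaw_eq_map hS hR hQ σ hTt y,
      integral_map (by fun_prop) hm.aestronglyMeasurable]
  simp only [h1]
  rw [transitionLaw_eq_map hS hR hQ σ hε x, (measurableEmbedding_addLeft _).integral_map]

theorem hFun_solvesKBE (hS : IsC0Semigroup S) (hA : IsGenerator S A) (hR : IsPosSqrt R Q)
    (hQ : IsCovarianceOperator Q) (hG : Measurable G)
    (hGint : ∀ t ∈ Icc 0 T, ∀ x, Integrable (fun z => Real.exp (-G z)) (transitionLaw S Q σ t x))
    (hreg : IsRegular A T (hFun S Q σ T G)) :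
    SolvesKBE A Q σ T (fun x => Real.exp (-G x)) (hFun S Q σ T G) := by
  refine ⟨hreg.toIsC12, fun t ht x => ?_, hFun_terminal hS hR hQ⟩
  set h := hFun S Q σ T G with hh
  have hslice : ∀ {F : Type _} [TopologicalSpace F] {g : ℝ × H → F},
      ContinuousOn g (Ioo 0 T ×ˢ univ) → Continuous fun y => g (t, y) := fun hg =>
    continuousOn_univ.1 (hg.comp (by fun_prop) fun y _ => ⟨ht, trivial⟩)
  obtain ⟨C, m, hC⟩ := hreg.growth
  have hdrift := hA.tendsto_drift hS (hreg.diff_x t ht) (hreg.mem_adjoint t ht)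
    (hslice hreg.cont_adj) x
  have hdiff := tendsto_diffusion hS hR hQ σ (hreg.diff_x t ht) (hreg.diff_xx t ht)
    (x := x) (hslice hreg.cont_Dxx).continuousAt (C := C) (m := m) fun y => by
      refine le_trans ?_ (hC t ht y)
      have h1 := abs_nonneg (dt h t y)
      have h2 := norm_nonneg (adjApply A (Dx h t y))
      change |h t y| + ‖Dx h t y‖ + ‖Dxx h t y‖ ≤ _
      linarith
  have hsum := hdrift.add hdiff
  -- The Markov identity steps backward in time, which produces the minus sign on the time
  -- derivative.
  have hder : Tendsto (fun ε : ℝ => ε⁻¹ * (h (t - ε) x - h t x)) (𝓝[>] 0) (𝓝 (-dt h t x)) := by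
    have h1 : HasDerivAt (fun s => h s x) (dt h t x) t := (hreg.diff_t t ht x).hasDerivAt
    have h2 : HasDerivAt (fun ε : ℝ => h (t - ε) x) (-dt h t x) 0 := by
      have := HasDerivAt.comp_const_sub t 0 (f := fun s => h s x) (f' := dt h t x) (by simpa using h1)
      simpa using this
    have h3 := (hasDerivAt_iff_tendsto_slope_zero.1 h2).mono_left
      (nhdsWithin_mono _ (show Ioi (0 : ℝ) ⊆ {0}ᶜ from fun ε hε => ne_of_gt hε))
    simpa using h3
  have hev : (fun ε : ℝ => ε⁻¹ * (h (t - ε) x - h t x)) =ᶠ[𝓝[>] 0] fun ε =>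
      ε⁻¹ * (h t (S ε x) - h t x) +
        ε⁻¹ * ((∫ z, h t (S ε x + z) ∂(transitionLaw S Q σ ε 0)) - h t (S ε x)) := by
    filter_upwards [Ioo_mem_nhdsGT ht.1] with ε hε
    rw [hh, hFun_sub hS hR hQ hG hGint ht.2.le hε.1.le hε.2.le x]
    ring
  have huniq := tendsto_nhds_unique (hder.congr' hev) hsum
  rw [hR.genL_eq hQ]
  change -dt h t x = inner ℝ x (adjApply A (Dx h t x)) +
    1 / 2 * (σ ^ 2 * hR.traceCLM hQ (Dxx h t x)) at huniq
  linarith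

end Kolmogorov

/-! ### Product and logarithm rules, the Hopf-Cole identity and Doob's transform. -/

section Calculus

variable {H : Type*} [NormedAddCommGroup H] [InnerProductSpace ℝ H] [CompleteSpace H]
  {A : H →ₗ.[ℝ] H} {T : ℝ} {f g h : ℝ → H → ℝ} {t : ℝ} {x : H}

theorem adjApply_of_mem {p : H} (hp : p ∈ A.adjoint.domain) :
    adjApply A p = A.adjoint ⟨p, hp⟩ := dif_pos hp

/-- Membership is essential: outside D(A*) the value of `adjApply` is the default 0, so linearity
holds only on the domain. -/
theorem adjApply_add {p q : H} (hp : p ∈ A.adjoint.domain) (hq : q ∈ A.adjoint.domain) :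
    adjApply A (p + q) = adjApply A p + adjApply A q := by
  rw [adjApply_of_mem hp, adjApply_of_mem hq, adjApply_of_mem (add_mem hp hq),
    ← LinearPMap.map_add]
  rfl

theorem adjApply_smul (c : ℝ) {p : H} (hp : p ∈ A.adjoint.domain) :
    adjApply A (c • p) = c • adjApply A p := by
  rw [adjApply_of_mem hp, adjApply_of_mem (A.adjoint.domain.smul_mem c hp), ← LinearPMap.map_smul]
  rfl

/-- The rank one operator `y ↦ ⟨p, y⟩ q`. -/
noncomputable abbrev rankOne (p q : H) : H →L[ℝ] H := (innerSL ℝ p).smulRight q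

theorem continuous_rankOne : Continuous fun p : H × H => rankOne p.1 p.2 := by
  have h1 : Continuous fun p : (H →L[ℝ] ℝ) × H => ContinuousLinearMap.smulRightL ℝ H H p.1 p.2 :=
    (ContinuousLinearMap.smulRightL ℝ H H).continuous₂
  have h2 : Continuous fun p : H × H => ((innerSL ℝ p.1 : H →L[ℝ] ℝ), p.2) := by fun_prop
  exact h1.comp h2

theorem norm_rankOne_le (p q : H) : ‖rankOne p q‖ ≤ ‖p‖ * ‖q‖ := by
  rw [rankOne, ContinuousLinearMap.norm_smulRight_apply, innerSL_apply_norm]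

theorem Dx_eq_of_hasFDerivAt {p : H} (hf : HasFDerivAt (f t) (innerSL ℝ p) x) : Dx f t x = p :=
  HasGradientAt.gradient hf

theorem IsC12.hasFDerivAt (hf : IsC12 A T f) (ht : t ∈ Ioo 0 T) (x : H) :
    HasFDerivAt (f t) (innerSL ℝ (Dx f t x)) x :=
  hasFDerivAt_gradient (hf.diff_x t ht x)

theorem IsC12.hasFDerivAt_Dx (hf : IsC12 A T f) (ht : t ∈ Ioo 0 T) (x : H) :
    HasFDerivAt (Dx f t) (Dxx f t x) x :=
  (hf.diff_xx t ht x).hasFDerivAt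

theorem IsC12.hasDerivAt (hf : IsC12 A T f) (ht : t ∈ Ioo 0 T) (x : H) :
    HasDerivAt (fun s => f s x) (dt f t x) t :=
  (hf.diff_t t ht x).hasDerivAt

theorem IsC12.continuousOn_Ioo (hf : IsC12 A T f) :
    ContinuousOn (fun p : ℝ × H => f p.1 p.2) (Ioo 0 T ×ˢ univ) :=
  hf.cont.mono (prod_mono Ioo_subset_Icc_self subset_rfl)

/-! ### Products -/

theorem IsC12.dt_mul (hf : IsC12 A T f) (hg : IsC12 A T g) (ht : t ∈ Ioo 0 T) (x : H) :
    dt (fun s y => f s y * g s y) t x = dt f t x * g t x + f t x * dt g t x :=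
  ((hf.hasDerivAt ht x).mul (hg.hasDerivAt ht x)).deriv

theorem IsC12.hasFDerivAt_mul (hf : IsC12 A T f) (hg : IsC12 A T g) (ht : t ∈ Ioo 0 T) (x : H) :
    HasFDerivAt (fun y => f t y * g t y)
      (innerSL ℝ (f t x • Dx g t x + g t x • Dx f t x)) x := by
  have := (hf.hasFDerivAt ht x).mul (hg.hasFDerivAt ht x)
  rw [map_add, map_smul, map_smul]
  exact this

theorem IsC12.Dx_mul (hf : IsC12 A T f) (hg : IsC12 A T g) (ht : t ∈ Ioo 0 T) (x : H) :
    Dx (fun s y => f s y * g s y) t x = f t x • Dx g t x + g t x • Dx f t x :=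
  Dx_eq_of_hasFDerivAt (hf.hasFDerivAt_mul hg ht x)

theorem IsC12.hasFDerivAt_Dx_mul (hf : IsC12 A T f) (hg : IsC12 A T g) (ht : t ∈ Ioo 0 T)
    (x : H) : HasFDerivAt (Dx (fun s y => f s y * g s y) t)
      ((f t x • Dxx g t x + rankOne (Dx f t x) (Dx g t x)) +
        (g t x • Dxx f t x + rankOne (Dx g t x) (Dx f t x))) x := by
  have e : Dx (fun s y => f s y * g s y) t = fun y => f t y • Dx g t y + g t y • Dx f t y :=
    funext fun y => hf.Dx_mul hg ht y
  rw [e]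
  exact ((hf.hasFDerivAt ht x).smul (hg.hasFDerivAt_Dx ht x)).add
    ((hg.hasFDerivAt ht x).smul (hf.hasFDerivAt_Dx ht x))

theorem IsC12.Dxx_mul (hf : IsC12 A T f) (hg : IsC12 A T g) (ht : t ∈ Ioo 0 T) (x : H) :
    Dxx (fun s y => f s y * g s y) t x =
      (f t x • Dxx g t x + rankOne (Dx f t x) (Dx g t x)) +
        (g t x • Dxx f t x + rankOne (Dx g t x) (Dx f t x)) :=
  (hf.hasFDerivAt_Dx_mul hg ht x).fderiv

theorem IsC12.adjApply_mul (hf : IsC12 A T f) (hg : IsC12 A T g) (ht : t ∈ Ioo 0 T) (x : H) :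
    adjApply A (Dx (fun s y => f s y * g s y) t x) =
      f t x • adjApply A (Dx g t x) + g t x • adjApply A (Dx f t x) := by
  have m1 := hf.mem_adjoint t ht x
  have m2 := hg.mem_adjoint t ht x
  rw [hf.Dx_mul hg ht, adjApply_add (A.adjoint.domain.smul_mem _ m2)
    (A.adjoint.domain.smul_mem _ m1), adjApply_smul _ m1, adjApply_smul _ m2]

theorem IsC12.mul (hf : IsC12 A T f) (hg : IsC12 A T g) :
    IsC12 A T (fun s y => f s y * g s y) where
  cont := hf.cont.mul hg.cont
  diff_t t ht x := (hf.diff_t t ht x).mul (hg.diff_t t ht x)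
  diff_x t ht := (hf.diff_x t ht).mul (hg.diff_x t ht)
  diff_xx t ht x := (hf.hasFDerivAt_Dx_mul hg ht x).differentiableAt
  mem_adjoint t ht x := by
    rw [hf.Dx_mul hg ht]
    exact add_mem (A.adjoint.domain.smul_mem _ (hg.mem_adjoint t ht x))
      (A.adjoint.domain.smul_mem _ (hf.mem_adjoint t ht x))
  cont_dt := ((hf.cont_dt.mul hg.continuousOn_Ioo).add (hf.continuousOn_Ioo.mul hg.cont_dt)).congr
    fun p hp => hf.dt_mul hg hp.1 p.2
  cont_Dx := ((hf.continuousOn_Ioo.smul hg.cont_Dx).add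
    (hg.continuousOn_Ioo.smul hf.cont_Dx)).congr fun p hp => hf.Dx_mul hg hp.1 p.2
  cont_Dxx := (((hf.continuousOn_Ioo.smul hg.cont_Dxx).add
      (continuous_rankOne.comp_continuousOn (hf.cont_Dx.prodMk hg.cont_Dx))).add
    ((hg.continuousOn_Ioo.smul hf.cont_Dxx).add
      (continuous_rankOne.comp_continuousOn (hg.cont_Dx.prodMk hf.cont_Dx)))).congr
    fun p hp => hf.Dxx_mul hg hp.1 p.2
  cont_adj := ((hf.continuousOn_Ioo.smul hg.cont_adj).add
    (hg.continuousOn_Ioo.smul hf.cont_adj)).congr fun p hp => hf.adjApply_mul hg hp.1 p.2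

/-- The two rank-one terms of the Hessian of the product have the same trace against Q, which
cancels the factor ½ and leaves one cross term. -/
theorem IsC12.genL_mul {R Q : H →L[ℝ] H} (hR : IsPosSqrt R Q) (hQ : IsCovarianceOperator Q)
    (σ : ℝ) (hf : IsC12 A T f) (hg : IsC12 A T g) (ht : t ∈ Ioo 0 T) (x : H) :
    genL A Q σ (fun s y => f s y * g s y) t x =
      f t x * genL A Q σ g t x + g t x * genL A Q σ f t x +
        σ ^ 2 * inner ℝ (R (Dx f t x)) (R (Dx g t x)) := by
  simp only [hR.genL_eq hQ, hf.adjApply_mul hg ht, hf.Dxx_mul hg ht, map_add, map_smul,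
    inner_add_right, inner_smul_right, hR.traceCLM_rankOne, smul_eq_mul]
  rw [real_inner_comm (R (Dx f t x))]
  ring

/-! ### Logarithms -/

theorem IsC12.dt_neg_log (hf : IsC12 A T f) (hpos : ∀ t ∈ Icc 0 T, ∀ x, 0 < f t x)
    (ht : t ∈ Ioo 0 T) (x : H) :
    dt (fun s y => -Real.log (f s y)) t x = -((f t x)⁻¹ * dt f t x) := by
  have := ((hf.hasDerivAt ht x).log (hpos t (Ioo_subset_Icc_self ht) x).ne').neg.deriv
  rw [div_eq_inv_mul] at this
  exact this

theorem IsC12.hasFDerivAt_log (hf : IsC12 A T f) (hpos : ∀ t ∈ Icc 0 T, ∀ x, 0 < f t x)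
    (ht : t ∈ Ioo 0 T) (x : H) :
    HasFDerivAt (fun y => Real.log (f t y)) (innerSL ℝ ((f t x)⁻¹ • Dx f t x)) x := by
  rw [map_smul]
  exact (hf.hasFDerivAt ht x).log (hpos t (Ioo_subset_Icc_self ht) x).ne'

theorem IsC12.Dx_log (hf : IsC12 A T f) (hpos : ∀ t ∈ Icc 0 T, ∀ x, 0 < f t x)
    (ht : t ∈ Ioo 0 T) (x : H) :
    Dx (fun s y => Real.log (f s y)) t x = (f t x)⁻¹ • Dx f t x :=
  Dx_eq_of_hasFDerivAt (hf.hasFDerivAt_log hpos ht x)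

theorem IsC12.hasFDerivAt_neg_log (hf : IsC12 A T f) (hpos : ∀ t ∈ Icc 0 T, ∀ x, 0 < f t x)
    (ht : t ∈ Ioo 0 T) (x : H) :
    HasFDerivAt (fun y => -Real.log (f t y)) (innerSL ℝ (-(f t x)⁻¹ • Dx f t x)) x := by
  rw [neg_smul, map_neg]
  exact (hf.hasFDerivAt_log hpos ht x).neg

theorem IsC12.Dx_neg_log (hf : IsC12 A T f) (hpos : ∀ t ∈ Icc 0 T, ∀ x, 0 < f t x)
    (ht : t ∈ Ioo 0 T) (x : H) :
    Dx (fun s y => -Real.log (f s y)) t x = -(f t x)⁻¹ • Dx f t x :=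
  Dx_eq_of_hasFDerivAt (hf.hasFDerivAt_neg_log hpos ht x)

theorem IsC12.hasFDerivAt_Dx_neg_log (hf : IsC12 A T f) (hpos : ∀ t ∈ Icc 0 T, ∀ x, 0 < f t x)
    (ht : t ∈ Ioo 0 T) (x : H) :
    HasFDerivAt (Dx (fun s y => -Real.log (f s y)) t)
      (-(f t x)⁻¹ • Dxx f t x + ((f t x)⁻¹ ^ 2) • rankOne (Dx f t x) (Dx f t x)) x := by
  have e : Dx (fun s y => -Real.log (f s y)) t = fun y => -(f t y)⁻¹ • Dx f t y :=
    funext fun y => hf.Dx_neg_log hpos ht y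
  have hne := (hpos t (Ioo_subset_Icc_self ht) x).ne'
  have h1 : HasFDerivAt (fun y => -(f t y)⁻¹) (((f t x)⁻¹ ^ 2) • innerSL ℝ (Dx f t x)) x := by
    have := ((hasDerivAt_inv hne).neg).comp_hasFDerivAt x (hf.hasFDerivAt ht x)
    refine this.congr_fderiv ?_
    simp [inv_pow]
  rw [e]
  refine (h1.smul (hf.hasFDerivAt_Dx ht x)).congr_fderiv ?_
  congr 1
  ext y
  simp [rankOne, smul_smul]

theorem IsC12.Dxx_neg_log (hf : IsC12 A T f) (hpos : ∀ t ∈ Icc 0 T, ∀ x, 0 < f t x)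
    (ht : t ∈ Ioo 0 T) (x : H) :
    Dxx (fun s y => -Real.log (f s y)) t x =
      -(f t x)⁻¹ • Dxx f t x + ((f t x)⁻¹ ^ 2) • rankOne (Dx f t x) (Dx f t x) :=
  (hf.hasFDerivAt_Dx_neg_log hpos ht x).fderiv

theorem IsC12.adjApply_neg_log (hf : IsC12 A T f) (hpos : ∀ t ∈ Icc 0 T, ∀ x, 0 < f t x)
    (ht : t ∈ Ioo 0 T) (x : H) :
    adjApply A (Dx (fun s y => -Real.log (f s y)) t x) = -(f t x)⁻¹ • adjApply A (Dx f t x) := by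
  rw [hf.Dx_neg_log hpos ht, adjApply_smul _ (hf.mem_adjoint t ht x)]

theorem IsC12.neg_log (hf : IsC12 A T f) (hpos : ∀ t ∈ Icc 0 T, ∀ x, 0 < f t x) :
    IsC12 A T (fun s y => -Real.log (f s y)) := by
  have hne : ∀ p ∈ Ioo 0 T ×ˢ (univ : Set H), f p.1 p.2 ≠ 0 := fun p hp =>
    (hpos p.1 (Ioo_subset_Icc_self hp.1) p.2).ne'
  have hinv := (hf.continuousOn_Ioo.inv₀ hne)
  exact
  { cont := (hf.cont.log fun p hp => (hpos p.1 hp.1 p.2).ne').neg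
    diff_t := fun t ht x =>
      ((hf.diff_t t ht x).log (hpos t (Ioo_subset_Icc_self ht) x).ne').neg
    diff_x := fun t ht x => (hf.hasFDerivAt_neg_log hpos ht x).differentiableAt
    diff_xx := fun t ht x => (hf.hasFDerivAt_Dx_neg_log hpos ht x).differentiableAt
    mem_adjoint := fun t ht x => by
      rw [hf.Dx_neg_log hpos ht]
      exact A.adjoint.domain.smul_mem _ (hf.mem_adjoint t ht x)
    cont_dt := ((hinv.mul hf.cont_dt).neg).congr fun p hp => hf.dt_neg_log hpos hp.1 p.2
    cont_Dx := (hinv.neg.smul hf.cont_Dx).congr fun p hp => hf.Dx_neg_log hpos hp.1 p.2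
    cont_Dxx := ((hinv.neg.smul hf.cont_Dxx).add ((hinv.pow 2).smul
      (continuous_rankOne.comp_continuousOn (hf.cont_Dx.prodMk hf.cont_Dx)))).congr
        fun p hp => hf.Dxx_neg_log hpos hp.1 p.2
    cont_adj := (hinv.neg.smul hf.cont_adj).congr fun p hp => hf.adjApply_neg_log hpos hp.1 p.2 }

theorem IsC12.genL_neg_log {R Q : H →L[ℝ] H} (hR : IsPosSqrt R Q) (hQ : IsCovarianceOperator Q)
    (σ : ℝ) (hf : IsC12 A T f) (hpos : ∀ t ∈ Icc 0 T, ∀ x, 0 < f t x) (ht : t ∈ Ioo 0 T) (x : H) :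
    genL A Q σ (fun s y => -Real.log (f s y)) t x =
      -((f t x)⁻¹ * genL A Q σ f t x) +
        1 / 2 * (σ ^ 2 * ((f t x)⁻¹ ^ 2 * ‖R (Dx f t x)‖ ^ 2)) := by
  simp only [hR.genL_eq hQ, hf.adjApply_neg_log hpos ht, hf.Dxx_neg_log hpos ht, map_add,
    map_smul, inner_smul_right, hR.traceCLM_rankOne, smul_eq_mul, real_inner_self_eq_norm_sq]
  ring

/-! ### The Hopf-Cole transform of a positive solution of the Kolmogorov equation -/

variable {R Q : H →L[ℝ] H} {σ : ℝ} {φ : H → ℝ}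

theorem norm_sq_smul_Dx_neg_log (hf : IsC12 A T f) (hpos : ∀ t ∈ Icc 0 T, ∀ x, 0 < f t x)
    (ht : t ∈ Ioo 0 T) (x : H) :
    ‖σ • R (Dx (fun s y => -Real.log (f s y)) t x)‖ ^ 2 =
      σ ^ 2 * ((f t x)⁻¹ ^ 2 * ‖R (Dx f t x)‖ ^ 2) := by
  rw [hf.Dx_neg_log hpos ht, map_smul, norm_smul, norm_smul, mul_pow, mul_pow, norm_neg]
  simp [Real.norm_eq_abs, sq_abs]

/-- The quadratic term that the logarithm adds to L is exactly the nonlinearity; what remains is the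
Kolmogorov equation divided by -h. -/
theorem SolvesKBE.solvesHJB (hR : IsPosSqrt R Q) (hQ : IsCovarianceOperator Q)
    (hf : SolvesKBE A Q σ T (fun x => Real.exp (-φ x)) f)
    (hpos : ∀ t ∈ Icc 0 T, ∀ x, 0 < f t x) :
    SolvesHJB A Q R σ T φ (fun s y => -Real.log (f s y)) where
  isC12 := hf.isC12.neg_log hpos
  eqn t ht x := by
    have h1 := hf.eqn t ht x
    rw [hf.isC12.dt_neg_log hpos ht, hf.isC12.genL_neg_log hR hQ σ hpos ht,
      norm_sq_smul_Dx_neg_log hf.isC12 hpos ht]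
    linear_combination -(f t x)⁻¹ * h1
  terminal x := by simp [hf.terminal x]

theorem optFeedback_eq_neg (hf : IsC12 A T f) (hpos : ∀ t ∈ Icc 0 T, ∀ x, 0 < f t x)
    (ht : t ∈ Ioo 0 T) (x : H) :
    optFeedback R σ f t x = -(σ • R (Dx (fun s y => -Real.log (f s y)) t x)) := by
  rw [optFeedback, hf.Dx_neg_log hpos ht, hf.Dx_log hpos ht, neg_smul, map_neg, smul_neg, neg_neg]

theorem optFeedback_eq_smul (hf : IsC12 A T f) (hpos : ∀ t ∈ Icc 0 T, ∀ x, 0 < f t x)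
    (ht : t ∈ Ioo 0 T) (x : H) :
    optFeedback R σ f t x = (f t x)⁻¹ • (σ • R (Dx f t x)) := by
  rw [optFeedback, hf.Dx_log hpos ht, map_smul, smul_comm]

theorem IsPosSqrt.smul_optFeedback (hR : IsPosSqrt R Q) (f : ℝ → H → ℝ) (t : ℝ) (x : H) :
    σ • R (optFeedback R σ f t x) = σ ^ 2 • Q (Dx (fun s y => Real.log (f s y)) t x) := by
  have hRR : ∀ y, R (R y) = Q y := fun y => by rw [← hR.sq, ContinuousLinearMap.comp_apply]
  rw [optFeedback, map_smul, smul_smul, hRR, ← pow_two]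

/-- Completing the square exhibits both the unique minimiser -p and the minimal value. -/
theorem inner_add_half_norm_sq (a p : H) :
    inner ℝ a p + 1 / 2 * ‖a‖ ^ 2 = 1 / 2 * ‖a + p‖ ^ 2 - 1 / 2 * ‖p‖ ^ 2 := by
  rw [norm_add_sq_real]; ring

theorem iInf_inner_add_half_norm_sq (p : H) :
    ⨅ a : H, (inner ℝ a p + 1 / 2 * ‖a‖ ^ 2) = -(1 / 2 * ‖p‖ ^ 2) := by
  -- The lower bound is also needed to give the real `⨅` its meaning, the set being required to be
  -- bounded below.
  have hle : ∀ a : H, -(1 / 2 * ‖p‖ ^ 2) ≤ inner ℝ a p + 1 / 2 * ‖a‖ ^ 2 := fun a => by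
    rw [inner_add_half_norm_sq]
    linarith [sq_nonneg ‖a + p‖]
  refine le_antisymm ((ciInf_le ⟨_, forall_mem_range.2 hle⟩ (-p)).trans ?_) (le_ciInf hle)
  rw [inner_add_half_norm_sq]
  simp

/-- In the product rule, f times (∂_t + L)h vanishes, and the cross term is h times the drift of the
feedback since the feedback is σR D_x h / h and R is self-adjoint. -/
theorem SolvesKBE.doob_transform (hR : IsPosSqrt R Q) (hQ : IsCovarianceOperator Q)
    (hh : SolvesKBE A Q σ T φ h) (hpos : ∀ t ∈ Icc 0 T, ∀ x, 0 < h t x) (hf : IsC12 A T f)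
    (ht : t ∈ Ioo 0 T) (x : H) :
    dt (fun s y => h s y * f s y) t x + genL A Q σ (fun s y => h s y * f s y) t x =
      h t x * (dt f t x + genL A Q σ f t x
        + inner ℝ (σ • R (optFeedback R σ h t x)) (Dx f t x)) := by
  have hne := (hpos t (Ioo_subset_Icc_self ht) x).ne'
  have e : inner ℝ (R (R (Dx h t x))) (Dx f t x) = inner ℝ (R (Dx h t x)) (R (Dx f t x)) := by
    rw [← ContinuousLinearMap.adjoint_inner_right, hR.adjoint_eq]
  rw [hh.isC12.dt_mul hf ht, hh.isC12.genL_mul hR hQ σ hf ht,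
    optFeedback_eq_smul hh.isC12 hpos ht]
  simp only [map_smul, inner_smul_left, e, conj_trivial]
  have h1 := hh.eqn t ht x
  field_simp
  linear_combination f t x * h1

end Calculus

/-! ### Polynomial growth, and stability of the regular class under products. -/

section Growth

variable {H : Type*} [NormedAddCommGroup H] [InnerProductSpace ℝ H] [CompleteSpace H]
  {F : Type*} [NormedAddCommGroup F] [NormedSpace ℝ F]
  {A : H →ₗ.[ℝ] H} {Q R : H →L[ℝ] H} {T σ : ℝ}

/-- Continuity and polynomial growth on the open strip `(0, T) × H`. -/
structure IsTame (T : ℝ) (g : ℝ → H → F) : Prop where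
  cont : ContinuousOn (fun p : ℝ × H => g p.1 p.2) (Ioo 0 T ×ˢ univ)
  growth : ∃ (C : ℝ) (m : ℕ), ∀ t ∈ Ioo 0 T, ∀ x, ‖g t x‖ ≤ C * (1 + ‖x‖) ^ m

theorem exists_common_growth {E F : Type*} [NormedAddCommGroup E] [NormedAddCommGroup F]
    {f : ℝ → H → E} {g : ℝ → H → F} {s : Set ℝ}
    (hf : ∃ (C : ℝ) (m : ℕ), ∀ t ∈ s, ∀ x, ‖f t x‖ ≤ C * (1 + ‖x‖) ^ m)
    (hg : ∃ (C : ℝ) (m : ℕ), ∀ t ∈ s, ∀ x, ‖g t x‖ ≤ C * (1 + ‖x‖) ^ m) :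
    ∃ (C : ℝ) (m : ℕ), 0 ≤ C ∧ ∀ t ∈ s, ∀ x,
      ‖f t x‖ ≤ C * (1 + ‖x‖) ^ m ∧ ‖g t x‖ ≤ C * (1 + ‖x‖) ^ m := by
  obtain ⟨C, m, hC⟩ := hf
  obtain ⟨D, n, hD⟩ := hg
  have key : ∀ (B : ℝ) (k : ℕ), B ≤ max |C| |D| → k ≤ max m n → ∀ x : H,
      B * (1 + ‖x‖) ^ k ≤ max |C| |D| * (1 + ‖x‖) ^ max m n := fun B k h1 h2 x => by
    have h3 : (1 : ℝ) ≤ 1 + ‖x‖ := by linarith [norm_nonneg x]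
    have h4 : (0 : ℝ) ≤ max |C| |D| := (abs_nonneg C).trans (le_max_left _ _)
    gcongr
  refine ⟨max |C| |D|, max m n, (abs_nonneg C).trans (le_max_left _ _), fun t ht x => ⟨?_, ?_⟩⟩
  · exact (hC t ht x).trans (key C m ((le_abs_self C).trans (le_max_left _ _)) (le_max_left _ _) x)
  · exact (hD t ht x).trans
      (key D n ((le_abs_self D).trans (le_max_right _ _)) (le_max_right _ _) x)

theorem IsTame.add {f g : ℝ → H → F} (hf : IsTame T f) (hg : IsTame T g) :
    IsTame T (fun t x => f t x + g t x) where
  cont := hf.cont.add hg.cont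
  growth := by
    obtain ⟨C, m, -, h⟩ := exists_common_growth hf.growth hg.growth
    exact ⟨C + C, m, fun t ht x => (norm_add_le _ _).trans
      (by rw [add_mul]; exact add_le_add (h t ht x).1 (h t ht x).2)⟩

theorem IsTame.bilin {E₁ E₂ : Type*} [NormedAddCommGroup E₁] [NormedAddCommGroup E₂]
    {f : ℝ → H → E₁} {g : ℝ → H → E₂} {B : E₁ → E₂ → F} (hf : IsTame T f) (hg : IsTame T g)
    (hB : Continuous fun p : E₁ × E₂ => B p.1 p.2) (hle : ∀ a b, ‖B a b‖ ≤ ‖a‖ * ‖b‖) :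
    IsTame T (fun t x => B (f t x) (g t x)) where
  cont := hB.comp_continuousOn (hf.cont.prodMk hg.cont)
  growth := by
    obtain ⟨C, m, hC, h⟩ := exists_common_growth hf.growth hg.growth
    refine ⟨C * C, m + m, fun t ht x => (hle _ _).trans ?_⟩
    rw [pow_add, mul_mul_mul_comm]
    have : 0 ≤ C * (1 + ‖x‖) ^ m := by positivity
    exact mul_le_mul (h t ht x).1 (h t ht x).2 (norm_nonneg _) this

theorem IsTame.smul {f : ℝ → H → ℝ} {g : ℝ → H → F} (hf : IsTame T f) (hg : IsTame T g) :
    IsTame T (fun t x => f t x • g t x) :=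
  hf.bilin hg continuous_smul norm_smul_le

theorem IsTame.mul {f g : ℝ → H → ℝ} (hf : IsTame T f) (hg : IsTame T g) :
    IsTame T (fun t x => f t x * g t x) :=
  hf.bilin hg continuous_mul norm_mul_le

theorem IsTame.inner {f g : ℝ → H → H} (hf : IsTame T f) (hg : IsTame T g) :
    IsTame T (fun t x => inner ℝ (f t x) (g t x)) :=
  hf.bilin hg continuous_inner norm_inner_le_norm

theorem IsTame.clm {E : Type*} [NormedAddCommGroup E] [NormedSpace ℝ E] {f : ℝ → H → E}
    (hf : IsTame T f) (B : E →L[ℝ] F) : IsTame T (fun t x => B (f t x)) where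
  cont := B.continuous.comp_continuousOn hf.cont
  growth := by
    obtain ⟨C, m, h⟩ := hf.growth
    refine ⟨‖B‖ * C, m, fun t ht x => (B.le_opNorm _).trans ?_⟩
    rw [mul_assoc]
    exact mul_le_mul_of_nonneg_left (h t ht x) (norm_nonneg _)

theorem IsTame.congr {f g : ℝ → H → F} (hf : IsTame T f)
    (h : ∀ t ∈ Ioo 0 T, ∀ x, g t x = f t x) : IsTame T g where
  cont := hf.cont.congr fun p hp => h p.1 hp.1 p.2
  growth := by
    obtain ⟨C, m, hC⟩ := hf.growth
    exact ⟨C, m, fun t ht x => (h t ht x).symm ▸ hC t ht x⟩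

theorem isTame_id : IsTame T (fun (_ : ℝ) (x : H) => x) where
  cont := continuousOn_snd
  growth := ⟨1, 1, fun t _ x => by simp⟩

variable {f h : ℝ → H → ℝ}

theorem IsRegular.tame (hf : IsRegular A T f) : IsTame T f where
  cont := hf.continuousOn_Ioo
  growth := by
    obtain ⟨C, m, h⟩ := hf.growth
    refine ⟨C, m, fun t ht x => le_trans ?_ (h t ht x)⟩
    rw [Real.norm_eq_abs]
    linarith [norm_nonneg (Dx f t x), abs_nonneg (dt f t x), norm_nonneg (Dxx f t x),
      norm_nonneg (adjApply A (Dx f t x))]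

theorem IsRegular.tame_dt (hf : IsRegular A T f) : IsTame T (dt f) where
  cont := hf.cont_dt
  growth := by
    obtain ⟨C, m, h⟩ := hf.growth
    refine ⟨C, m, fun t ht x => le_trans ?_ (h t ht x)⟩
    rw [Real.norm_eq_abs]
    linarith [norm_nonneg (Dx f t x), abs_nonneg (f t x), norm_nonneg (Dxx f t x),
      norm_nonneg (adjApply A (Dx f t x))]

theorem IsRegular.tame_Dx (hf : IsRegular A T f) : IsTame T (Dx f) where
  cont := hf.cont_Dx
  growth := by
    obtain ⟨C, m, h⟩ := hf.growth
    refine ⟨C, m, fun t ht x => le_trans ?_ (h t ht x)⟩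
    linarith [abs_nonneg (dt f t x), abs_nonneg (f t x), norm_nonneg (Dxx f t x),
      norm_nonneg (adjApply A (Dx f t x))]

theorem IsRegular.tame_Dxx (hf : IsRegular A T f) : IsTame T (Dxx f) where
  cont := hf.cont_Dxx
  growth := by
    obtain ⟨C, m, h⟩ := hf.growth
    refine ⟨C, m, fun t ht x => le_trans ?_ (h t ht x)⟩
    linarith [abs_nonneg (dt f t x), abs_nonneg (f t x), norm_nonneg (Dx f t x),
      norm_nonneg (adjApply A (Dx f t x))]

theorem IsRegular.tame_adjApply (hf : IsRegular A T f) :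
    IsTame T (fun t x => adjApply A (Dx f t x)) where
  cont := hf.cont_adj
  growth := by
    obtain ⟨C, m, h⟩ := hf.growth
    refine ⟨C, m, fun t ht x => le_trans ?_ (h t ht x)⟩
    linarith [abs_nonneg (dt f t x), abs_nonneg (f t x), norm_nonneg (Dx f t x),
      norm_nonneg (Dxx f t x)]

theorem IsRegular.tame_genL (hR : IsPosSqrt R Q) (hQ : IsCovarianceOperator Q) (σ : ℝ)
    (hf : IsRegular A T f) : IsTame T (genL A Q σ f) :=
  ((isTame_id.inner hf.tame_adjApply).add
    (hf.tame_Dxx.clm ((1 / 2 * σ ^ 2) • hR.traceCLM hQ))).congr fun t _ x => by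
      rw [hR.genL_eq hQ, smul_apply, smul_eq_mul, mul_assoc]

/-- The growth bound is assumed only for times in the open interval; it passes to the end points by
continuity, (0, T) being dense in [0, T]. -/
theorem IsRegular.growth_Icc (hf : IsRegular A T f) (hT : 0 < T) :
    ∃ (C : ℝ) (m : ℕ), ∀ t ∈ Icc 0 T, ∀ x, ‖f t x‖ ≤ C * (1 + ‖x‖) ^ m := by
  obtain ⟨C, m, h⟩ := hf.tame.growth
  refine ⟨C, m, fun t ht x => ?_⟩
  have h1 : ContinuousWithinAt (fun s => f s x) (Icc 0 T) t :=
    (hf.cont (t, x) ⟨ht, mem_univ _⟩).comp (f := fun s : ℝ => (s, x)) (s := Icc 0 T)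
      (by fun_prop) fun s hs => ⟨hs, mem_univ _⟩
  have h2 : Tendsto (fun s => ‖f s x‖) (𝓝[Ioo 0 T] t) (𝓝 ‖f t x‖) :=
    (h1.mono Ioo_subset_Icc_self).norm
  have : (𝓝[Ioo 0 T] t).NeBot := by
    rw [← mem_closure_iff_nhdsWithin_neBot, closure_Ioo hT.ne]
    exact ht
  exact le_of_tendsto h2 (eventually_mem_nhdsWithin.mono fun s hs => h s hs x)

theorem UniformContinuousOn.bilin {α E₁ E₂ F : Type*} [PseudoMetricSpace α]
    [NormedAddCommGroup E₁] [NormedAddCommGroup E₂] [NormedAddCommGroup F]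
    {f : α → E₁} {g : α → E₂} {B : E₁ → E₂ → F} {s : Set α} {C : ℝ}
    (hf : UniformContinuousOn f s) (hg : UniformContinuousOn g s)
    (hfC : ∀ a ∈ s, ‖f a‖ ≤ C) (hgC : ∀ a ∈ s, ‖g a‖ ≤ C)
    (hB : ∀ a b a' b', ‖B a b - B a' b'‖ ≤ ‖a - a'‖ * ‖b‖ + ‖a'‖ * ‖b - b'‖) :
    UniformContinuousOn (fun a => B (f a) (g a)) s := by
  rw [Metric.uniformContinuousOn_iff] at hf hg ⊢
  intro ε hε
  set D := |C| + 1
  have hD : 0 < D := by positivity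
  obtain ⟨δ₁, hδ₁, h1⟩ := hf (ε / (2 * D)) (by positivity)
  obtain ⟨δ₂, hδ₂, h2⟩ := hg (ε / (2 * D)) (by positivity)
  refine ⟨min δ₁ δ₂, lt_min hδ₁ hδ₂, fun a ha b hb hab => ?_⟩
  have h3 := h1 a ha b hb (hab.trans_le (min_le_left _ _))
  have h4 := h2 a ha b hb (hab.trans_le (min_le_right _ _))
  rw [dist_eq_norm] at h3 h4 ⊢
  have h5 : ‖g a‖ < D := by linarith [hgC a ha, le_abs_self C]
  have h6 : ‖f b‖ < D := by linarith [hfC b hb, le_abs_self C]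
  calc ‖B (f a) (g a) - B (f b) (g b)‖
      ≤ ‖f a - f b‖ * ‖g a‖ + ‖f b‖ * ‖g a - g b‖ := hB _ _ _ _
    _ ≤ ‖f a - f b‖ * D + D * ‖g a - g b‖ := by gcongr
    _ < ε / (2 * D) * D + D * (ε / (2 * D)) := by gcongr
    _ = ε := by field_simp; norm_num

theorem UniformContinuousOn.add {α : Type*} [UniformSpace α] {f g : α → F} {s : Set α}
    (hf : UniformContinuousOn f s) (hg : UniformContinuousOn g s) :
    UniformContinuousOn (fun a => f a + g a) s := by
  rw [uniformContinuousOn_iff_restrict] at *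
  exact UniformContinuous.add hf hg

theorem norm_smul_sub_smul_le (a : ℝ) (b : F) (a' : ℝ) (b' : F) :
    ‖a • b - a' • b'‖ ≤ ‖a - a'‖ * ‖b‖ + ‖a'‖ * ‖b - b'‖ := by
  have : a • b - a' • b' = (a - a') • b + a' • (b - b') := by module
  rw [this]
  exact (norm_add_le _ _).trans (add_le_add (norm_smul_le _ _) (norm_smul_le _ _))

theorem norm_rankOne_sub_rankOne_le (a b a' b' : H) :
    ‖rankOne a b - rankOne a' b'‖ ≤ ‖a - a'‖ * ‖b‖ + ‖a'‖ * ‖b - b'‖ := by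
  have : rankOne a b - rankOne a' b' = rankOne (a - a') b + rankOne a' (b - b') := by
    ext y
    simp only [rankOne, sub_apply, add_apply,
      ContinuousLinearMap.smulRight_apply, innerSL_apply_apply, inner_sub_left, sub_smul, smul_sub]
    abel
  rw [this]
  exact (norm_add_le _ _).trans (add_le_add (norm_rankOne_le _ _) (norm_rankOne_le _ _))

theorem IsTame.exists_bound {E₁ E₂ : Type*} [NormedAddCommGroup E₁] [NormedAddCommGroup E₂]
    {f : ℝ → H → E₁} {g : ℝ → H → E₂} {s : Set ℝ}
    (hf : ∃ (C : ℝ) (m : ℕ), ∀ t ∈ s, ∀ x, ‖f t x‖ ≤ C * (1 + ‖x‖) ^ m)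
    (hg : ∃ (C : ℝ) (m : ℕ), ∀ t ∈ s, ∀ x, ‖g t x‖ ≤ C * (1 + ‖x‖) ^ m) (r : ℝ) :
    ∃ D, ∀ p ∈ s ×ˢ Metric.closedBall (0 : H) r, ‖f p.1 p.2‖ ≤ D ∧ ‖g p.1 p.2‖ ≤ D := by
  obtain ⟨C, m, hC, h⟩ := exists_common_growth hf hg
  refine ⟨C * (1 + r) ^ m, fun p hp => ?_⟩
  have h1 : ‖p.2‖ ≤ r := by simpa using hp.2
  have h2 : C * (1 + ‖p.2‖) ^ m ≤ C * (1 + r) ^ m := by gcongr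
  exact ⟨((h p.1 hp.1 p.2).1).trans h2, ((h p.1 hp.1 p.2).2).trans h2⟩

theorem UniformContinuousOn.bilin_of_growth {E₁ E₂ : Type*} [NormedAddCommGroup E₁]
    [NormedAddCommGroup E₂] {f : ℝ → H → E₁} {g : ℝ → H → E₂} {s : Set ℝ} {B : E₁ → E₂ → F} {r : ℝ}
    (hf : ∃ (C : ℝ) (m : ℕ), ∀ t ∈ s, ∀ x, ‖f t x‖ ≤ C * (1 + ‖x‖) ^ m)
    (hg : ∃ (C : ℝ) (m : ℕ), ∀ t ∈ s, ∀ x, ‖g t x‖ ≤ C * (1 + ‖x‖) ^ m)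
    (hfu : UniformContinuousOn (fun p : ℝ × H => f p.1 p.2) (s ×ˢ Metric.closedBall 0 r))
    (hgu : UniformContinuousOn (fun p : ℝ × H => g p.1 p.2) (s ×ˢ Metric.closedBall 0 r))
    (hB : ∀ a b a' b', ‖B a b - B a' b'‖ ≤ ‖a - a'‖ * ‖b‖ + ‖a'‖ * ‖b - b'‖) :
    UniformContinuousOn (fun p : ℝ × H => B (f p.1 p.2) (g p.1 p.2))
      (s ×ˢ Metric.closedBall 0 r) := by
  obtain ⟨D, hD⟩ := IsTame.exists_bound hf hg r
  exact UniformContinuousOn.bilin hfu hgu (fun p hp => (hD p hp).1) (fun p hp => (hD p hp).2) hB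

/-- Makes h f an admissible test function, as the change of measure requires, and h² one of
polynomial growth, as the moments of the density require. -/
theorem IsRegular.mul (hT : 0 < T) (hf : IsRegular A T f) (hh : IsRegular A T h) :
    IsRegular A T (fun s y => f s y * h s y) := by
  have c := hf.toIsC12
  have d := hh.toIsC12
  have uf : ∀ r, UniformContinuousOn (fun p : ℝ × H => f p.1 p.2)
      (Ioo 0 T ×ˢ Metric.closedBall 0 r) := fun r =>
    (hf.unif r).mono (prod_mono Ioo_subset_Icc_self subset_rfl)
  have uh : ∀ r, UniformContinuousOn (fun p : ℝ × H => h p.1 p.2)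
      (Ioo 0 T ×ˢ Metric.closedBall 0 r) := fun r =>
    (hh.unif r).mono (prod_mono Ioo_subset_Icc_self subset_rfl)
  have t0 := hf.tame.mul hh.tame
  have t1 : IsTame T (Dx fun s y => f s y * h s y) :=
    ((hf.tame.smul hh.tame_Dx).add (hh.tame.smul hf.tame_Dx)).congr fun t ht x => c.Dx_mul d ht x
  have t2 : IsTame T (dt fun s y => f s y * h s y) :=
    ((hf.tame_dt.mul hh.tame).add (hf.tame.mul hh.tame_dt)).congr fun t ht x => c.dt_mul d ht x
  have t3 : IsTame T (Dxx fun s y => f s y * h s y) :=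
    (((hf.tame.smul hh.tame_Dxx).add
      (hf.tame_Dx.bilin hh.tame_Dx continuous_rankOne norm_rankOne_le)).add
    ((hh.tame.smul hf.tame_Dxx).add
      (hh.tame_Dx.bilin hf.tame_Dx continuous_rankOne norm_rankOne_le))).congr
      fun t ht x => c.Dxx_mul d ht x
  have t4 : IsTame T (fun t x => adjApply A (Dx (fun s y => f s y * h s y) t x)) :=
    ((hf.tame.smul hh.tame_adjApply).add (hh.tame.smul hf.tame_adjApply)).congr
      fun t ht x => c.adjApply_mul d ht x
  refine
  { toIsC12 := c.mul d
    unif := fun r => UniformContinuousOn.bilin_of_growth (B := fun a b : ℝ => a • b)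
      (hf.growth_Icc hT) (hh.growth_Icc hT) (hf.unif r) (hh.unif r) norm_smul_sub_smul_le
    unif_dt := fun r => ?_
    unif_Dx := fun r => ?_
    unif_Dxx := fun r => ?_
    growth := ?_ }
  · refine (UniformContinuousOn.add
      (UniformContinuousOn.bilin_of_growth (B := fun a b : ℝ => a • b)
        hf.tame_dt.growth hh.tame.growth (hf.unif_dt r) (uh r) norm_smul_sub_smul_le)
      (UniformContinuousOn.bilin_of_growth (B := fun a b : ℝ => a • b)
        hf.tame.growth hh.tame_dt.growth (uf r) (hh.unif_dt r) norm_smul_sub_smul_le)).congr ?_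
    exact fun p hp => (c.dt_mul d hp.1 p.2).symm
  · refine (UniformContinuousOn.add
      (UniformContinuousOn.bilin_of_growth
        hf.tame.growth hh.tame_Dx.growth (uf r) (hh.unif_Dx r) norm_smul_sub_smul_le)
      (UniformContinuousOn.bilin_of_growth
        hh.tame.growth hf.tame_Dx.growth (uh r) (hf.unif_Dx r) norm_smul_sub_smul_le)).congr ?_
    exact fun p hp => (c.Dx_mul d hp.1 p.2).symm
  · refine (UniformContinuousOn.add
      (UniformContinuousOn.add
        (UniformContinuousOn.bilin_of_growth
          hf.tame.growth hh.tame_Dxx.growth (uf r) (hh.unif_Dxx r) norm_smul_sub_smul_le)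
        (UniformContinuousOn.bilin_of_growth hf.tame_Dx.growth hh.tame_Dx.growth
          (hf.unif_Dx r) (hh.unif_Dx r) norm_rankOne_sub_rankOne_le))
      (UniformContinuousOn.add
        (UniformContinuousOn.bilin_of_growth
          hh.tame.growth hf.tame_Dxx.growth (uh r) (hf.unif_Dxx r) norm_smul_sub_smul_le)
        (UniformContinuousOn.bilin_of_growth hh.tame_Dx.growth hf.tame_Dx.growth
          (hh.unif_Dx r) (hf.unif_Dx r) norm_rankOne_sub_rankOne_le))).congr ?_
    exact fun p hp => (c.Dxx_mul d hp.1 p.2).symm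
  · have e : ∃ (C : ℝ) (m : ℕ), ∀ t ∈ Ioo 0 T, ∀ x : H,
        ‖(|f t x * h t x| + ‖Dx (fun s y => f s y * h s y) t x‖
          + |dt (fun s y => f s y * h s y) t x| + ‖Dxx (fun s y => f s y * h s y) t x‖
          + ‖adjApply A (Dx (fun s y => f s y * h s y) t x)‖ : ℝ)‖ ≤ C * (1 + ‖x‖) ^ m := by
      have n0 : IsTame T fun t x => |f t x * h t x| := ⟨t0.cont.abs, by simpa using t0.growth⟩
      have n2 : IsTame T fun t x => |dt (fun s y => f s y * h s y) t x| :=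
        ⟨t2.cont.abs, by simpa using t2.growth⟩
      have nn : ∀ {E : Type _} [NormedAddCommGroup E] [NormedSpace ℝ E] {g : ℝ → H → E},
          IsTame T g → IsTame T fun t x => ‖g t x‖ := fun hg =>
        ⟨hg.cont.norm, by simpa using hg.growth⟩
      exact ((((n0.add (nn t1)).add n2).add (nn t3)).add (nn t4)).growth
    obtain ⟨C, m, hCm⟩ := e
    exact ⟨C, m, fun t ht x => (le_abs_self _).trans (hCm t ht x)⟩

end Growth

/-! ### Measurability and integrability along paths. -/

section Processes

variable {H : Type*} [NormedAddCommGroup H] [InnerProductSpace ℝ H] [CompleteSpace H]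
  [MeasurableSpace H] [BorelSpace H] [SecondCountableTopology H]
  {F : Type*} [NormedAddCommGroup F] [MeasurableSpace F] [BorelSpace F]
  [SecondCountableTopology F]
  {A : H →ₗ.[ℝ] H} {Q R : H →L[ℝ] H} {T σ t₀ : ℝ} {Ω : Type*}

/-- Clamping time to [a, b] makes the paths continuous on all of ℝ, so joint measurability follows
from measurability at each time. -/
theorem measurable_comp_projIcc {_ : MeasurableSpace Ω} {a b : ℝ} (hab : a ≤ b) {X : ℝ → Ω → H}
    (hX : ∀ ω, ContinuousOn (fun s => X s ω) (Icc a b)) (hm : ∀ s ∈ Icc a b, Measurable (X s)) :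
    Measurable fun p : ℝ × Ω => X (projIcc a b hab p.1) p.2 :=
  measurable_uncurry_of_continuous_of_measurable (u := fun s ω => X (projIcc a b hab s) ω)
    (fun ω => (hX ω).comp_continuous (continuous_subtype_val.comp continuous_projIcc)
      fun s => (projIcc a b hab s).2) fun s => hm _ (projIcc a b hab s).2

theorem IsTame.measurable_indicator {g : ℝ → H → F} (hg : IsTame T g) :
    Measurable ((Ioo 0 T ×ˢ (univ : Set H)).indicator fun p : ℝ × H => g p.1 p.2) := by
  classical
  rw [← piecewise_eq_indicator]
  exact hg.cont.measurable_piecewise continuousOn_const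
    (measurableSet_Ioo.prod MeasurableSet.univ)

theorem IsTame.stronglyMeasurable_comp {_ : MeasurableSpace Ω} {g : ℝ → H → F} (hg : IsTame T g)
    {a b : ℝ} (hab : a ≤ b) {X : ℝ → Ω → H}
    (hX : ∀ ω, ContinuousOn (fun s => X s ω) (Icc a b)) (hm : ∀ s ∈ Icc a b, Measurable (X s)) :
    StronglyMeasurable fun p : ℝ × Ω => (Ioo 0 T ×ˢ (univ : Set H)).indicator
      (fun p : ℝ × H => g p.1 p.2) (p.1, X (projIcc a b hab p.1) p.2) :=
  (hg.measurable_indicator.comp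
    (measurable_fst.prodMk (measurable_comp_projIcc hab hX hm))).stronglyMeasurable

theorem indicator_projIcc {g : ℝ → H → F} {a b : ℝ} (hab : a ≤ b) (X : ℝ → Ω → H) {s : ℝ}
    (hs : s ∈ Icc a b) (hs' : s ∈ Ioo 0 T) (ω : Ω) :
    (Ioo 0 T ×ˢ (univ : Set H)).indicator (fun p : ℝ × H => g p.1 p.2)
      (s, X (projIcc a b hab s) ω) = g s (X s ω) := by
  rw [indicator_of_mem (by exact ⟨hs', mem_univ _⟩), projIcc_of_mem hab hs]

theorem ae_mem_Ioo (a b : ℝ) : ∀ᵐ s ∂volume.restrict (Icc a b), s ∈ Ioo a b := by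
  rw [← Measure.restrict_congr_set Ioo_ae_eq_Icc]
  exact ae_restrict_mem measurableSet_Ioo

theorem ae_prod_mem_Ioo {_ : MeasurableSpace Ω} (P : Measure Ω) [SFinite P] (a b : ℝ) :
    ∀ᵐ p ∂(volume.restrict (Icc a b)).prod P, p.1 ∈ Ioo a b :=
  Measure.quasiMeasurePreserving_fst.ae (ae_mem_Ioo a b)

theorem mul_one_add_pow_le (C : ℝ) (m : ℕ) {y : ℝ} (hy : 0 ≤ y) :
    C * (1 + y) ^ m ≤ |C| * 2 ^ (m - 1) * (1 + y ^ m) := by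
  have h1 := add_pow_le zero_le_one hy m
  rw [one_pow] at h1
  rw [mul_assoc]
  exact (mul_le_mul_of_nonneg_right (le_abs_self C) (by positivity)).trans
    (mul_le_mul_of_nonneg_left h1 (abs_nonneg C))

/-- A continuous adapted process with moments of all orders, bounded in time. -/
structure IsMomentProcess (t₀ T : ℝ) {mΩ : MeasurableSpace Ω} (P : Measure Ω)
    (𝓕 : Filtration (Icc t₀ T) mΩ) (X : ℝ → Ω → H) : Prop where
  adapted : StronglyAdapted 𝓕 (fun (s : Icc t₀ T) ω => X s ω)
  continuous_paths : ∀ ω, ContinuousOn (fun s => X s ω) (Icc t₀ T)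
  moments : ∀ n : ℕ, ∃ C : ℝ, ∀ s ∈ Icc t₀ T,
    Integrable (fun ω => ‖X s ω‖ ^ n) P ∧ ∫ ω, ‖X s ω‖ ^ n ∂P ≤ C

variable {mΩ : MeasurableSpace Ω} {P : Measure Ω} {𝓕 : Filtration (Icc t₀ T) mΩ} {X : ℝ → Ω → H}

theorem IsControlled.isMomentProcess {x₀ : H} {α : ℝ → Ω → H}
    (h : IsControlled A Q R σ T t₀ x₀ P 𝓕 α X) : IsMomentProcess t₀ T P 𝓕 X :=
  ⟨h.adapted, h.continuous_paths, h.moments⟩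

theorem IsMomentProcess.measurable_filtration (hX : IsMomentProcess t₀ T P 𝓕 X) (i : Icc t₀ T)
    {s : ℝ} (hs : s ∈ Icc t₀ (i : ℝ)) : Measurable[𝓕 i] (X s) :=
  ((hX.adapted ⟨s, hs.1, hs.2.trans i.2.2⟩).mono
    (𝓕.mono (show (⟨s, hs.1, hs.2.trans i.2.2⟩ : Icc t₀ T) ≤ i from hs.2))).measurable

theorem IsMomentProcess.measurable (hX : IsMomentProcess t₀ T P 𝓕 X) {s : ℝ}
    (hs : s ∈ Icc t₀ T) : Measurable (X s) :=
  (hX.adapted ⟨s, hs⟩).measurable.mono (𝓕.le _) le_rfl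

theorem IsMomentProcess.integrable_of_growth [IsFiniteMeasure P] (hX : IsMomentProcess t₀ T P 𝓕 X)
    {s : ℝ} (hs : s ∈ Icc t₀ T) {φ : H → F} (hφ : Continuous φ) {C : ℝ} {m : ℕ}
    (hC : ∀ x, ‖φ x‖ ≤ C * (1 + ‖x‖) ^ m) : Integrable (fun ω => φ (X s ω)) P := by
  obtain ⟨D, hD⟩ := hX.moments m
  refine Integrable.mono' (((integrable_const (1 : ℝ)).add (hD s hs).1).const_mul
    (|C| * 2 ^ (m - 1))) (hφ.measurable.comp (hX.measurable hs)).aestronglyMeasurable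
    (Eventually.of_forall fun ω => ?_)
  exact (hC _).trans (mul_one_add_pow_le C m (norm_nonneg _))

theorem IsMomentProcess.integrable_tame [IsFiniteMeasure P] (hX : IsMomentProcess t₀ T P 𝓕 X)
    {g : ℝ → H → F} (hg : IsTame T g) {s : ℝ} (hs : s ∈ Icc t₀ T) (hs' : s ∈ Ioo 0 T) :
    Integrable (fun ω => g s (X s ω)) P := by
  obtain ⟨C, m, hC⟩ := hg.growth
  refine hX.integrable_of_growth hs (φ := g s) ?_ (hC s hs')
  exact hg.cont.comp_continuous (f := fun x : H => (s, x)) (by fun_prop) fun x => ⟨hs', mem_univ _⟩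

theorem IsMomentProcess.integrable_regular [IsFiniteMeasure P] (hX : IsMomentProcess t₀ T P 𝓕 X)
    (hT : 0 < T) (ht₀ : 0 ≤ t₀) {f : ℝ → H → ℝ} (hf : IsRegular A T f) {s : ℝ}
    (hs : s ∈ Icc t₀ T) : Integrable (fun ω => f s (X s ω)) P := by
  obtain ⟨C, m, hC⟩ := hf.growth_Icc hT
  have hs' : s ∈ Icc 0 T := ⟨ht₀.trans hs.1, hs.2⟩
  refine hX.integrable_of_growth hs (φ := f s) ?_ (hC s hs')
  exact hf.cont.comp_continuous (f := fun x : H => (s, x)) (by fun_prop) fun x => ⟨hs', mem_univ _⟩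

theorem IsMomentProcess.aestronglyMeasurable_tame [SFinite P] (hX : IsMomentProcess t₀ T P 𝓕 X)
    (h0 : 0 ≤ t₀) (hT : t₀ ≤ T) {g : ℝ → H → F} (hg : IsTame T g) :
    AEStronglyMeasurable (fun p : ℝ × Ω => g p.1 (X p.1 p.2))
      ((volume.restrict (Icc t₀ T)).prod P) := by
  refine (hg.stronglyMeasurable_comp hT hX.continuous_paths
    fun s hs => hX.measurable hs).aestronglyMeasurable.congr ?_
  filter_upwards [ae_prod_mem_Ioo P t₀ T] with p hp
  exact indicator_projIcc hT X (Ioo_subset_Icc_self hp) ⟨h0.trans_lt hp.1, hp.2⟩ p.2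

/-- Moments bounded uniformly in time are integrable over the bounded time interval; the end points,
where growth is not controlled, are null. -/
theorem IsMomentProcess.integrable_prod [IsFiniteMeasure P] (hX : IsMomentProcess t₀ T P 𝓕 X)
    (h0 : 0 ≤ t₀) (hT : t₀ ≤ T) {g : ℝ → H → F} (hg : IsTame T g) :
    Integrable (fun p : ℝ × Ω => g p.1 (X p.1 p.2)) ((volume.restrict (Icc t₀ T)).prod P) := by
  obtain ⟨C, m, hC⟩ := hg.growth
  obtain ⟨D, hD⟩ := hX.moments m
  have hmeas : AEStronglyMeasurable (fun p : ℝ × Ω => ‖X p.1 p.2‖ ^ m)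
      ((volume.restrict (Icc t₀ T)).prod P) :=
    (hX.aestronglyMeasurable_tame h0 hT isTame_id).norm.pow m
  have hpow : Integrable (fun p : ℝ × Ω => ‖X p.1 p.2‖ ^ m)
      ((volume.restrict (Icc t₀ T)).prod P) := by
    rw [integrable_prod_iff hmeas]
    refine ⟨?_, Integrable.mono' (integrable_const D) hmeas.norm.integral_prod_right' ?_⟩
    · filter_upwards [ae_restrict_mem measurableSet_Icc] with s hs using (hD s hs).1
    · filter_upwards [ae_restrict_mem measurableSet_Icc] with s hs
      simp only [norm_pow, norm_norm]
      rw [Real.norm_of_nonneg (integral_nonneg fun ω => by positivity)]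
      exact (hD s hs).2
  refine Integrable.mono' (((integrable_const (1 : ℝ)).add hpow).const_mul (|C| * 2 ^ (m - 1)))
    (hX.aestronglyMeasurable_tame h0 hT hg) ?_
  filter_upwards [ae_prod_mem_Ioo P t₀ T] with p hp
  exact (hC p.1 ⟨h0.trans_lt hp.1, hp.2⟩ _).trans (mul_one_add_pow_le C m (norm_nonneg _))

theorem IsMomentProcess.stronglyMeasurable_tame (hX : IsMomentProcess t₀ T P 𝓕 X)
    {g : ℝ → H → F} (hg : IsTame T g) (s : Icc t₀ T) (hs' : (s : ℝ) ∈ Ioo 0 T) :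
    StronglyMeasurable[𝓕 s] (fun ω => g s (X s ω)) := by
  have hc : Continuous (g s) :=
    hg.cont.comp_continuous (f := fun x : H => ((s : ℝ), x)) (by fun_prop)
      fun x => ⟨hs', mem_univ _⟩
  exact (hX.adapted s).measurable |> hc.measurable.comp |>.stronglyMeasurable

theorem IsMomentProcess.stronglyMeasurable_regular (hX : IsMomentProcess t₀ T P 𝓕 X)
    (ht₀ : 0 ≤ t₀) {f : ℝ → H → ℝ} (hf : IsRegular A T f) (s : Icc t₀ T) :
    StronglyMeasurable[𝓕 s] (fun ω => f s (X s ω)) := by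
  have hc : Continuous (f s) :=
    hf.cont.comp_continuous (f := fun x : H => ((s : ℝ), x)) (by fun_prop)
      fun x => ⟨⟨ht₀.trans s.2.1, s.2.2⟩, mem_univ _⟩
  exact (hX.adapted s).measurable |> hc.measurable.comp |>.stronglyMeasurable

theorem intervalIntegral_eq_integral_Ioo {E : Type*} [NormedAddCommGroup E] [NormedSpace ℝ E]
    {a b : ℝ} (hab : a ≤ b) (f : ℝ → E) : ∫ r in a..b, f r = ∫ r in Ioo a b, f r := by
  rw [intervalIntegral.integral_of_le hab, integral_Ioc_eq_integral_Ioo]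

theorem IsMomentProcess.stronglyMeasurable_integral (hX : IsMomentProcess t₀ T P 𝓕 X)
    (h0 : 0 ≤ t₀) {g : ℝ → H → ℝ} (hg : IsTame T g) (s : Icc t₀ T) :
    StronglyMeasurable[𝓕 s] (fun ω => ∫ r in t₀..s, g r (X r ω)) := by
  -- Here Ω carries 𝓕 s and time is clamped to [t₀, s], so only values of X up to time s enter and
  -- the integral is adapted.
  have h1 := @IsTame.stronglyMeasurable_comp H _ _ _ _ _ _ ℝ _ _ _ _ T Ω (𝓕 s) g hg t₀ s s.2.1 X
    (fun ω => (hX.continuous_paths ω).mono (Icc_subset_Icc_right s.2.2))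
    (fun r hr => hX.measurable_filtration s hr)
  have h2 := @StronglyMeasurable.integral_prod_left' ℝ Ω ℝ _ (𝓕 s)
    (volume.restrict (Ioo t₀ s)) _ _ _ _ h1
  convert h2 using 1
  ext ω
  rw [intervalIntegral_eq_integral_Ioo s.2.1]
  refine setIntegral_congr_fun measurableSet_Ioo fun r hr => ?_
  exact (indicator_projIcc s.2.1 X (Ioo_subset_Icc_self hr)
    ⟨h0.trans_lt hr.1, hr.2.trans_le s.2.2⟩ ω).symm

/-- Fubini's theorem for increments of time integrals. -/
theorem setIntegral_intervalIntegral {F : ℝ × Ω → ℝ} [SFinite P]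
    (hF : Integrable F ((volume.restrict (Icc t₀ T)).prod P)) (B : Set Ω) {s : ℝ}
    (hs : s ∈ Icc t₀ T) :
    ∫ ω in B, (∫ r in t₀..s, F (r, ω)) ∂P = ∫ r in t₀..s, ∫ ω in B, F (r, ω) ∂P := by
  have h1 : Integrable F ((volume.restrict (uIoc t₀ s)).prod (P.restrict B)) := by
    refine hF.mono_measure (Measure.prod_mono (Measure.restrict_mono ?_ le_rfl)
      Measure.restrict_le_self)
    rw [uIoc_of_le hs.1]
    exact Ioc_subset_Icc_self.trans (Icc_subset_Icc_right hs.2)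
  exact (intervalIntegral_integral_swap (f := fun r ω => F (r, ω)) h1).symm

theorem intervalIntegrable_setIntegral {F : ℝ × Ω → ℝ} [SFinite P]
    (hF : Integrable F ((volume.restrict (Icc t₀ T)).prod P)) (B : Set Ω) {s t : ℝ}
    (hs : s ∈ Icc t₀ T) (ht : t ∈ Icc t₀ T) :
    IntervalIntegrable (fun r => ∫ ω in B, F (r, ω) ∂P) volume s t := by
  have h1 : Integrable F ((volume.restrict (Icc t₀ T)).prod (P.restrict B)) :=
    hF.mono_measure (Measure.prod_mono le_rfl Measure.restrict_le_self)
  rw [intervalIntegrable_iff]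
  exact IntegrableOn.mono_set h1.integral_prod_left
    (uIoc_subset_uIcc.trans (uIcc_subset_Icc hs ht))

theorem integrable_intervalIntegral {F : ℝ × Ω → ℝ} [SFinite P]
    (hF : Integrable F ((volume.restrict (Icc t₀ T)).prod P)) {s : ℝ} (hs : s ∈ Icc t₀ T) :
    Integrable (fun ω => ∫ r in t₀..s, F (r, ω)) P := by
  simp only [intervalIntegral.integral_of_le hs.1]
  refine (hF.mono_measure (Measure.prod_mono (Measure.restrict_mono ?_ le_rfl)
    le_rfl)).integral_prod_right
  exact Ioc_subset_Icc_self.trans (Icc_subset_Icc_right hs.2)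

end Processes

/-! ### The verification theorem. -/

section Verification

variable {H : Type*} [NormedAddCommGroup H] [InnerProductSpace ℝ H] [CompleteSpace H]
  [MeasurableSpace H] [BorelSpace H] [SecondCountableTopology H]
  {A : H →ₗ.[ℝ] H} {Q R : H →L[ℝ] H} {T σ t₀ : ℝ} {Ω : Type*}
  {mΩ : MeasurableSpace Ω} {P : Measure Ω} {𝓕 : Filtration (Icc t₀ T) mΩ}
  {α X : ℝ → Ω → H} {x₀ : H} {V h f : ℝ → H → ℝ} {G : H → ℝ}

theorem aestronglyMeasurable_of_isStronglyProgressive [SFinite P] (hT : t₀ ≤ T)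
    (hα : IsStronglyProgressive 𝓕 (fun (s : Icc t₀ T) ω => α s ω)) :
    AEStronglyMeasurable (fun p : ℝ × Ω => α p.1 p.2) ((volume.restrict (Icc t₀ T)).prod P) := by
  have h1 := hα ⟨T, hT, le_rfl⟩
  have h2 : @Measurable (ℝ × Ω) (Iic (⟨T, hT, le_rfl⟩ : Icc t₀ T) × Ω) _
      (Subtype.instMeasurableSpace.prod (𝓕 ⟨T, hT, le_rfl⟩))
      (fun p => (⟨projIcc t₀ T hT p.1, (projIcc t₀ T hT p.1).2.2⟩, p.2)) := by
    refine Measurable.prodMk ?_ (measurable_snd.mono le_rfl (𝓕.le _))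
    exact (continuous_projIcc.measurable.comp measurable_fst).subtype_mk
  refine (h1.comp_measurable h2).aestronglyMeasurable.congr ?_
  filter_upwards [ae_prod_mem_Ioo P t₀ T] with p hp
  simp only [Function.comp_apply, projIcc_of_mem hT (Ioo_subset_Icc_self hp)]

theorem IsControlled.integral_martingale_terminal [IsProbabilityMeasure P] (ht₀ : t₀ ∈ Icc 0 T)
    (hc : IsControlled A Q R σ T t₀ x₀ P 𝓕 α X) (hf : IsRegular A T f) :
    ∫ ω, (f T (X T ω) - ∫ r in t₀..T, (dt f r (X r ω) + genL A Q σ f r (X r ω)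
        + inner ℝ (σ • R (α r ω)) (Dx f r (X r ω)))) ∂P = f t₀ x₀ := by
  have h1 := (hc.martingale_problem f hf).setIntegral_eq
    (i := ⟨t₀, le_rfl, ht₀.2⟩) (j := ⟨T, ht₀.2, le_rfl⟩) ht₀.2 MeasurableSet.univ
  simp only [Measure.restrict_univ, intervalIntegral.integral_same, sub_zero] at h1
  rw [← h1, integral_congr_ae (hc.initial.mono fun ω hω => congrArg (f t₀) hω)]
  simp

/-- The completion of the square behind the verification theorem. -/
theorem SolvesHJB.drift_eq (hR : IsPosSqrt R Q) (hV : SolvesHJB A Q R σ T G V) {t : ℝ}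
    (ht : t ∈ Ioo 0 T) (x a : H) :
    dt V t x + genL A Q σ V t x + inner ℝ (σ • R a) (Dx V t x) =
      1 / 2 * ‖a + σ • R (Dx V t x)‖ ^ 2 - 1 / 2 * ‖a‖ ^ 2 := by
  have h1 := hV.eqn t ht x
  have h2 : inner ℝ (σ • R a) (Dx V t x) = inner ℝ a (σ • R (Dx V t x)) := by
    rw [real_inner_smul_left, real_inner_smul_right]
    exact congrArg _ (hR.isPositive.isSelfAdjoint.isSymmetric a (Dx V t x))
  rw [norm_add_sq_real, h2]
  linarith

/-- The martingale problem is tested on V. Its drift is a difference of two squares by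
`SolvesHJB.drift_eq`, so the running cost cancels and the excess of the cost over V is half the L²
distance of the control from the feedback. -/
theorem IsControlled.cost_formula [IsProbabilityMeasure P] (ht₀ : t₀ ∈ Icc 0 T)
    (hR : IsPosSqrt R Q) (hc : IsControlled A Q R σ T t₀ x₀ P 𝓕 α X) (hV : IsRegular A T V)
    (hHJB : SolvesHJB A Q R σ T G V) :
    Integrable (fun p : ℝ × Ω => ‖α p.1 p.2 + σ • R (Dx V p.1 (X p.1 p.2))‖ ^ 2)
      ((volume.restrict (Icc t₀ T)).prod P) ∧
    Integrable (pathCost T t₀ G α X) P ∧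
    cost P T t₀ G α X = V t₀ x₀ + 1 / 2 *
      ∫ p : ℝ × Ω, ‖α p.1 p.2 + σ • R (Dx V p.1 (X p.1 p.2))‖ ^ 2
        ∂((volume.restrict (Icc t₀ T)).prod P) := by
  have hX := hc.isMomentProcess
  have hu : IsTame T fun t x => σ • R (Dx V t x) := hV.tame_Dx.clm (σ • R)
  have hu2 := hX.integrable_prod ht₀.1 ht₀.2 (hu.inner hu)
  simp only [real_inner_self_eq_norm_sq] at hu2
  have hβ : Integrable (fun p : ℝ × Ω => ‖α p.1 p.2 + σ • R (Dx V p.1 (X p.1 p.2))‖ ^ 2)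
      ((volume.restrict (Icc t₀ T)).prod P) := by
    refine Integrable.mono' ((hc.square_integrable.const_mul 2).add (hu2.const_mul 2))
      (((aestronglyMeasurable_of_isStronglyProgressive ht₀.2 hc.progressive).add
        (hX.aestronglyMeasurable_tame ht₀.1 ht₀.2 hu)).norm.pow 2)
      (Eventually.of_forall fun p => ?_)
    rw [Real.norm_of_nonneg (by positivity)]
    have h1 := norm_add_le (α p.1 p.2) (σ • R (Dx V p.1 (X p.1 p.2)))
    have h2 := pow_le_pow_left₀ (norm_nonneg _) h1 2
    simp only [Pi.add_apply]
    linarith [sq_nonneg (‖α p.1 p.2‖ - ‖σ • R (Dx V p.1 (X p.1 p.2))‖)]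
  have hM := hc.martingale_problem V hV
  have hMT := hM.integrable ⟨T, ht₀.2, le_rfl⟩
  have hpath : pathCost T t₀ G α X =ᵐ[P] fun ω => (V T (X T ω) - ∫ r in t₀..T,
      (dt V r (X r ω) + genL A Q σ V r (X r ω) + inner ℝ (σ • R (α r ω)) (Dx V r (X r ω)))) +
      1 / 2 * ∫ r in Icc t₀ T, ‖α r ω + σ • R (Dx V r (X r ω))‖ ^ 2 := by
    -- For almost every path both squares are integrable in time, so the integral of their
    -- difference can be split.
    filter_upwards [hc.square_integrable.prod_left_ae, hβ.prod_left_ae] with ω h1 h2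
    have e : ∫ r in t₀..T, (dt V r (X r ω) + genL A Q σ V r (X r ω)
        + inner ℝ (σ • R (α r ω)) (Dx V r (X r ω))) =
        1 / 2 * (∫ r in Icc t₀ T, ‖α r ω + σ • R (Dx V r (X r ω))‖ ^ 2) -
          1 / 2 * ∫ r in Icc t₀ T, ‖α r ω‖ ^ 2 := by
      rw [intervalIntegral.integral_of_le ht₀.2, ← integral_Icc_eq_integral_Ioc,
        ← integral_const_mul, ← integral_const_mul,
        ← integral_sub (h2.const_mul _) (h1.const_mul _)]
      refine integral_congr_ae ?_
      filter_upwards [ae_mem_Ioo t₀ T] with r hr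
      exact hHJB.drift_eq hR ⟨ht₀.1.trans_lt hr.1, hr.2⟩ _ _
    rw [pathCost, e, hHJB.terminal, intervalIntegral.integral_of_le ht₀.2,
      ← integral_Icc_eq_integral_Ioc, integral_const_mul]
    ring
  have hint : Integrable (fun ω => 1 / 2 * ∫ r in Icc t₀ T,
      ‖α r ω + σ • R (Dx V r (X r ω))‖ ^ 2) P := hβ.integral_prod_right.const_mul _
  refine ⟨hβ, (integrable_congr hpath).2 (hMT.add hint), ?_⟩
  rw [cost, integral_congr_ae hpath, integral_add hMT hint,
    hc.integral_martingale_terminal ht₀ hV, integral_const_mul, ← integral_prod_symm _ hβ]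

theorem IsControlled.verification [IsProbabilityMeasure P] (ht₀ : t₀ ∈ Icc 0 T)
    (hR : IsPosSqrt R Q) (hc : IsControlled A Q R σ T t₀ x₀ P 𝓕 α X) (hV : IsRegular A T V)
    (hHJB : SolvesHJB A Q R σ T G V) {u : ℝ → H → H}
    (hu : ∀ t ∈ Ioo 0 T, ∀ x, u t x = -(σ • R (Dx V t x))) :
    Integrable (pathCost T t₀ G α X) P ∧ V t₀ x₀ ≤ cost P T t₀ G α X ∧
    (cost P T t₀ G α X = V t₀ x₀ ↔ ∀ᵐ p ∂((volume.restrict (Icc t₀ T)).prod P),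
      α p.1 p.2 = u p.1 (X p.1 p.2)) := by
  obtain ⟨hβ, hint, hcost⟩ := hc.cost_formula ht₀ hR hV hHJB
  have hnn : (0 : ℝ × Ω → ℝ) ≤ fun p => ‖α p.1 p.2 + σ • R (Dx V p.1 (X p.1 p.2))‖ ^ 2 :=
    fun p => by positivity
  refine ⟨hint, ?_, ?_⟩
  · rw [hcost]
    linarith [integral_nonneg (μ := (volume.restrict (Icc t₀ T)).prod P) hnn]
  · have h1 : cost P T t₀ G α X = V t₀ x₀ ↔
        ∫ p : ℝ × Ω, ‖α p.1 p.2 + σ • R (Dx V p.1 (X p.1 p.2))‖ ^ 2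
          ∂((volume.restrict (Icc t₀ T)).prod P) = 0 := by
      rw [hcost]
      constructor <;> intro h <;> linarith
    rw [h1, integral_eq_zero_iff_of_nonneg hnn hβ]
    refine eventually_congr ?_
    filter_upwards [ae_prod_mem_Ioo P t₀ T] with p hp
    rw [hu p.1 ⟨ht₀.1.trans_lt hp.1, hp.2⟩, Pi.zero_apply, sq_eq_zero_iff, norm_eq_zero,
      add_eq_zero_iff_eq_neg]

/-- Under zero control the compensator of h is the time integral of (∂_t + L)h, which vanishes. -/
theorem IsControlled.martingale_of_solvesKBE {φ : H → ℝ} (ht₀ : 0 ≤ t₀)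
    (hc : IsControlled A Q R σ T t₀ x₀ P 𝓕 (fun _ _ => 0) X) (hh : IsRegular A T h)
    (hKBE : SolvesKBE A Q σ T φ h) :
    Martingale (fun (s : Icc t₀ T) ω => h s (X s ω)) 𝓕 P := by
  have h1 := hc.martingale_problem h hh
  have e : (fun (s : Icc t₀ T) ω => h s (X s ω) - ∫ r in t₀..s, (dt h r (X r ω)
      + genL A Q σ h r (X r ω) + inner ℝ (σ • R 0) (Dx h r (X r ω)))) =
      fun (s : Icc t₀ T) ω => h s (X s ω) := by
    funext s ω
    rw [intervalIntegral_eq_integral_Ioo s.2.1, setIntegral_eq_zero_of_forall_eq_zero, sub_zero]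
    intro r hr
    rw [hKBE.eqn r ⟨ht₀.trans_lt hr.1, hr.2.trans_le s.2.2⟩]
    simp
  rwa [e] at h1

end Verification

/-! ### Change of measure, and progressive measurability of feedback controls. -/

section DoobTransform

variable {H : Type*} [NormedAddCommGroup H] [InnerProductSpace ℝ H] [CompleteSpace H]
  [MeasurableSpace H] [BorelSpace H] [SecondCountableTopology H]
  {A : H →ₗ.[ℝ] H} {Q R : H →L[ℝ] H} {T σ t₀ : ℝ} {Ω : Type*}
  {mΩ : MeasurableSpace Ω} {P Ph : Measure Ω} {𝓕 : Filtration (Icc t₀ T) mΩ}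
  {X : ℝ → Ω → H} {x₀ : H} {h f : ℝ → H → ℝ} {φ : H → ℝ}

/-! ### Change of measure by a positive martingale -/

section ChangeOfMeasure

variable {Z : Ω → ℝ} {c : ℝ}

theorem integral_withDensity_div (hZ : Measurable Z) (hZ0 : ∀ ω, 0 < Z ω) (hc : 0 < c)
    (Y : Ω → ℝ) :
    ∫ ω, Y ω ∂(P.withDensity fun ω => ENNReal.ofReal (Z ω / c)) = c⁻¹ * ∫ ω, Z ω * Y ω ∂P := by
  rw [integral_withDensity_eq_integral_toReal_smul (hZ.div_const c).ennreal_ofReal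
    (Eventually.of_forall fun ω => ENNReal.ofReal_lt_top), ← integral_const_mul]
  refine integral_congr_ae (Eventually.of_forall fun ω => ?_)
  simp only [smul_eq_mul]
  rw [ENNReal.toReal_ofReal (div_pos (hZ0 ω) hc).le]
  ring

theorem integrable_withDensity_div (hZ : Measurable Z) (hZ0 : ∀ ω, 0 < Z ω) (hc : 0 < c)
    {Y : Ω → ℝ} :
    Integrable Y (P.withDensity fun ω => ENNReal.ofReal (Z ω / c)) ↔
      Integrable (fun ω => Z ω * Y ω) P := by
  rw [integrable_withDensity_iff_integrable_smul' (hZ.div_const c).ennreal_ofReal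
    (Eventually.of_forall fun ω => ENNReal.ofReal_lt_top)]
  have e : (fun ω => (ENNReal.ofReal (Z ω / c)).toReal • Y ω) = fun ω => c⁻¹ * (Z ω * Y ω) := by
    ext ω
    rw [ENNReal.toReal_ofReal (div_pos (hZ0 ω) hc).le, smul_eq_mul]
    ring
  rw [e, integrable_const_mul_iff (IsUnit.mk0 _ (inv_ne_zero hc.ne'))]

/-- Bayes' formula: against data known at time s, the terminal density may be replaced by its
conditional expectation given 𝓕 s. -/
theorem setIntegral_withDensity_div [IsFiniteMeasure P] (s : Icc t₀ T)
    (hZ : Measurable Z) (hZ0 : ∀ ω, 0 < Z ω) (hc : 0 < c) (hZi : Integrable Z P) {W Y : Ω → ℝ}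
    (hW : P[Z | 𝓕 s] =ᵐ[P] W) (hY : StronglyMeasurable[𝓕 s] Y)
    (hYi : Integrable Y (P.withDensity fun ω => ENNReal.ofReal (Z ω / c))) {B : Set Ω}
    (hB : MeasurableSet[𝓕 s] B) :
    ∫ ω in B, Y ω ∂(P.withDensity fun ω => ENNReal.ofReal (Z ω / c)) =
      c⁻¹ * ∫ ω in B, W ω * Y ω ∂P := by
  have hB' := 𝓕.le s B hB
  have hZY : Integrable (fun ω => B.indicator Y ω * Z ω) P := by
    simpa only [mul_comm] using
      (integrable_withDensity_div hZ hZ0 hc).1 (hYi.indicator hB')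
  rw [← integral_indicator hB', integral_withDensity_div hZ hZ0 hc, ← integral_indicator hB']
  congr 1
  have h1 := condExp_mul_of_stronglyMeasurable_left (hY.indicator hB) hZY hZi
  calc ∫ ω, Z ω * B.indicator Y ω ∂P = ∫ ω, (B.indicator Y * Z) ω ∂P := by
        simp only [Pi.mul_apply, mul_comm]
    _ = ∫ ω, (P[B.indicator Y * Z | 𝓕 s]) ω ∂P := (integral_condExp (𝓕.le s)).symm
    _ = ∫ ω, B.indicator (fun ω => W ω * Y ω) ω ∂P := by
        refine integral_congr_ae ?_
        filter_upwards [h1, hW] with ω h2 h3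
        rw [h2, Pi.mul_apply, h3, indicator_mul_right, mul_comm]

end ChangeOfMeasure

/-! ### Measurability of the feedback -/

/-- `fderiv` is measurable even where the function is not differentiable. This covers the times 0
and T, where nothing is known about D_x h. -/
theorem measurable_optFeedback (R : H →L[ℝ] H) (σ : ℝ) (h : ℝ → H → ℝ) (t : ℝ) :
    Measurable (optFeedback R σ h t) := by
  have h1 : Measurable fun x => fderiv ℝ (fun y => Real.log (h t y)) x := measurable_fderiv ℝ _
  have h2 := (InnerProductSpace.toDual ℝ H).symm.continuous.measurable.comp h1
  exact (R.continuous.measurable.comp h2).const_smul σ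

theorem IsMomentProcess.isStronglyProgressive_of_tame (hX : IsMomentProcess t₀ T P 𝓕 X)
    (ht₀ : 0 ≤ t₀) (hT : 0 < T) {u : ℝ → H → H} (hu : IsTame T u) (hm : ∀ t, Measurable (u t)) :
    IsStronglyProgressive 𝓕 (fun (s : Icc t₀ T) ω => u s (X s ω)) := by
  intro i
  -- Progressive measurability concerns every time, not almost every one, so the slices at 0 and T
  -- are glued to the strip separately.
  set w : ℝ × H → H := fun q => (Ioo 0 T ×ˢ (univ : Set H)).indicator (fun p => u p.1 p.2) q +
    (({0} : Set ℝ) ×ˢ (univ : Set H)).indicator (fun p => u 0 p.2) q +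
    (({T} : Set ℝ) ×ˢ (univ : Set H)).indicator (fun p => u T p.2) q with hw
  have hwm : Measurable w := (hu.measurable_indicator.add
    (((hm 0).comp measurable_snd).indicator ((measurableSet_singleton _).prod .univ))).add
    (((hm T).comp measurable_snd).indicator ((measurableSet_singleton _).prod .univ))
  have hweq : ∀ s ∈ Icc 0 T, ∀ x, w (s, x) = u s x := by
    intro s hs x
    rcases eq_or_lt_of_le hs.1 with h0 | h0
    · subst h0
      simp [hw, hT.ne]
    rcases eq_or_lt_of_le hs.2 with h1 | h1
    · subst h1
      simp [hw, hT.ne']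
    · simp [hw, indicator, h0, h1, h0.ne', h1.ne]
  have h1 := @measurable_comp_projIcc H _ _ _ _ _ _ Ω (𝓕 i) t₀ i i.2.1 X
    (fun ω => (hX.continuous_paths ω).mono (Icc_subset_Icc_right i.2.2))
    (fun r hr => hX.measurable_filtration i hr)
  have h2 : @Measurable (ℝ × Ω) (ℝ × H) (@Prod.instMeasurableSpace _ _ _ (𝓕 i)) _
      (fun p => (p.1, X (projIcc t₀ i i.2.1 p.1) p.2)) :=
    Measurable.prodMk (@measurable_fst _ _ _ (𝓕 i)) h1
  have h3 : @Measurable (Iic i × Ω) (ℝ × Ω) (Subtype.instMeasurableSpace.prod (𝓕 i))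
      (@Prod.instMeasurableSpace _ _ _ (𝓕 i)) (fun p => (((p.1 : Icc t₀ T) : ℝ), p.2)) :=
    Measurable.prodMk (m := Subtype.instMeasurableSpace.prod (𝓕 i))
      ((measurable_subtype_coe.comp measurable_subtype_coe).comp (@measurable_fst _ _ _ (𝓕 i)))
      (@measurable_snd _ _ _ (𝓕 i))
  have h4 := (hwm.comp (h2.comp h3)).stronglyMeasurable
  convert h4 using 1
  ext p
  have hp : ((p.1 : Icc t₀ T) : ℝ) ∈ Icc t₀ (i : ℝ) := ⟨(p.1 : Icc t₀ T).2.1, p.1.2⟩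
  simp only [Function.comp_apply]
  rw [hweq _ ⟨ht₀.trans hp.1, hp.2.trans i.2.2⟩, projIcc_of_mem i.2.1 hp]

end DoobTransform

/-! ### Doob's h-transform of the uncontrolled law. -/

section DoobMeasure

variable {H : Type*} [NormedAddCommGroup H] [InnerProductSpace ℝ H] [CompleteSpace H]
  [MeasurableSpace H] [BorelSpace H] [SecondCountableTopology H]
  {A : H →ₗ.[ℝ] H} {Q R : H →L[ℝ] H} {T σ t₀ : ℝ} {Ω : Type*}
  {mΩ : MeasurableSpace Ω} {P : Measure Ω} {𝓕 : Filtration (Icc t₀ T) mΩ}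
  {X : ℝ → Ω → H} {x₀ : H} {h f : ℝ → H → ℝ} {φ : H → ℝ}

/-- Doob's `h`-transform of the law `P` of `X`. -/
noncomputable abbrev doobMeasure (P : Measure Ω) (h : ℝ → H → ℝ) (X : ℝ → Ω → H) (T t₀ : ℝ)
    (x₀ : H) : Measure Ω :=
  P.withDensity fun ω => ENNReal.ofReal (h T (X T ω) / h t₀ x₀)

theorem IsMomentProcess.measurable_terminal (hX : IsMomentProcess t₀ T P 𝓕 X)
    (ht₀ : t₀ ∈ Icc 0 T) (hh : IsRegular A T h) : Measurable fun ω => h T (X T ω) :=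
  (hX.stronglyMeasurable_regular ht₀.1 hh ⟨T, ht₀.2, le_rfl⟩).measurable.mono (𝓕.le _) le_rfl

/-- The martingale property between t₀ and T gives E h(T, X_T) = h(t₀, x₀), so the density has total
mass 1. -/
theorem isProbabilityMeasure_doobMeasure [IsProbabilityMeasure P] (ht₀ : t₀ ∈ Icc 0 T)
    (hpos : ∀ t ∈ Icc 0 T, ∀ x, 0 < h t x)
    (hM : Martingale (fun (s : Icc t₀ T) ω => h s (X s ω)) 𝓕 P)
    (hinit : ∀ᵐ ω ∂P, X t₀ ω = x₀) :
    IsProbabilityMeasure (doobMeasure P h X T t₀ x₀) := by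
  have hT : T ∈ Icc 0 T := ⟨ht₀.1.trans ht₀.2, le_rfl⟩
  have h0 := hpos t₀ ht₀ x₀
  have h1 := hM.setIntegral_eq (i := ⟨t₀, le_rfl, ht₀.2⟩) (j := ⟨T, ht₀.2, le_rfl⟩) ht₀.2
    MeasurableSet.univ
  simp only [Measure.restrict_univ] at h1
  rw [integral_congr_ae (hinit.mono fun ω hω => congrArg (h t₀) hω)] at h1
  simp only [integral_const, probReal_univ, one_smul] at h1
  constructor
  rw [withDensity_apply _ MeasurableSet.univ, Measure.restrict_univ,
    ← ofReal_integral_eq_lintegral_ofReal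
      ((hM.integrable ⟨T, ht₀.2, le_rfl⟩).div_const _)
      (Eventually.of_forall fun ω => (div_pos (hpos T hT _) h0).le),
    integral_div, ← h1, div_self h0.ne', ENNReal.ofReal_one]

theorem IsMomentProcess.doobMeasure [IsFiniteMeasure P] (hX : IsMomentProcess t₀ T P 𝓕 X)
    (hT : 0 < T) (ht₀ : t₀ ∈ Icc 0 T) (hh : IsRegular A T h)
    (hpos : ∀ t ∈ Icc 0 T, ∀ x, 0 < h t x) :
    IsMomentProcess t₀ T (doobMeasure P h X T t₀ x₀) 𝓕 X where
  adapted := hX.adapted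
  continuous_paths := hX.continuous_paths
  moments n := by
    have hT' : T ∈ Icc t₀ T := ⟨ht₀.2, le_rfl⟩
    have h0 := hpos t₀ ht₀ x₀
    have hZ := hX.measurable_terminal ht₀ hh
    have hZ0 : ∀ ω, 0 < h T (X T ω) := fun ω => hpos T ⟨hT.le, le_rfl⟩ _
    -- The density is square integrable since h² is again regular. With Zy ≤ Z² + y², moments under
    -- the new measure reduce to moments of twice the order under P.
    have hZ2 := hX.integrable_regular hT ht₀.1 (hh.mul hT hh) hT'
    obtain ⟨C, hC⟩ := hX.moments (n * 2)
    simp only [pow_mul] at hC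
    have hle : ∀ s ω, h T (X T ω) * ‖X s ω‖ ^ n ≤
        h T (X T ω) * h T (X T ω) + (‖X s ω‖ ^ n) ^ 2 := fun s ω => by
      nlinarith [sq_nonneg (h T (X T ω) - ‖X s ω‖ ^ n), sq_nonneg (h T (X T ω)),
        sq_nonneg (‖X s ω‖ ^ n)]
    have hint : ∀ s ∈ Icc t₀ T, Integrable (fun ω => h T (X T ω) * ‖X s ω‖ ^ n) P := by
      intro s hs
      refine Integrable.mono' (hZ2.add (hC s hs).1)
        (hZ.mul ((hX.measurable hs).norm.pow_const n)).aestronglyMeasurable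
        (Eventually.of_forall fun ω => ?_)
      rw [Real.norm_of_nonneg (mul_nonneg (hZ0 ω).le (by positivity))]
      exact hle s ω
    refine ⟨(h t₀ x₀)⁻¹ * (∫ ω, h T (X T ω) * h T (X T ω) ∂P + C), fun s hs => ⟨?_, ?_⟩⟩
    · exact (integrable_withDensity_div hZ hZ0 h0).2 (hint s hs)
    · rw [integral_withDensity_div hZ hZ0 h0]
      refine mul_le_mul_of_nonneg_left ?_ (inv_pos.2 h0).le
      refine (integral_mono (hint s hs) (hZ2.add (hC s hs).1) (hle s)).trans ?_
      simp only [Pi.add_apply]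
      rw [integral_add hZ2 (hC s hs).1]
      linarith [(hC s hs).2]

theorem intervalIntegral_congr_Ioo {E : Type*} [NormedAddCommGroup E] [NormedSpace ℝ E]
    {a b : ℝ} (hab : a ≤ b) {f g : ℝ → E} (hfg : ∀ r ∈ Ioo a b, f r = g r) :
    ∫ r in a..b, f r = ∫ r in a..b, g r := by
  rw [intervalIntegral_eq_integral_Ioo hab, intervalIntegral_eq_integral_Ioo hab]
  exact setIntegral_congr_fun measurableSet_Ioo hfg

/-- The integrand of the martingale problem for the equation controlled by the feedback `u`. -/
noncomputable abbrev feedbackDrift (A : H →ₗ.[ℝ] H) (Q R : H →L[ℝ] H) (σ : ℝ) (u : ℝ → H → H)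
    (f : ℝ → H → ℝ) (t : ℝ) (x : H) : ℝ :=
  dt f t x + genL A Q σ f t x + inner ℝ (σ • R (u t x)) (Dx f t x)

theorem IsRegular.tame_feedbackDrift (hR : IsPosSqrt R Q) (hQ : IsCovarianceOperator Q)
    (hf : IsRegular A T f) {u : ℝ → H → H} (hu : IsTame T u) :
    IsTame T (feedbackDrift A Q R σ u f) :=
  (hf.tame_dt.add (hf.tame_genL hR hQ σ)).add ((hu.clm (σ • R)).inner hf.tame_Dx)

/-- The martingale problem for the controlled equation, from the one for the uncontrolled equation
with the test function `h f`. -/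
theorem IsControlled.martingale_doobMeasure [IsProbabilityMeasure P] (hT : 0 < T)
    (ht₀ : t₀ ∈ Icc 0 T) (hR : IsPosSqrt R Q) (hQ : IsCovarianceOperator Q)
    (hc : IsControlled A Q R σ T t₀ x₀ P 𝓕 (fun _ _ => 0) X) (hh : IsRegular A T h)
    (hKBE : SolvesKBE A Q σ T φ h) (hpos : ∀ t ∈ Icc 0 T, ∀ x, 0 < h t x)
    (hu : IsTame T (optFeedback R σ h)) (hf : IsRegular A T f) :
    Martingale (fun (s : Icc t₀ T) ω => f s (X s ω) -
      ∫ r in t₀..s, feedbackDrift A Q R σ (optFeedback R σ h) f r (X r ω)) 𝓕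
      (doobMeasure P h X T t₀ x₀) := by
  have hX := hc.isMomentProcess
  have hM := hc.martingale_of_solvesKBE ht₀.1 hh hKBE
  have := isProbabilityMeasure_doobMeasure ht₀ hpos hM hc.initial
  have hXh := hX.doobMeasure (x₀ := x₀) hT ht₀ hh hpos
  have h0 := hpos t₀ ht₀ x₀
  have hZ := hX.measurable_terminal ht₀ hh
  have hZ0 : ∀ ω, 0 < h T (X T ω) := fun ω => hpos T ⟨hT.le, le_rfl⟩ _
  have hZi := hM.integrable ⟨T, ht₀.2, le_rfl⟩
  set Ph := HopfCole.doobMeasure P h X T t₀ x₀ with hPh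
  have key : ∀ (s : Icc t₀ T) (Y : Ω → ℝ), StronglyMeasurable[𝓕 s] Y → Integrable Y Ph →
      ∀ B, MeasurableSet[𝓕 s] B →
        ∫ ω in B, Y ω ∂Ph = (h t₀ x₀)⁻¹ * ∫ ω in B, h s (X s ω) * Y ω ∂P :=
    fun s Y hY hYi B hB => setIntegral_withDensity_div s hZ hZ0 h0 hZi
      (hM.2 s ⟨T, ht₀.2, le_rfl⟩ s.2.2) hY hYi hB
  have hg := hf.tame_feedbackDrift (σ := σ) hR hQ hu
  set g := feedbackDrift A Q R σ (optFeedback R σ h) f with hgdef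
  have hgPh := hXh.integrable_prod ht₀.1 ht₀.2 hg
  have hhg := hX.integrable_prod ht₀.1 ht₀.2 (hh.tame.mul hg)
  have hfi : ∀ s : Icc t₀ T, Integrable (fun ω => f s (X s ω)) Ph := fun s =>
    hXh.integrable_regular hT ht₀.1 hf s.2
  have hMi : ∀ s : Icc t₀ T, Integrable (fun ω => f s (X s ω) - ∫ r in t₀..s, g r (X r ω)) Ph :=
    fun s => (hfi s).sub (integrable_intervalIntegral hgPh s.2)
  have hadp : ∀ s : Icc t₀ T,
      StronglyMeasurable[𝓕 s] (fun ω => f s (X s ω) - ∫ r in t₀..s, g r (X r ω)) := fun s =>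
    (hX.stronglyMeasurable_regular ht₀.1 hf s).sub (hX.stronglyMeasurable_integral ht₀.1 hg s)
  have hhfi : ∀ s : Icc t₀ T, Integrable (fun ω => h s (X s ω) * f s (X s ω)) P := fun s =>
    hX.integrable_regular hT ht₀.1 (hh.mul hT hf) s.2
  -- The martingale problem under P with test function h f, whose drift is h times the controlled
  -- drift of f.
  have hN : Martingale (fun (s : Icc t₀ T) ω => h s (X s ω) * f s (X s ω) -
      ∫ r in t₀..s, h r (X r ω) * g r (X r ω)) 𝓕 P := by
    have h1 := hc.martingale_problem _ (hh.mul hT hf)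
    convert h1 using 1
    funext s ω
    congr 1
    refine intervalIntegral_congr_Ioo s.2.1 fun r hr => ?_
    rw [hKBE.doob_transform hR hQ hpos hf.toIsC12 ⟨ht₀.1.trans_lt hr.1, hr.2.trans_le s.2.2⟩]
    simp [hgdef, feedbackDrift]
  refine ⟨hadp, fun i j hij => (ae_eq_condExp_of_forall_setIntegral_eq (𝓕.le i) (hMi j)
    (fun B _ _ => (hMi i).integrableOn) (fun B hB _ => ?_) (hadp i).aestronglyMeasurable).symm⟩
  have hij' : (i : ℝ) ≤ j := hij
  have e1 : ∀ k : Icc t₀ T, ∫ ω in B, (f k (X k ω) - ∫ r in t₀..k, g r (X r ω)) ∂Ph =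
      ∫ ω in B, f k (X k ω) ∂Ph - ∫ r in t₀..k, ∫ ω in B, g r (X r ω) ∂Ph := fun k => by
    rw [integral_sub (hfi k).integrableOn (integrable_intervalIntegral hgPh k.2).integrableOn]
    congr 1
    exact setIntegral_intervalIntegral hgPh B k.2
  have e2 : ∀ k : Icc t₀ T, ∫ ω in B, (h k (X k ω) * f k (X k ω) -
        ∫ r in t₀..k, h r (X r ω) * g r (X r ω)) ∂P =
      ∫ ω in B, h k (X k ω) * f k (X k ω) ∂P -
        ∫ r in t₀..k, ∫ ω in B, h r (X r ω) * g r (X r ω) ∂P := fun k => by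
    rw [integral_sub (hhfi k).integrableOn (integrable_intervalIntegral hhg k.2).integrableOn]
    congr 1
    exact setIntegral_intervalIntegral hhg B k.2
  have hstart : t₀ ∈ Icc t₀ T := ⟨le_rfl, ht₀.2⟩
  have d1 := intervalIntegral.integral_add_adjacent_intervals
    (intervalIntegrable_setIntegral hgPh B hstart i.2)
    (intervalIntegrable_setIntegral hgPh B i.2 j.2)
  have d2 := intervalIntegral.integral_add_adjacent_intervals
    (intervalIntegrable_setIntegral hhg B hstart i.2)
    (intervalIntegrable_setIntegral hhg B i.2 j.2)
  -- Fubini has put time outside, so Bayes' formula applies at each r separately, with density h(r,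
  -- X_r): B belongs to 𝓕 i, hence to 𝓕 r.
  have d3 : ∫ r in (i : ℝ)..j, ∫ ω in B, g r (X r ω) ∂Ph =
      (h t₀ x₀)⁻¹ * ∫ r in (i : ℝ)..j, ∫ ω in B, h r (X r ω) * g r (X r ω) ∂P := by
    rw [← intervalIntegral.integral_const_mul]
    refine intervalIntegral_congr_Ioo hij' fun r hr => ?_
    have hr1 : r ∈ Icc t₀ T := ⟨i.2.1.trans hr.1.le, hr.2.le.trans j.2.2⟩
    have hr2 : r ∈ Ioo 0 T := ⟨(ht₀.1.trans i.2.1).trans_lt hr.1, hr.2.trans_le j.2.2⟩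
    exact key ⟨r, hr1⟩ _ (hX.stronglyMeasurable_tame hg ⟨r, hr1⟩ hr2)
      (hXh.integrable_tame hg hr1 hr2) B (𝓕.mono (show i ≤ ⟨r, hr1⟩ from hr.1.le) B hB)
  have f1 := key i _ (hX.stronglyMeasurable_regular ht₀.1 hf i) (hfi i) B hB
  have f2 := key j _ (hX.stronglyMeasurable_regular ht₀.1 hf j) (hfi j) B (𝓕.mono hij B hB)
  have n1 := hN.setIntegral_eq hij hB
  rw [e2, e2] at n1
  rw [e1, e1, f1, f2, ← d1, d3]
  linear_combination (h t₀ x₀)⁻¹ * n1 + (h t₀ x₀)⁻¹ * d2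

theorem IsControlled.doobMeasure [IsProbabilityMeasure P] (hT : 0 < T)
    (ht₀ : t₀ ∈ Icc 0 T) (hR : IsPosSqrt R Q) (hQ : IsCovarianceOperator Q)
    (hc : IsControlled A Q R σ T t₀ x₀ P 𝓕 (fun _ _ => 0) X) (hh : IsRegular A T h)
    (hKBE : SolvesKBE A Q σ T φ h) (hpos : ∀ t ∈ Icc 0 T, ∀ x, 0 < h t x)
    (hu : IsTame T (optFeedback R σ h)) :
    IsControlled A Q R σ T t₀ x₀ (doobMeasure P h X T t₀ x₀) 𝓕
      (fun s ω => optFeedback R σ h s (X s ω)) X := by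
  have hX := hc.isMomentProcess
  have := isProbabilityMeasure_doobMeasure ht₀ hpos
    (hc.martingale_of_solvesKBE ht₀.1 hh hKBE) hc.initial
  have hXh := hX.doobMeasure (x₀ := x₀) hT ht₀ hh hpos
  exact
  { progressive := hX.isStronglyProgressive_of_tame ht₀.1 hT hu (measurable_optFeedback R σ h)
    square_integrable := by
      have h1 := hXh.integrable_prod ht₀.1 ht₀.2 (hu.inner hu)
      simpa only [real_inner_self_eq_norm_sq] using h1
    adapted := hX.adapted
    continuous_paths := hX.continuous_paths
    initial := (withDensity_absolutelyContinuous _ _).ae_le hc.initial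
    moments := hXh.moments
    martingale_problem := fun f hf =>
      hc.martingale_doobMeasure hT ht₀ hR hQ hh hKBE hpos hu hf }

end DoobMeasure

end HopfCole

/-! ### The main theorem. -/

theorem mainTheorem2 {H : Type*} [NormedAddCommGroup H] [InnerProductSpace ℝ H]
    [CompleteSpace H] [SecondCountableTopology H] [MeasurableSpace H] [BorelSpace H]
    (T σ : ℝ) (hT : 0 < T) (hσ : 0 < σ)
    (S : ℝ → H →L[ℝ] H) (hS : HopfCole.IsC0Semigroup S)
    (A : H →ₗ.[ℝ] H) (hA : HopfCole.IsGenerator S A)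
    (Q R : H →L[ℝ] H) (hQ : HopfCole.IsCovarianceOperator Q) (hR : HopfCole.IsPosSqrt R Q)
    (G : H → ℝ) (hG : Measurable G)
    (hGint : ∀ t ∈ Icc 0 T, ∀ x,
      Integrable (fun z => Real.exp (-G z)) (HopfCole.transitionLaw S Q σ t x))
    (h V : ℝ → H → ℝ) (hh : h = HopfCole.hFun S Q σ T G) (hV : V = HopfCole.VFun S Q σ T G) :
    -- `h` solves the Kolmogorov backward equation as soon as it is regular
    (HopfCole.IsRegular A T h →
      HopfCole.SolvesKBE A Q σ T (fun x => Real.exp (-G x)) h) ∧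
    -- whenever `h` solves the Kolmogorov backward equation, `V = -log h` solves the HJB equation,
    -- the feedback `σ Q^{1/2} D_x log h` is the unique minimiser in it, and the generator of the
    -- controlled equation is Doob's transform of the uncontrolled one
    (HopfCole.SolvesKBE A Q σ T (fun x => Real.exp (-G x)) h →
      HopfCole.SolvesHJB A Q R σ T G V ∧
      (∀ t ∈ Ioo 0 T, ∀ x,
        HopfCole.optFeedback R σ h t x = -(σ • R (HopfCole.Dx V t x)) ∧
        HopfCole.optFeedback R σ h t x = (h t x)⁻¹ • (σ • R (HopfCole.Dx h t x)) ∧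
        σ • R (HopfCole.optFeedback R σ h t x) =
          σ ^ 2 • Q (HopfCole.Dx (fun s y => Real.log (h s y)) t x) ∧
        (∀ a : H, a ≠ HopfCole.optFeedback R σ h t x →
          inner ℝ (HopfCole.optFeedback R σ h t x) (σ • R (HopfCole.Dx V t x))
              + 1 / 2 * ‖HopfCole.optFeedback R σ h t x‖ ^ 2 <
            inner ℝ a (σ • R (HopfCole.Dx V t x)) + 1 / 2 * ‖a‖ ^ 2) ∧
        HopfCole.dt V t x + HopfCole.genL A Q σ V t x
          + (⨅ a : H, (inner ℝ a (σ • R (HopfCole.Dx V t x)) + 1 / 2 * ‖a‖ ^ 2)) = 0) ∧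
      (∀ f : ℝ → H → ℝ, HopfCole.IsC12 A T f → ∀ t ∈ Ioo 0 T, ∀ x,
        (h t x)⁻¹ * (HopfCole.dt (fun s y => h s y * f s y) t x
            + HopfCole.genL A Q σ (fun s y => h s y * f s y) t x) =
          HopfCole.dt f t x + HopfCole.genL A Q σ f t x
            + inner ℝ (σ • R (HopfCole.optFeedback R σ h t x)) (HopfCole.Dx f t x))) ∧
    -- if `h` and `V` are regular, the feedback is the optimal control, and the optimally controlled
    -- law is Doob's `h`-transform of the uncontrolled one
    (HopfCole.IsRegular A T h → HopfCole.IsRegular A T V →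
      ∀ t₀ ∈ Icc 0 T, ∀ (x₀ : H) (Ω : Type*) (mΩ : MeasurableSpace Ω) (P : Measure Ω)
        (_ : IsProbabilityMeasure P) (𝓕 : Filtration (Icc t₀ T) mΩ) (X : ℝ → Ω → H),
      (∀ α : ℝ → Ω → H, HopfCole.IsControlled A Q R σ T t₀ x₀ P 𝓕 α X →
        Integrable (HopfCole.pathCost T t₀ G α X) P ∧
        V t₀ x₀ ≤ HopfCole.cost P T t₀ G α X ∧
        (HopfCole.cost P T t₀ G α X = V t₀ x₀ ↔
          ∀ᵐ p ∂((volume.restrict (Icc t₀ T)).prod P),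
            α p.1 p.2 = HopfCole.optFeedback R σ h p.1 (X p.1 p.2))) ∧
      (HopfCole.IsControlled A Q R σ T t₀ x₀ P 𝓕 (fun _ _ => 0) X →
        (∀ s : Icc t₀ T,
          P[fun ω => Real.exp (-G (X T ω)) | 𝓕 s] =ᵐ[P] fun ω => h s (X s ω)) ∧
        ∀ Ph : Measure Ω,
          Ph = P.withDensity (fun ω => ENNReal.ofReal (h T (X T ω) / h t₀ x₀)) →
          IsProbabilityMeasure Ph ∧
          HopfCole.IsControlled A Q R σ T t₀ x₀ Ph 𝓕
            (fun s ω => HopfCole.optFeedback R σ h s (X s ω)) X ∧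
          HopfCole.cost Ph T t₀ G (fun s ω => HopfCole.optFeedback R σ h s (X s ω)) X
            = V t₀ x₀)) := by
  subst hh hV
  set h := HopfCole.hFun S Q σ T G with hdef
  have hpos : ∀ t ∈ Icc 0 T, ∀ x, 0 < h t x := fun t ht x =>
    HopfCole.hFun_pos hS hR hQ hGint ht x
  have partA : HopfCole.IsRegular A T h →
      HopfCole.SolvesKBE A Q σ T (fun x => Real.exp (-G x)) h := fun hreg =>
    HopfCole.hFun_solvesKBE hS hA hR hQ hG hGint hreg
  refine ⟨partA, fun hKBE => ?_, fun hreg hVreg t₀ ht₀ x₀ Ω mΩ P _ 𝓕 X => ?_⟩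
  · have hHJB : HopfCole.SolvesHJB A Q R σ T G (HopfCole.VFun S Q σ T G) :=
      hKBE.solvesHJB hR hQ hpos
    refine ⟨hHJB, fun t ht x => ?_, fun f hf t ht x => ?_⟩
    · have e : HopfCole.optFeedback R σ h t x =
          -(σ • R (HopfCole.Dx (HopfCole.VFun S Q σ T G) t x)) :=
        HopfCole.optFeedback_eq_neg hKBE.isC12 hpos ht x
      refine ⟨e, HopfCole.optFeedback_eq_smul hKBE.isC12 hpos ht x, hR.smul_optFeedback h t x,
        fun a ha => ?_, ?_⟩
      · rw [HopfCole.inner_add_half_norm_sq, HopfCole.inner_add_half_norm_sq, e, neg_add_cancel,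
          norm_zero]
        have h1 : a + σ • R (HopfCole.Dx (HopfCole.VFun S Q σ T G) t x) ≠ 0 := fun h2 =>
          ha (e ▸ eq_neg_of_add_eq_zero_left h2)
        have h2 := pow_pos (norm_pos_iff.2 h1) 2
        linarith
      · rw [HopfCole.iInf_inner_add_half_norm_sq]
        linarith [hHJB.eqn t ht x]
    · rw [hKBE.doob_transform hR hQ hpos hf ht x,
        inv_mul_cancel_left₀ (hpos t (Ioo_subset_Icc_self ht) x).ne']
  · have hKBE := partA hreg
    have hHJB : HopfCole.SolvesHJB A Q R σ T G (HopfCole.VFun S Q σ T G) :=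
      hKBE.solvesHJB hR hQ hpos
    have hu : ∀ t ∈ Ioo 0 T, ∀ x, HopfCole.optFeedback R σ h t x =
        -(σ • R (HopfCole.Dx (HopfCole.VFun S Q σ T G) t x)) := fun t ht x =>
      HopfCole.optFeedback_eq_neg hKBE.isC12 hpos ht x
    -- Polynomial growth of the feedback comes from the regularity of V; that of h alone would not
    -- do, as 1/h has no a priori bound.
    have hut : HopfCole.IsTame T (HopfCole.optFeedback R σ h) :=
      (hVreg.tame_Dx.clm (-(σ • R))).congr fun t ht x => by
        rw [hu t ht x]
        rfl
    refine ⟨fun α hα => hα.verification ht₀ hR hVreg hHJB hu, fun hc => ?_⟩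
    have hM := hc.martingale_of_solvesKBE ht₀.1 hreg hKBE
    refine ⟨fun s => ?_, fun Ph hPh => ?_⟩
    · have h1 := hM.2 s ⟨T, ht₀.2, le_rfl⟩ s.2.2
      simpa only [hKBE.terminal] using h1
    · subst hPh
      have hprob := HopfCole.isProbabilityMeasure_doobMeasure ht₀ hpos hM hc.initial
      have hopt := hc.doobMeasure hT ht₀ hR hQ hreg hKBE hpos hut
      -- Under the transformed law the control is the feedback itself, so the equality case of the
      -- verification theorem gives the cost.
      exact ⟨hprob, hopt, (hopt.verification ht₀ hR hVreg hHJB hu).2.2.2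
        (Eventually.of_forall fun _ => rfl)⟩
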